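/- \textbf{Setting.} Let $m\ge 0$ and let $V=(V_{ij})_{i,j\in\{1,2\}}:\mathbb R\to\mathbb C^{2\times 2}$. Let $H_V$ be the maximal Dirac operator in $L^2(\mathbb R)^2$, \[ H_V\begin{pmatrix}\psi_1\\ \psi_2\end{pmatrix}=\begin{pmatrix}(-i\partial_x+V_{12})\psi_2+(V_{11}+m)\psi_1\\ (-i\partial_x+V_{21})\psi_1+(V_{22}-m)\psi_2\end{pmatrix}, \] taken in the sense of distributions, with domain $\mathcal D(H_V)=\{\psi\in L^2(\mathbb R)^2: H_V\psi\in L^2(\mathbb R)^2\}$. In conditions with an index $\pm$, ``near $\pm\infty$'' means for all $x$ with $\pm x$ large enough. \textbf{Assumptions.} Let $N\ge 0$ be an integer, let $V_{11},V_{22}\in W^{N+1,\infty}_{\rm loc}(\mathbb R)$ (continuous representatives) and $V_{12},V_{21}\in W^{N,\infty}_{\rm loc}(\mathbb R)$ with $V_{12}=V_{21}$ almost everywhere, and put $F(x)=\int_0^x(\mathrm{Im}\,V_{11}+\mathrm{Im}\,V_{22})\,dt$. Let $\mu_\pm\in(0,1]$, $\varepsilon_\pm\in(0,\mu_\pm/2)$,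 $\nu_\pm\in\mathbb R$ and let $f:\mathbb R\to\mathbb R$ be continuous, such that \begin{enumerate} \item $\limsup_{x\to-\infty}(\mathrm{Im}\,V_{11}+\mathrm{Im}\,V_{22})<0<\liminf_{x\to+\infty}(\mathrm{Im}\,V_{11}+\mathrm{Im}\,V_{22})$, and $|\mathrm{Im}\,V_{11}+\mathrm{Im}\,V_{22}|\ge\mu_\pm(|\mathrm{Im}\,V_{11}|+|\mathrm{Im}\,V_{22}|)$ near $\pm\infty$; \item $\int_0^x(\mathrm{Im}\,V_{12}+\mathrm{Im}\,V_{21})\,dt\le 2\varepsilon_\pm F(x)$ near $\pm\infty$; \item $f$ is unbounded at $+\infty$ and at $-\infty$, $|f|\le C F$ near $\pm\infty$ for some $C>0$, and, if $\nu_\pm<0$, $|f|$ is bounded away from $0$ near $\pm\infty$; \item as $x\to\pm\infty$, $|V_{ii}^{(k)}|=\mathcal O(|f|^{k\nu_\pm}|V_{ii}|)$ for $i=1,2$, $1\le k\le N+1$, and $|(V_{21}-V_{12})^{(k)}|=\mathcal O(|f|^{(k+1)\nu_\pm})$ for $0\le k\le N$ (almost everywhere; the last condition is automatic here). \end{enumerate}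 \textbf{Cut-off.} Fix $\varepsilon_1\in(0,1)$ and a small $\eta>0$, namely with $\eta<\min\{\mu_-,\mu_+\}$ and $\varepsilon_\pm<(\mu_\pm-\eta)/\sqrt{\eta^2+(2+2\eta)^2}$. If $\mathrm{Re}\,V_{11}$, $\mathrm{Re}\,V_{22}$ and $\mathrm{Im}\,V_{11}-\mathrm{Im}\,V_{22}$ are all bounded at $\pm\infty$, put $M_\pm=0$; otherwise put $M_\pm=\frac1\eta\max\{|\mathrm{Re}\,V_{11}+m|,|\mathrm{Re}\,V_{22}-m|,|\mathrm{Im}\,V_{11}-\mathrm{Im}\,V_{22}|\}$. Let $g_\pm=\max\{M_\pm,|f|^{2\nu_\pm/(1-\varepsilon_1)}\}$ if $\nu_\pm>0$ and $g_\pm=M_\pm$ if $\nu_\pm\le0$. Let $\delta^\pm_\lambda=\inf\{x\ge0: g_\pm(\pm x)=\lambda\}\in[0,+\infty]$ ($\inf\emptyset=+\infty$). Say that \emph{no cut-off is needed at} $\pm\infty$ if those three functions are bounded at $\pm\infty$ and $\nu_\pm\le 0$; in that case put $\Delta^\pm_\lambda=0$, and otherwise $\Delta^\pm_\lambda=1/\delta^\pm_\lambda$.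 For all large $\lambda$ let $\xi=\xi_\lambda:\mathbb R\to[0,1]$ be $C^\infty$, equal to $1$ on $(-\delta^-_\lambda+\Delta^-_\lambda,\delta^+_\lambda-\Delta^+_\lambda)$ and to $0$ outside $(-\delta^-_\lambda,\delta^+_\lambda)$, with $(\Delta^\pm_\lambda)^{j}\|\xi^{(j)}\|_{L^\infty(\mathbb R_\pm)}\le C$, $j=1,2$, where $C$ does not depend on $\lambda$. \textbf{Pseudomode.} Put $k_1(x)=\exp(-i\int_0^xV_{21})$, $k_2(x)=\exp(-i\int_0^xV_{12})$, $V_\lambda=(\lambda-m-V_{11})(\lambda+m-V_{22})$ and $K_\lambda=\frac{k_1}{k_2}\frac1{\lambda+m-V_{22}}$. Define $\psi_{-1},\dots,\psi_{N-1}$ by $\psi_k(0)=0$, $\psi_{-1}'=i\lambda^{-1}V_\lambda^{1/2}$ (principal branch) and \[ \psi_{\ell+1}'=\frac1{2\psi_{-1}'}\Big(\psi_\ell''+\frac{K_\lambda'}{K_\lambda}\psi_\ell'-\sum_{j=0}^{\ell}\psi_j'\psi_{\ell-j}'\Big),\qquad \ell\ge-1, \] on $(-\delta^-_\lambda,\delta^+_\lambda)$,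 and let $P=\sum_{k=-1}^{N-1}\lambda^{-k}\psi_k$, $u=\xi e^{-P}$, $v=\frac{k_1}{k_2}\frac{-iu'}{\lambda+m-V_{22}}$, $\Psi_{\lambda,N}=(k_1u,\,k_2v)^{T}$, and \[ \kappa(\lambda)=\frac{\Big\|\frac{k_1e^{-P}}{\lambda+m-V_{22}}\xi''\Big\|_{L^2}+\Big\|\frac{k_1e^{-P}}{\lambda+m-V_{22}}\Big(2P'-\frac{K_\lambda'}{K_\lambda}\Big)\xi'\Big\|_{L^2}}{\sqrt{\|k_1e^{-P}\xi\|_{L^2}^2+\Big\|\frac{k_1(-i\partial_x)(e^{-P}\xi)}{\lambda+m-V_{22}}\Big\|_{L^2}^2}} . \] \textbf{Theorem.} As $\lambda\to+\infty$, $\kappa(\lambda)\to0$; more precisely $\kappa=\kappa_-+\kappa_+$ for large $\lambda$, where $\kappa_\pm(\lambda)=0$ for large $\lambda$ if no cut-off is needed at $\pm\infty$, and $\kappa_\pm(\lambda)=\mathcal O(\exp(-d_1F(\pm d_2\delta^\pm_\lambda)))$ with some $d_1,d_2>0$ otherwise. Moreover, for all sufficiently large $a_\pm>0$ there are functions $\sigma_\pm^{(N)}$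 such that, for all large $\lambda$, $0\ne\Psi_{\lambda,N}\in\mathcal D(H_V)$ and \[ \frac{\|(H_V-\lambda)\Psi_{\lambda,N}\|}{\|\Psi_{\lambda,N}\|}\le\kappa(\lambda)+\sigma_-^{(N)}(\lambda)+\sigma_+^{(N)}(\lambda), \] where, for each of the two signs, \begin{enumerate} \item[i)] if $V_{11}$ or $V_{22}$ is not bounded at $\pm\infty$, then $\sigma_\pm^{(N)}(\lambda)=\mathcal O\big(\lambda^{-\frac{1+\varepsilon_1}2(N+1)+1}\big)$ if $\nu_\pm>0$, and, if $\nu_\pm\le0$, \[ \sigma_\pm^{(N)}(\lambda)=\mathcal O\Big(\max\Big\{\lambda^{-(N+1)},\ \lambda^{-N}\sup_{a_\pm<\pm x<\delta^\pm_\lambda}\frac{|f(x)|^{(N+1)\nu_\pm}\max\{|V_{11}(x)|,|V_{22}(x)|\}}{|\lambda+m-V_{22}(x)|}\Big\}\Big) \] with a finite supremum for large $\lambda$; \item[ii)] if $V_{11}$ and $V_{22}$ are bounded at $\pm\infty$, then $\sigma_\pm^{(N)}(\lambda)=\mathcal O(\lambda^{-(N+1)})$ if $\nu_\pm\le0$ and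 $\sigma_\pm^{(N)}(\lambda)=\mathcal O\big(\lambda^{-\frac{1+\varepsilon_1}2(N+1)}\big)$ if $\nu_\pm>0$. \end{enumerate} -/

import Mathlib

open MeasureTheory Filter Topology Asymptotics
open scoped ContDiff

noncomputable section

namespace DiracWKB

/-! ### The two ends of the real line -/

/-- The two ends `-∞` and `+∞` of the real line. Every quantity carrying the index `±`
is a function on `Side`. -/
inductive Side where
  | minus
  | plus

/-- The sign of an end. -/
def Side.sgn : Side → ℝ
  | .minus => -1
  | .plus => 1

/-- The filter of neighbourhoods of an end. -/
def Side.filter : Side → Filter ℝ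
  | .minus => atBot
  | .plus => atTop

/-! ### Function spaces -/

/-- The norm of `L²(ℝ)`. -/
def l2norm {E : Type*} [NormedAddCommGroup E] (h : ℝ → E) : ℝ :=
  (eLpNorm h 2 volume).toReal

/-- The space `L^∞_loc(ℝ)`. -/
def MemLinftyLoc (g : ℝ → ℂ) : Prop :=
  ∀ K : Set ℝ, IsCompact K → MemLp g ⊤ (volume.restrict K)

/-- `h` is the `n`-th distributional derivative of `g`, both being locally integrable. (By
linearity it is enough to use real-valued test functions.) -/
structure IsWeakDeriv (n : ℕ) (g h : ℝ → ℂ) : Prop where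
  locallyIntegrable_left : LocallyIntegrable g volume
  locallyIntegrable_right : LocallyIntegrable h volume
  integral_eq : ∀ φ : ℝ → ℝ, ContDiff ℝ ∞ φ → HasCompactSupport φ →
    ∫ x, iteratedDeriv n φ x • g x = (-1) ^ n * ∫ x, φ x • h x

/-- The Sobolev space `W^{k,∞}_loc(ℝ)`; in particular `W^{0,∞}_loc = L^∞_loc`. -/
def MemWLoc (k : ℕ) (g : ℝ → ℂ) : Prop :=
  ∀ n ≤ k, ∃ h : ℝ → ℂ, IsWeakDeriv n g h ∧ MemLinftyLoc h

/-! ### The Dirac operator -/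

/-- `IsDiracImage m V Ψ Φ` says that `Ψ` lies in the domain of the maximal Dirac operator `H_V`
in `L²(ℝ)²` and that `H_V Ψ = Φ`: both `Ψ` and `Φ` are square integrable, and
`(-i ∂ + V₁₂) Ψ₂ + (V₁₁ + m) Ψ₁ = Φ₁` and `(-i ∂ + V₂₁) Ψ₁ + (V₂₂ - m) Ψ₂ = Φ₂`
hold in the sense of distributions. -/
structure IsDiracImage (m : ℝ) (V : ℝ → Matrix (Fin 2) (Fin 2) ℂ)
    (Ψ Φ : ℝ → EuclideanSpace ℂ (Fin 2)) : Prop where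
  memLp : MemLp Ψ 2 volume
  memLp_image : MemLp Φ 2 volume
  fst_eq : ∀ φ : ℝ → ℝ, ContDiff ℝ ∞ φ → HasCompactSupport φ →
    (∫ x, deriv φ x • (Complex.I * Ψ x 1))
        + ∫ x, φ x • (V x 0 1 * Ψ x 1 + (V x 0 0 + m) * Ψ x 0)
      = ∫ x, φ x • Φ x 0
  snd_eq : ∀ φ : ℝ → ℝ, ContDiff ℝ ∞ φ → HasCompactSupport φ →
    (∫ x, deriv φ x • (Complex.I * Ψ x 0))
        + ∫ x, φ x • (V x 1 0 * Ψ x 0 + (V x 1 1 - m) * Ψ x 1)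
      = ∫ x, φ x • Φ x 1

/-- `H_V Ψ` is determined by `Ψ` as an element of `L²`. -/
theorem IsDiracImage.ae_unique {m : ℝ} {V : ℝ → Matrix (Fin 2) (Fin 2) ℂ}
    {Ψ Φ Φ' : ℝ → EuclideanSpace ℂ (Fin 2)} (h : IsDiracImage m V Ψ Φ)
    (h' : IsDiracImage m V Ψ Φ') : Φ =ᵐ[volume] Φ' := by
  have hc : ∀ {Θ : ℝ → EuclideanSpace ℂ (Fin 2)}, MemLp Θ 2 volume → ∀ i : Fin 2,
      LocallyIntegrable (fun x => Θ x i) volume := by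
    intro Θ hΘ i
    have : MemLp (fun x => Θ x i) 2 volume :=
      (EuclideanSpace.proj (𝕜 := ℂ) i : EuclideanSpace ℂ (Fin 2) →L[ℂ] ℂ).comp_memLp' hΘ
    exact this.locallyIntegrable (by norm_num)
  have h0 := ae_eq_of_integral_contDiff_smul_eq (hc h.memLp_image 0) (hc h'.memLp_image 0)
    (fun φ h1 h2 => (h.fst_eq φ h1 h2).symm.trans (h'.fst_eq φ h1 h2))
  have h1 := ae_eq_of_integral_contDiff_smul_eq (hc h.memLp_image 1) (hc h'.memLp_image 1)
    (fun φ h1 h2 => (h.snd_eq φ h1 h2).symm.trans (h'.snd_eq φ h1 h2))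
  filter_upwards [h0, h1] with x hx0 hx1
  ext i
  fin_cases i
  · exact hx0
  · exact hx1

/-! ### The hypotheses on the potential -/

/-- `F(x) = ∫₀ˣ (Im V₁₁ + Im V₂₂)`. -/
def F (V : ℝ → Matrix (Fin 2) (Fin 2) ℂ) (x : ℝ) : ℝ :=
  ∫ t in (0 : ℝ)..x, ((V t 0 0).im + (V t 1 1).im)

/-- The standing hypotheses on the potential `V`, of regularity index `N`. The diagonal entries
are the continuous representatives of their classes; statements about derivatives
near an end hold almost everywhere. -/
structure Admissible (N : ℕ) (V : ℝ → Matrix (Fin 2) (Fin 2) ℂ) (f : ℝ → ℝ)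
    (μ ε ν : Side → ℝ) : Prop where
  diag_continuous : ∀ i, Continuous fun x => V x i i
  diag_sobolev : ∀ i, MemWLoc (N + 1) fun x => V x i i
  offDiag_sobolev : ∀ i j, i ≠ j → MemWLoc N fun x => V x i j
  limsup_neg : limsup (fun x => (((V x 0 0).im + (V x 1 1).im : ℝ) : EReal)) atBot < 0
  liminf_pos : 0 < liminf (fun x => (((V x 0 0).im + (V x 1 1).im : ℝ) : EReal)) atTop
  mu_mem : ∀ s, 0 < μ s ∧ μ s ≤ 1
  im_ge : ∀ s, ∀ᶠ x in Side.filter s,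
    μ s * (|(V x 0 0).im| + |(V x 1 1).im|) ≤ |(V x 0 0).im + (V x 1 1).im|
  eps_mem : ∀ s, 0 < ε s ∧ ε s < μ s / 2
  offDiag_le : ∀ s, ∀ᶠ x in Side.filter s,
    ∫ t in (0 : ℝ)..x, ((V t 0 1).im + (V t 1 0).im) ≤ 2 * ε s * F V x
  f_continuous : Continuous f
  f_unbounded : ∀ s, ¬ f =O[Side.filter s] fun _ => (1 : ℝ)
  f_away_zero : ∀ s, ν s < 0 → ∃ c > 0, ∀ᶠ x in Side.filter s, c ≤ |f x|
  f_le : ∀ s, ∃ C > 0, ∀ᶠ x in Side.filter s, |f x| ≤ C * F V x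
  diag_deriv : ∀ s i, ∀ n, 1 ≤ n → n ≤ N + 1 → ∃ W, IsWeakDeriv n (fun x => V x i i) W ∧
    W =O[Side.filter s ⊓ ae volume] fun x => |f x| ^ (n * ν s) * ‖V x i i‖
  offDiag_deriv : ∀ s, ∀ n, n ≤ N → ∃ W, IsWeakDeriv n (fun x => V x 1 0 - V x 0 1) W ∧
    W =O[Side.filter s ⊓ ae volume] fun x => |f x| ^ ((n + 1) * ν s)

/-! ### The cut-off -/

/-- `Re V₁₁`, `Re V₂₂` and `Im V₁₁ - Im V₂₂` are bounded at the end `s`. -/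
def PartsBounded (V : ℝ → Matrix (Fin 2) (Fin 2) ℂ) (s : Side) : Prop :=
  ((fun x => (V x 0 0).re) =O[Side.filter s] fun _ => (1 : ℝ)) ∧
  ((fun x => (V x 1 1).re) =O[Side.filter s] fun _ => (1 : ℝ)) ∧
  ((fun x => (V x 0 0).im - (V x 1 1).im) =O[Side.filter s] fun _ => (1 : ℝ))

/-- `V₁₁` and `V₂₂` are bounded at the end `s`. -/
def DiagBounded (V : ℝ → Matrix (Fin 2) (Fin 2) ℂ) (s : Side) : Prop :=
  ∀ i, (fun x => V x i i) =O[Side.filter s] fun _ => (1 : ℝ)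

open Classical in
/-- The function `g_±` which controls the size of the support of the cut-off. -/
def gFun (m : ℝ) (V : ℝ → Matrix (Fin 2) (Fin 2) ℂ) (f : ℝ → ℝ) (ν : Side → ℝ) (η ε₁ : ℝ)
    (s : Side) (x : ℝ) : ℝ :=
  if PartsBounded V s then
    if 0 < ν s then |f x| ^ (2 * ν s / (1 - ε₁)) else 0
  else
    let M := max (max (η⁻¹ * |(V x 0 0).re + m|) (η⁻¹ * |(V x 1 1).re - m|))
      (η⁻¹ * |(V x 0 0).im - (V x 1 1).im|)
    if 0 < ν s then max M (|f x| ^ (2 * ν s / (1 - ε₁))) else M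

/-- `δ^±_λ = inf {x ≥ 0 : g_±(±x) = λ}`, an extended real number. As `inf ∅ = +∞`, this is `+∞`
when `g_± = 0` (and `λ > 0`). -/
def cutRadius (m : ℝ) (V : ℝ → Matrix (Fin 2) (Fin 2) ℂ) (f : ℝ → ℝ) (ν : Side → ℝ) (η ε₁ : ℝ)
    (s : Side) (lam : ℝ) : EReal :=
  sInf ((fun x : ℝ => (x : EReal)) '' {x | 0 ≤ x ∧ gFun m V f ν η ε₁ s (s.sgn * x) = lam})

/-- No cut-off is needed at the end `s`. -/
def NoCut (V : ℝ → Matrix (Fin 2) (Fin 2) ℂ) (ν : Side → ℝ) (s : Side) : Prop :=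
  PartsBounded V s ∧ ν s ≤ 0

open Classical in
/-- The width `Δ^±_λ` of the transition region: `0` if no cut-off is needed at the end, and
`1 / δ^±_λ` otherwise. -/
def cutWidth (m : ℝ) (V : ℝ → Matrix (Fin 2) (Fin 2) ℂ) (f : ℝ → ℝ) (ν : Side → ℝ) (η ε₁ : ℝ)
    (s : Side) (lam : ℝ) : ℝ :=
  if NoCut V ν s then 0 else ((cutRadius m V f ν η ε₁ s lam).toReal)⁻¹

/-- `ξ lam` is a smooth cut-off function with values in `[0,1]` that equals `1` on
`(-δ⁻ + Δ⁻, δ⁺ - Δ⁺)` and vanishes outside `(-δ⁻, δ⁺)`, and whose derivatives of order `j = 1, 2`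
on the half-lines `ℝ_±` are at most `C (Δ^±)^{-j}`. -/
structure IsCutoffAt (δ : Side → EReal) (Δ : Side → ℝ) (C : ℝ) (ξ : ℝ → ℝ) : Prop where
  smooth : ContDiff ℝ ∞ ξ
  mem_Icc : ∀ x, ξ x ∈ Set.Icc (0 : ℝ) 1
  eq_one : ∀ x : ℝ, (∀ s : Side, ((s.sgn * x + Δ s : ℝ) : EReal) < δ s) → ξ x = 1
  eq_zero : ∀ x : ℝ, (∃ s : Side, δ s ≤ ((s.sgn * x : ℝ) : EReal)) → ξ x = 0
  deriv_le : ∀ s : Side, ∀ j : ℕ, j = 1 ∨ j = 2 → ∀ x : ℝ, 0 ≤ s.sgn * x →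
    |iteratedDeriv j ξ x| * Δ s ^ j ≤ C

/-- The `λ`-dependent family `ξ` is an admissible family of cut-off functions as `λ → +∞`. -/
def IsCutoffFamily (m : ℝ) (V : ℝ → Matrix (Fin 2) (Fin 2) ℂ) (f : ℝ → ℝ) (ν : Side → ℝ)
    (η ε₁ : ℝ) (ξ : ℝ → ℝ → ℝ) : Prop :=
  ∃ C : ℝ, ∀ᶠ lam : ℝ in atTop,
    IsCutoffAt (fun s => cutRadius m V f ν η ε₁ s lam) (fun s => cutWidth m V f ν η ε₁ s lam)
      C (ξ lam)

/-- The set `I^± ∩ J^±_λ` of all `x` on the side `s` with `a < |x| < δ^±_λ`. -/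
def outerSet (m : ℝ) (V : ℝ → Matrix (Fin 2) (Fin 2) ℂ) (f : ℝ → ℝ) (ν : Side → ℝ) (η ε₁ : ℝ)
    (s : Side) (a lam : ℝ) : Set ℝ :=
  {x | a < s.sgn * x ∧ ((s.sgn * x : ℝ) : EReal) < cutRadius m V f ν η ε₁ s lam}

/-! ### The WKB construction -/

/-- `k₁(x) = exp (-i ∫₀ˣ V₂₁)`. -/
def k₁ (V : ℝ → Matrix (Fin 2) (Fin 2) ℂ) (x : ℝ) : ℂ :=
  Complex.exp (-Complex.I * ∫ t in (0 : ℝ)..x, V t 1 0)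

/-- `k₂(x) = exp (-i ∫₀ˣ V₁₂)`. -/
def k₂ (V : ℝ → Matrix (Fin 2) (Fin 2) ℂ) (x : ℝ) : ℂ :=
  Complex.exp (-Complex.I * ∫ t in (0 : ℝ)..x, V t 0 1)

/-- `λ + m - V₂₂`. -/
def den (m : ℝ) (V : ℝ → Matrix (Fin 2) (Fin 2) ℂ) (lam : ℝ) (x : ℝ) : ℂ :=
  lam + m - V x 1 1

/-- `V_λ = (λ - m - V₁₁) (λ + m - V₂₂)`. -/
def Vlam (m : ℝ) (V : ℝ → Matrix (Fin 2) (Fin 2) ℂ) (lam : ℝ) (x : ℝ) : ℂ :=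
  (lam - m - V x 0 0) * den m V lam x

/-- `K_λ = (k₁ / k₂) / (λ + m - V₂₂)`. -/
def Klam (m : ℝ) (V : ℝ → Matrix (Fin 2) (Fin 2) ℂ) (lam : ℝ) (x : ℝ) : ℂ :=
  k₁ V x / k₂ V x / den m V lam x

/-- `psiD m V lam q` is the derivative `ψ'_{q-1}`, so that the index `q = 0` is the solution
`ψ'_{-1} = i λ⁻¹ V_λ^{1/2}` of the eikonal equation (principal branch), and the transport
equations read
`ψ'_{ℓ+1} = (2 ψ'_{-1})⁻¹ (ψ''_ℓ + (K_λ' / K_λ) ψ'_ℓ - ∑_{j=0}^{ℓ} ψ'_j ψ'_{ℓ-j})`, `ℓ = q - 1`. -/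
def psiD (m : ℝ) (V : ℝ → Matrix (Fin 2) (Fin 2) ℂ) (lam : ℝ) : ℕ → ℝ → ℂ
  | 0 => fun x => Complex.I * (lam : ℂ)⁻¹ * Vlam m V lam x ^ (1 / 2 : ℂ)
  | q + 1 => fun x => (2 * psiD m V lam 0 x)⁻¹ *
      (deriv (psiD m V lam q) x
        + deriv (Klam m V lam) x / Klam m V lam x * psiD m V lam q x
        - ∑ j : Fin q, psiD m V lam (j + 1) x * psiD m V lam (q - j) x)
  termination_by q => q

/-- The phase `P_{λ,n} = ∑_{k=-1}^{n-1} λ^{-k} ψ_k` with `ψ_k(0) = 0`. -/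
def phase (m : ℝ) (V : ℝ → Matrix (Fin 2) (Fin 2) ℂ) (n : ℕ) (lam : ℝ) (x : ℝ) : ℂ :=
  ∑ q ∈ Finset.range (n + 1),
    (lam : ℂ) ^ (1 - (q : ℤ)) * ∫ t in (0 : ℝ)..x, psiD m V lam q t

/-- `u_{λ,n} = ξ exp (-P_{λ,n})`. -/
def uFun (m : ℝ) (V : ℝ → Matrix (Fin 2) (Fin 2) ℂ) (n : ℕ) (ξ : ℝ → ℝ → ℝ) (lam : ℝ)
    (x : ℝ) : ℂ :=
  ξ lam x * Complex.exp (-phase m V n lam x)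

/-- `v_{λ,n} = (k₁ / k₂) (-i u_{λ,n}') / (λ + m - V₂₂)`. -/
def vFun (m : ℝ) (V : ℝ → Matrix (Fin 2) (Fin 2) ℂ) (n : ℕ) (ξ : ℝ → ℝ → ℝ) (lam : ℝ)
    (x : ℝ) : ℂ :=
  k₁ V x / k₂ V x * (-Complex.I * deriv (uFun m V n ξ lam) x) / den m V lam x

/-- The pseudomode `Ψ_{λ,n} = (k₁ u_{λ,n}, k₂ v_{λ,n})`. -/
def pseudomode (m : ℝ) (V : ℝ → Matrix (Fin 2) (Fin 2) ℂ) (n : ℕ) (ξ : ℝ → ℝ → ℝ) (lam : ℝ)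
    (x : ℝ) : EuclideanSpace ℂ (Fin 2) :=
  !₂[k₁ V x * uFun m V n ξ lam x, k₂ V x * vFun m V n ξ lam x]

/-- The quantity `κ(λ)` collecting the terms with derivatives of the cut-off. -/
def kappa (m : ℝ) (V : ℝ → Matrix (Fin 2) (Fin 2) ℂ) (n : ℕ) (ξ : ℝ → ℝ → ℝ) (lam : ℝ) : ℝ :=
  (l2norm (fun x => k₁ V x * Complex.exp (-phase m V n lam x) / den m V lam x
        * ((iteratedDeriv 2 (ξ lam) x : ℝ) : ℂ))
    + l2norm (fun x => k₁ V x * Complex.exp (-phase m V n lam x) / den m V lam x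
        * (2 * deriv (phase m V n lam) x - deriv (Klam m V lam) x / Klam m V lam x)
        * ((deriv (ξ lam) x : ℝ) : ℂ)))
  / Real.sqrt
      (l2norm (fun x => k₁ V x * Complex.exp (-phase m V n lam x) * (ξ lam x : ℂ)) ^ 2
        + l2norm (fun x => k₁ V x
            * (-Complex.I * deriv (fun y => Complex.exp (-phase m V n lam y) * (ξ lam y : ℂ)) x)
            / den m V lam x) ^ 2)

/-- The set of values on `I^± ∩ J^±_λ` of
`|f|^{(n+1) ν_±} max {|V₁₁|, |V₂₂|} / |λ + m - V₂₂|`. -/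
def growthSet (m : ℝ) (V : ℝ → Matrix (Fin 2) (Fin 2) ℂ) (f : ℝ → ℝ) (ν : Side → ℝ) (η ε₁ : ℝ)
    (n : ℕ) (s : Side) (a lam : ℝ) : Set ℝ :=
  (fun x => |f x| ^ ((n + 1) * ν s) * max ‖V x 0 0‖ ‖V x 1 1‖ / ‖den m V lam x‖) ''
    outerSet m V f ν η ε₁ s a lam

end DiracWKB

end

/-! The pseudomode is a complex WKB solution `exp (-P)`, cut off where the expansion stops being
useful. Since `V₁₂ = V₂₁` almost everywhere, `k₁ = k₂`, and the choice of the lower component makes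
the second row of `(H_V - λ) Ψ = 0` hold exactly. The first row is a scalar second order equation
for `u = ξ exp (-P)`. Its residual consists of two terms carrying `ξ''` and `ξ'`, whose norms form
the numerator of `κ`, and of `u k₁ / (λ + m - V₂₂)` times the remainder `P'² - P'' - (K'/K) P' +
V_λ` (`WKBData.ae_residual_eq`). Two estimates are therefore needed: a pointwise bound for the
remainder and exponential decay of `k₁ exp (-P)`.

Remainder. Let `W i` be the two factors of `V_λ`, `z i k = (W i)^(k) / W i` and `Y = λ ψ'_{-1}`, so
that `Y² = -V_λ` and `Y' / Y = (z 0 1 + z 1 1) / 2`. Then `λ^(1-q) ψ'_{q-1} = Y^(1-q) p_q(z)`, where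
for `q ≥ 1` the universal polynomial `p_q` is homogeneous of weight `q` and has no constant term
(`homog_wkbPoly`, `psiD_eq`). The transport equations cancel all low orders of the remainder, and
only products of weight at least `N + 1` survive (`wkbRemainder_eq`). With `D = |λ + m - V₂₂|`, `Φ =
|f|^ν` and `G = max |V_ii| / D`, the hypotheses on the derivatives give `|z i k| ≤ C Φ^k G` away
from the origin; hence the remainder divided by `D` is at most `C Φ^(N+1) D^(-N) G`. The stated
rates follow by inserting `D ≥ (1-η) λ` and, for `ν > 0`, the bound `Φ ≤ λ^((1-ε₁)/2)`, which the
definition of the cut-off radius enforces (`pow_mul_le_rate`).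

Decay. On the support of the cut-off the real parts and the difference of the imaginary parts are at
most `η λ`. Taking the imaginary part of `(V_λ^(1/2))² = V_λ` bounds `± Re Y` below by `(μ - η) /
√(η² + (2+2η)²)` times `± (Im V₁₁ + Im V₂₂)` (`PartsLe.le_eikonal_re`). The term `q = 1` has the
explicit primitive `(log W 0 - log W 1) / 4` with bounded real part
(`abs_re_integral_wkbTerm_one_le`), and the terms `q ≥ 2` are `O(λ^(-ε₁))` pointwise, so that their
integrals are absorbed by the linear growth of `F`. As `log |k₁| ≤ ε F + C` and `ε` is smaller than
the constant above, `|k₁ exp (-P)| ≤ C exp (-c F)` (`Admissible.exists_amplitude_le`). The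
derivatives of `ξ` live where `|x| ≥ δ/2` and are `O(δ²)`, which the exponential beats
(`Admissible.exists_amplitudeBound`); near `0` the amplitude is bounded below, so that norms can be
divided by.

The coefficients are only Sobolev, so `P'` is only locally Lipschitz. All calculus is carried out
with locally Lipschitz functions differentiated almost everywhere. -/

noncomputable section

/-! ### Calculus of locally Lipschitz functions and classical representatives of weak derivatives.
-/

namespace DiracWKB

/-! ### Functions that are Lipschitz near a point -/

section LipAt

variable {E G : Type*} [NormedAddCommGroup E] [NormedAddCommGroup G]

/-- `h` is Lipschitz on a neighbourhood of `x`. -/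
def LipAt (h : ℝ → E) (x : ℝ) : Prop := ∃ K, ∃ t ∈ 𝓝 x, LipschitzOnWith K h t

theorem LipAt.continuousAt {h : ℝ → E} {x : ℝ} (hh : LipAt h x) : ContinuousAt h x := by
  obtain ⟨K, t, ht, hK⟩ := hh
  exact hK.continuousOn.continuousAt ht

theorem LipAt.congr {h g : ℝ → E} {x : ℝ} (hh : LipAt h x) (hg : g =ᶠ[𝓝 x] h) : LipAt g x := by
  obtain ⟨K, t, ht, hK⟩ := hh
  refine ⟨K, t ∩ {y | g y = h y}, inter_mem ht hg, ?_⟩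
  intro y hy z hz
  rw [hy.2, hz.2]
  exact hK hy.1 hz.1

theorem LipAt.prodMk {h : ℝ → E} {g : ℝ → G} {x : ℝ} (hh : LipAt h x) (hg : LipAt g x) :
    LipAt (fun y => (h y, g y)) x := by
  obtain ⟨K, t, ht, hK⟩ := hh
  obtain ⟨K', t', ht', hK'⟩ := hg
  exact ⟨max K K', t ∩ t', inter_mem ht ht',
    (hK.mono Set.inter_subset_left).prodMk (hK'.mono Set.inter_subset_right)⟩

variable [NormedSpace ℝ E] [NormedSpace ℝ G]

theorem lipAt_of_contDiffAt {h : ℝ → E} {x : ℝ} (hh : ContDiffAt ℝ 1 h x) : LipAt h x :=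
  hh.exists_lipschitzOnWith

/-- A `C¹` map is Lipschitz near each point. Every closure property below is this one applied to a
smooth map such as sum, product, inverse or exponential. -/
theorem LipAt.comp {h : ℝ → E} {x : ℝ} (hh : LipAt h x) {g : E → G}
    (hg : ContDiffAt ℝ 1 g (h x)) : LipAt (fun y => g (h y)) x := by
  have hc := hh.continuousAt
  obtain ⟨K, t, ht, hK⟩ := hh
  obtain ⟨K', t', ht', hK'⟩ := hg.exists_lipschitzOnWith
  exact ⟨K' * K, t ∩ h ⁻¹' t', inter_mem ht (hc ht'),
    hK'.comp (hK.mono Set.inter_subset_left) fun y hy => hy.2⟩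

theorem lipAt_const (c : E) (x : ℝ) : LipAt (fun _ => c) x :=
  lipAt_of_contDiffAt contDiffAt_const

theorem LipAt.add {h g : ℝ → E} {x : ℝ} (hh : LipAt h x) (hg : LipAt g x) :
    LipAt (fun y => h y + g y) x :=
  (hh.prodMk hg).comp (g := fun p : E × E => p.1 + p.2) (by fun_prop)

theorem LipAt.neg {h : ℝ → E} {x : ℝ} (hh : LipAt h x) : LipAt (fun y => -h y) x :=
  hh.comp (g := fun p : E => -p) (by fun_prop)

theorem LipAt.sub {h g : ℝ → E} {x : ℝ} (hh : LipAt h x) (hg : LipAt g x) :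
    LipAt (fun y => h y - g y) x :=
  (hh.prodMk hg).comp (g := fun p : E × E => p.1 - p.2) (by fun_prop)

theorem LipAt.mul {h g : ℝ → ℂ} {x : ℝ} (hh : LipAt h x) (hg : LipAt g x) :
    LipAt (fun y => h y * g y) x :=
  (hh.prodMk hg).comp (g := fun p : ℂ × ℂ => p.1 * p.2) (by fun_prop)

theorem LipAt.smul {h : ℝ → ℝ} {g : ℝ → E} {x : ℝ} (hh : LipAt h x) (hg : LipAt g x) :
    LipAt (fun y => h y • g y) x :=
  (hh.prodMk hg).comp (g := fun p : ℝ × E => p.1 • p.2) (by fun_prop)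

theorem LipAt.inv {h : ℝ → ℂ} {x : ℝ} (hh : LipAt h x) (h0 : h x ≠ 0) :
    LipAt (fun y => (h y)⁻¹) x :=
  hh.comp (g := fun p : ℂ => p⁻¹) (contDiffAt_inv ℝ h0)

theorem LipAt.cexp {h : ℝ → ℂ} {x : ℝ} (hh : LipAt h x) :
    LipAt (fun y => Complex.exp (h y)) x :=
  hh.comp (g := fun p : ℂ => Complex.exp p) (by fun_prop)

theorem LipAt.ofReal {h : ℝ → ℝ} {x : ℝ} (hh : LipAt h x) :
    LipAt (fun y => (h y : ℂ)) x :=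
  hh.comp (g := fun p : ℝ => (p : ℂ)) (Complex.ofRealCLM.contDiff.contDiffAt)

theorem LipAt.sum {ι : Type*} (s : Finset ι) {h : ι → ℝ → E} {x : ℝ}
    (hh : ∀ i ∈ s, LipAt (h i) x) : LipAt (fun y => ∑ i ∈ s, h i y) x := by
  classical
  induction s using Finset.induction_on with
  | empty => simpa using lipAt_const (0 : E) x
  | insert i s hi ih =>
    simp only [Finset.sum_insert hi]
    exact (hh i (Finset.mem_insert_self _ _)).add
      (ih fun j hj => hh j (Finset.mem_insert_of_mem hj))

end LipAt

/-! ### The fundamental theorem of calculus for locally Lipschitz functions -/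

/-- A locally Lipschitz function is Lipschitz on compact intervals, hence absolutely continuous
there, and the Lebesgue form of the fundamental theorem applies. -/
theorem integral_eq_sub_of_lipAt_real {H H' : ℝ → ℝ} (hH : ∀ x, LipAt H x)
    (hd : ∀ᵐ x, HasDerivAt H (H' x) x) (a b : ℝ) :
    IntervalIntegrable H' volume a b ∧ ∫ x in a..b, H' x = H b - H a := by
  have hloc : LocallyLipschitz H := hH
  obtain ⟨K, hK⟩ := (hloc.locallyLipschitzOn (s := Set.uIcc a b)).exists_lipschitzOnWith_of_compact
    isCompact_uIcc
  have hac := hK.absolutelyContinuousOnInterval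
  have hae : ∀ᵐ x, deriv H x = H' x := hd.mono fun x hx => hx.deriv
  refine ⟨hac.intervalIntegrable_deriv.congr_ae (ae_restrict_of_ae hae), ?_⟩
  rw [← hac.integral_deriv_eq_sub]
  exact intervalIntegral.integral_congr_ae (hae.mono fun x hx _ => hx.symm)

theorem integral_eq_sub_of_lipAt {H H' : ℝ → ℂ} (hH : ∀ x, LipAt H x)
    (hd : ∀ᵐ x, HasDerivAt H (H' x) x) (a b : ℝ) :
    IntervalIntegrable H' volume a b ∧ ∫ x in a..b, H' x = H b - H a := by
  obtain ⟨h1, h1'⟩ := integral_eq_sub_of_lipAt_real (H := fun x => (H x).re)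
    (H' := fun x => (H' x).re) (fun x => (hH x).comp (g := Complex.re)
      Complex.reCLM.contDiff.contDiffAt)
    (hd.mono fun x hx => by
      simpa using! (Complex.reCLM.hasFDerivAt.comp_hasDerivAt x hx)) a b
  obtain ⟨h2, h2'⟩ := integral_eq_sub_of_lipAt_real (H := fun x => (H x).im)
    (H' := fun x => (H' x).im) (fun x => (hH x).comp (g := Complex.im)
      Complex.imCLM.contDiff.contDiffAt)
    (hd.mono fun x hx => by
      simpa using! (Complex.imCLM.hasFDerivAt.comp_hasDerivAt x hx)) a b
  have h1c : IntervalIntegrable (fun x => ((H' x).re : ℂ)) volume a b :=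
    ⟨h1.1.ofReal, h1.2.ofReal⟩
  have h2c : IntervalIntegrable (fun x => ((H' x).im : ℂ)) volume a b :=
    ⟨h2.1.ofReal, h2.2.ofReal⟩
  have he : H' = fun x => ((H' x).re : ℂ) + ((H' x).im : ℂ) * Complex.I := by
    funext x; exact (Complex.re_add_im _).symm
  refine ⟨he ▸ h1c.add (h2c.mul_const _), ?_⟩
  rw [he, intervalIntegral.integral_add h1c (h2c.mul_const _),
    intervalIntegral.integral_mul_const, intervalIntegral.integral_ofReal,
    intervalIntegral.integral_ofReal, h1', h2']
  push_cast
  linear_combination Complex.re_add_im (H b) - Complex.re_add_im (H a)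

/-- The integral of the derivative of a compactly supported locally Lipschitz function
vanishes. -/
theorem integral_deriv_eq_zero_of_lipAt {H H' : ℝ → ℂ} (hH : ∀ x, LipAt H x)
    (hd : ∀ᵐ x, HasDerivAt H (H' x) x) (hc : HasCompactSupport H) :
    Integrable H' volume ∧ ∫ x, H' x = 0 := by
  obtain ⟨r, hr⟩ := hc.isCompact.isBounded.subset_closedBall 0
  set R := |r| + 1 with hR
  have hz : ∀ x, x ∉ Set.Icc (-|r|) |r| → x ∉ tsupport H := by
    intro x hx hx'
    have := hr hx'
    rw [Metric.mem_closedBall, Real.dist_eq, sub_zero] at this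
    exact hx (abs_le.1 (this.trans (le_abs_self r)))
  -- Off the support `H` vanishes in a whole neighbourhood, so the pointwise derivative is zero
  -- there and the integral over the line reduces to one over a bounded interval.
  have hd0 : ∀ᵐ x, x ∉ Set.Ioc (-R) R → H' x = 0 := by
    filter_upwards [hd] with x hx hxn
    have h1 : x ∉ tsupport H := hz x fun h => hxn ⟨by linarith [h.1], by linarith [h.2]⟩
    have h2 : H =ᶠ[𝓝 x] fun _ => 0 := notMem_tsupport_iff_eventuallyEq.1 h1
    exact hx.unique ((hasDerivAt_const x (0 : ℂ)).congr_of_eventuallyEq h2)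
  obtain ⟨h1, h2⟩ := integral_eq_sub_of_lipAt hH hd (-R) R
  have hRR : -R ≤ R := by have := abs_nonneg r; linarith
  have hzero : ∀ x, x ∉ Set.Icc (-|r|) |r| → H x = 0 := fun x hx =>
    image_eq_zero_of_notMem_tsupport (hz x hx)
  have e1 : H R = 0 := hzero _ fun h => by linarith [h.2]
  have e2 : H (-R) = 0 := hzero _ fun h => by linarith [h.1]
  have hind : Set.indicator (Set.Ioc (-R) R) H' =ᵐ[volume] H' := by
    filter_upwards [hd0] with x hx
    by_cases hm : x ∈ Set.Ioc (-R) R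
    · simp [hm]
    · simp [hm, hx hm]
  refine ⟨(Integrable.congr ((integrable_indicator_iff measurableSet_Ioc).2 h1.1) hind), ?_⟩
  rw [← integral_congr_ae hind, integral_indicator measurableSet_Ioc,
    ← intervalIntegral.integral_of_le hRR, h2, e1, e2, sub_zero]

/-- Integration by parts against a test function. -/
theorem integral_deriv_smul_eq_of_lipAt {H H' : ℝ → ℂ} (hH : ∀ x, LipAt H x)
    (hd : ∀ᵐ x, HasDerivAt H (H' x) x) {φ : ℝ → ℝ} (hφ : ContDiff ℝ ∞ φ)
    (hc : HasCompactSupport φ) :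
    Integrable (fun x => φ x • H' x) ∧ ∫ x, deriv φ x • H x = -∫ x, φ x • H' x := by
  have hφ1 : Differentiable ℝ φ := hφ.differentiable (by simp)
  obtain ⟨h1, h2⟩ := integral_deriv_eq_zero_of_lipAt (H := fun x => φ x • H x)
    (H' := fun x => φ x • H' x + deriv φ x • H x)
    (fun x => (lipAt_of_contDiffAt ((hφ.of_le (by exact_mod_cast le_top)).contDiffAt)).smul (hH x))
    (hd.mono fun x hx => (hφ1 x).hasDerivAt.smul hx) (hc.smul_right)
  have h3 : Integrable (fun x => deriv φ x • H x) := by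
    refine Continuous.integrable_of_hasCompactSupport ?_ (hc.deriv.smul_right)
    exact (hφ.continuous_deriv (by exact_mod_cast le_top)).smul
      (continuous_iff_continuousAt.2 fun x => (hH x).continuousAt)
  have h4 : Integrable (fun x => φ x • H' x) := by
    refine (h1.sub h3).congr (Eventually.of_forall fun x => ?_)
    simp
  refine ⟨h4, ?_⟩
  rw [integral_add h4 h3] at h2
  exact eq_neg_of_add_eq_zero_right h2

/-! ### Primitives of locally bounded functions -/

theorem MemLinftyLoc.locallyIntegrable {h : ℝ → ℂ} (hh : MemLinftyLoc h) :
    LocallyIntegrable h volume := by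
  rw [locallyIntegrable_iff]
  intro K hK
  have : IsFiniteMeasure (volume.restrict K) := ⟨by
    rw [Measure.restrict_apply_univ]; exact hK.measure_lt_top⟩
  exact (hh K hK).integrable le_top

theorem MemLinftyLoc.exists_bound {h : ℝ → ℂ} (hh : MemLinftyLoc h) (R : ℝ) :
    ∃ C, 0 ≤ C ∧ ∀ᵐ x, |x| ≤ R → ‖h x‖ ≤ C := by
  have h1 := hh (Set.Icc (-R) R) isCompact_Icc
  have h2 := ae_le_eLpNormEssSup (f := h) (μ := volume.restrict (Set.Icc (-R) R))
  rw [ae_restrict_iff' measurableSet_Icc] at h2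
  have h3 : eLpNormEssSup h (volume.restrict (Set.Icc (-R) R)) ≠ ⊤ := by
    have := h1.2
    rw [eLpNorm_exponent_top] at this
    exact this.ne
  refine ⟨(eLpNormEssSup h (volume.restrict (Set.Icc (-R) R))).toReal,
    ENNReal.toReal_nonneg, h2.mono fun x hx hxR => ?_⟩
  have := hx (abs_le.1 hxR)
  have h4 := ENNReal.toReal_mono h3 this
  simpa using h4

theorem MemLinftyLoc.intervalIntegrable {h : ℝ → ℂ} (hh : MemLinftyLoc h)
    (a b : ℝ) : IntervalIntegrable h volume a b :=
  (hh.locallyIntegrable.integrableOn_isCompact isCompact_uIcc).intervalIntegrable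

theorem MemLinftyLoc.lipAt_primitive {h : ℝ → ℂ} (hh : MemLinftyLoc h) (x : ℝ) :
    LipAt (fun y => ∫ t in (0 : ℝ)..y, h t) x := by
  obtain ⟨C, hC, hb⟩ := hh.exists_bound (|x| + 1)
  refine ⟨⟨C, hC⟩, Metric.ball x 1, Metric.ball_mem_nhds x one_pos,
    LipschitzOnWith.of_dist_le_mul ?_⟩
  intro y hy z hz
  have hi := hh.intervalIntegrable
  rw [dist_eq_norm, intervalIntegral.integral_interval_sub_left (hi _ _) (hi _ _), Real.dist_eq]
  refine intervalIntegral.norm_integral_le_of_norm_le_const_ae (hb.mono fun t ht htm => ht ?_)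
  rw [Metric.mem_ball, Real.dist_eq] at hy hz
  have h1 := Set.uIoc_subset_uIcc htm
  rw [Set.mem_uIcc] at h1
  rw [abs_lt] at hy hz
  have := abs_le.1 (le_refl |x|)
  rw [abs_le]
  rcases h1 with h1 | h1 <;> constructor <;> linarith [h1.1, h1.2]

theorem MemLinftyLoc.ae_hasDerivAt_primitive {h : ℝ → ℂ} (hh : MemLinftyLoc h) :
    ∀ᵐ x, HasDerivAt (fun y => ∫ t in (0 : ℝ)..y, h t) (h x) x :=
  (_root_.LocallyIntegrable.ae_hasDerivAt_integral hh.locallyIntegrable).mono fun _ hx => hx 0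

/-! ### Weak derivatives -/

/-- A locally integrable function with vanishing weak derivative is constant. -/
theorem ae_eq_const_of_integral_deriv_smul_eq_zero {g : ℝ → ℂ} (hg : LocallyIntegrable g volume)
    (h0 : ∀ φ : ℝ → ℝ, ContDiff ℝ ∞ φ → HasCompactSupport φ → ∫ x, deriv φ x • g x = 0) :
    ∃ c : ℂ, ∀ᵐ x, g x = c := by
  let b : ContDiffBump (0 : ℝ) := ⟨1, 2, by norm_num, by norm_num⟩
  let ρ : ℝ → ℝ := b.normed volume
  have hρ : ContDiff ℝ ∞ ρ := b.contDiff_normed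
  have hρc : HasCompactSupport ρ := b.hasCompactSupport_normed
  have hρ1 : ∫ x, ρ x = 1 := b.integral_normed
  have hint : ∀ {φ : ℝ → ℝ}, ContDiff ℝ ∞ φ → HasCompactSupport φ →
      Integrable (fun x => φ x • g x) := fun {φ} h1 h2 =>
    hg.integrable_smul_left_of_hasCompactSupport h1.continuous h2
  refine ⟨∫ x, ρ x • g x, ?_⟩
  refine ae_eq_of_integral_contDiff_smul_eq hg (locallyIntegrable_const _) fun φ hφ hφc => ?_
  set I := ∫ x, φ x with hI
  -- A test function is its mean times the bump `ρ` plus a function `w` of mean zero, and `w` is the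
  -- derivative of the test function `θ` below. Testing against `θ'` thus identifies `g` with the
  -- constant `∫ ρ g`.
  let w : ℝ → ℝ := fun x => φ x - I * ρ x
  have hw : ContDiff ℝ ∞ w := hφ.sub (contDiff_const.mul hρ)
  have hwc : HasCompactSupport w := hφc.sub (hρc.mul_left)
  have hwi : Integrable w := hw.continuous.integrable_of_hasCompactSupport hwc
  have hw0 : ∫ x, w x = 0 := by
    simp only [w]
    rw [integral_sub (hφ.continuous.integrable_of_hasCompactSupport hφc)
      ((hρ.continuous.integrable_of_hasCompactSupport hρc).const_mul _), integral_const_mul, hρ1]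
    simp [hI]
  obtain ⟨r, hr⟩ := hwc.isCompact.isBounded.subset_closedBall 0
  have hz : ∀ x, |r| < |x| → w x = 0 := fun x hx => by
    refine image_eq_zero_of_notMem_tsupport fun h => ?_
    have := hr h
    rw [Metric.mem_closedBall, Real.dist_eq, sub_zero] at this
    linarith [le_abs_self r]
  let θ : ℝ → ℝ := fun x => ∫ t in (-(|r| + 1))..x, w t
  have hθd : ∀ x, HasDerivAt θ (w x) x := fun x =>
    intervalIntegral.integral_hasDerivAt_right (hw.continuous.intervalIntegrable _ _)
      (hw.continuous.stronglyMeasurableAtFilter _ _) hw.continuous.continuousAt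
  have hθ : ContDiff ℝ ∞ θ := by
    rw [contDiff_infty_iff_deriv]
    refine ⟨fun x => (hθd x).differentiableAt, ?_⟩
    rwa [show deriv θ = w from funext fun x => (hθd x).deriv]
  have hr0 := abs_nonneg r
  have hθc : HasCompactSupport θ := by
    refine HasCompactSupport.intro (K := Set.Icc (-(|r| + 1)) (|r| + 1)) isCompact_Icc ?_
    intro x hx
    rw [Set.mem_Icc, not_and_or, not_le, not_le] at hx
    rcases hx with hx | hx
    · refine (intervalIntegral.integral_congr_ae (g := fun _ => 0)
        (Eventually.of_forall ?_)).trans (by simp)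
      intro t ht
      rw [Set.uIoc_of_ge hx.le] at ht
      exact hz t (by rw [abs_of_nonpos (by linarith [ht.2] : t ≤ 0)]; linarith [ht.2])
    · change ∫ t in (-(|r| + 1))..x, w t = 0
      rw [← hw0]
      refine intervalIntegral.integral_eq_integral_of_support_subset fun t ht => ?_
      have : ¬ |r| < |t| := fun h => ht (hz t h)
      have := abs_le.1 (not_lt.1 this)
      exact ⟨by linarith [this.1], by linarith [this.2]⟩
  have key := h0 θ hθ hθc
  rw [show deriv θ = w from funext fun x => (hθd x).deriv] at key
  have : ∀ x, w x • g x = φ x • g x - I • (ρ x • g x) := fun x => by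
    simp only [w, sub_smul, mul_smul]
  simp only [this] at key
  have hρi : Integrable fun x => I • (ρ x • g x) := (hint hρ hρc).smul I
  rw [integral_sub (hint hφ hφc) hρi, integral_smul, sub_eq_zero] at key
  rw [key, integral_smul_const]

theorem IsWeakDeriv.ae_unique {n : ℕ} {g h h' : ℝ → ℂ} (H : IsWeakDeriv n g h)
    (H' : IsWeakDeriv n g h') : ∀ᵐ x, h x = h' x := by
  refine ae_eq_of_integral_contDiff_smul_eq H.2 H'.2 fun φ h1 h2 => ?_
  have := (H.3 φ h1 h2).symm.trans (H'.3 φ h1 h2)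
  exact mul_left_cancel₀ (pow_ne_zero n (by norm_num)) this

theorem IsWeakDeriv.ae_eq_of_zero {g h : ℝ → ℂ} (H : IsWeakDeriv 0 g h) :
    ∀ᵐ x, h x = g x :=
  H.ae_unique ⟨H.1, H.1, fun φ _ _ => by simp⟩

theorem IsWeakDeriv.congr {n : ℕ} {g h h' : ℝ → ℂ} (H : IsWeakDeriv n g h)
    (hh : ∀ᵐ x, h' x = h x) : IsWeakDeriv n g h' := by
  refine ⟨H.1, H.2.congr (hh.mono fun x hx => hx.symm), fun φ h1 h2 => ?_⟩
  rw [H.3 φ h1 h2]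
  congr 1
  exact integral_congr_ae (hh.mono fun x hx => by simp [hx])

/-- Testing the order `n` identity with `φ'` and the order `n + 1` identity with `φ` produces the
same left-hand side. -/
theorem IsWeakDeriv.succ {n : ℕ} {g h h' : ℝ → ℂ} (H : IsWeakDeriv n g h)
    (H' : IsWeakDeriv (n + 1) g h') {φ : ℝ → ℝ} (h1 : ContDiff ℝ ∞ φ)
    (h2 : HasCompactSupport φ) : ∫ x, deriv φ x • h x = -∫ x, φ x • h' x := by
  have e1 := H.3 (deriv φ) ((contDiff_infty_iff_deriv.1 h1).2) h2.deriv
  have e2 := H'.3 φ h1 h2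
  rw [iteratedDeriv_succ'] at e2
  rw [e1, pow_succ] at e2
  refine mul_left_cancel₀ (pow_ne_zero n (by norm_num : (-1 : ℂ) ≠ 0)) ?_
  linear_combination e2

/-- Consecutive weak derivatives: the lower one is almost everywhere a primitive of the higher
one. -/
theorem IsWeakDeriv.ae_eq_primitive {n : ℕ} {g h h' : ℝ → ℂ} (H : IsWeakDeriv n g h)
    (H' : IsWeakDeriv (n + 1) g h') (hb : MemLinftyLoc h') :
    ∃ c : ℂ, ∀ᵐ x, h x = c + ∫ t in (0 : ℝ)..x, h' t := by
  have hcont : Continuous fun x => ∫ t in (0 : ℝ)..x, h' t :=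
    continuous_iff_continuousAt.2 fun x => (hb.lipAt_primitive x).continuousAt
  have hloc := H.2.sub hcont.locallyIntegrable (μ := volume)
  obtain ⟨c, hc⟩ := ae_eq_const_of_integral_deriv_smul_eq_zero hloc fun φ h1 h2 => by
    obtain ⟨i1, i2⟩ := integral_deriv_smul_eq_of_lipAt hb.lipAt_primitive
      hb.ae_hasDerivAt_primitive h1 h2
    have hd : Continuous (deriv φ) := h1.continuous_deriv (by exact_mod_cast le_top)
    simp only [Pi.sub_apply, smul_sub]
    rw [integral_sub (H.2.integrable_smul_left_of_hasCompactSupport hd h2.deriv)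
      (hcont.locallyIntegrable.integrable_smul_left_of_hasCompactSupport hd h2.deriv),
      i2, H.succ H' h1 h2, sub_self]
  refine ⟨c, hc.mono fun x hx => ?_⟩
  rw [← hx]
  simp

/-- `J` is a sequence of classical derivatives of `g`, the last one being understood almost
everywhere. -/
structure IsJet (N : ℕ) (g : ℝ → ℂ) (J : ℕ → ℝ → ℂ) : Prop where
  zero : J 0 = g
  hasDerivAt : ∀ k < N, ∀ x, HasDerivAt (J k) (J (k + 1) x) x
  lipAt : ∀ k ≤ N, ∀ x, LipAt (J k) x
  ae_hasDerivAt : ∀ᵐ x, HasDerivAt (J N) (J (N + 1) x) x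
  memLinftyLoc : ∀ k ≤ N + 1, MemLinftyLoc (J k)
  isWeakDeriv : ∀ k ≤ N + 1, IsWeakDeriv k g (J k)

theorem MemLinftyLoc.congr {h h' : ℝ → ℂ} (H : MemLinftyLoc h) (hh : ∀ᵐ x, h' x = h x) :
    MemLinftyLoc h' := fun K hK =>
  (memLp_congr_ae (ae_restrict_of_ae hh)).2 (H K hK)

/-- Each weak derivative of order at most `N` agrees almost everywhere with a constant plus a
primitive of the next one. These primitives are continuous, so the identities between consecutive
orders become classical; only the last differentiation remains almost everywhere. -/
theorem exists_isJet {N : ℕ} {g : ℝ → ℂ} (hg : Continuous g) (h : MemWLoc (N + 1) g) :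
    ∃ J, IsJet N g J := by
  choose! w hw hwb using h
  have hp : ∀ n, ∃ c : ℂ, n ≤ N → ∀ᵐ x, w n x = c + ∫ t in (0 : ℝ)..x, w (n + 1) t := fun n => by
    by_cases hn : n ≤ N
    · obtain ⟨c, hc⟩ := (hw n (by omega)).ae_eq_primitive (hw (n + 1) (by omega))
        (hwb (n + 1) (by omega))
      exact ⟨c, fun _ => hc⟩
    · exact ⟨0, fun h => absurd h hn⟩
  choose c hc using hp
  -- Beyond order `N` no continuous representative is available, and the weak derivative itself is
  -- kept.
  let J : ℕ → ℝ → ℂ := fun n =>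
    if n ≤ N then fun x => c n + ∫ t in (0 : ℝ)..x, w (n + 1) t else w n
  have hJ : ∀ n ≤ N, J n = fun x => c n + ∫ t in (0 : ℝ)..x, w (n + 1) t := fun n hn => by
    simp [J, hn]
  have hJae : ∀ n, ∀ᵐ x, J n x = w n x := fun n => by
    by_cases hn : n ≤ N
    · rw [hJ n hn]; exact (hc n hn).mono fun x hx => hx.symm
    · simp [J, hn]
  have hJlip : ∀ n ≤ N, ∀ x, LipAt (J n) x := fun n hn x => by
    rw [hJ n hn]
    exact (lipAt_const _ _).add ((hwb (n + 1) (by omega)).lipAt_primitive x)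
  have hJc : ∀ n ≤ N, Continuous (J n) := fun n hn =>
    continuous_iff_continuousAt.2 fun x => (hJlip n hn x).continuousAt
  refine ⟨J, ?_, ?_, hJlip, ?_, ?_, ?_⟩
  -- Both sides are continuous, so equality almost everywhere is equality; this is where the choice
  -- of the continuous representative of the diagonal entries matters.
  · refine Continuous.ae_eq_iff_eq volume (hJc 0 (Nat.zero_le _)) hg |>.1 ?_
    filter_upwards [hJae 0, (hw 0 (by omega)).ae_eq_of_zero] with x h1 h2
    rw [h1, h2]
  · intro k hk x
    have e : J k = fun x => c k + ∫ t in (0 : ℝ)..x, J (k + 1) t := by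
      rw [hJ k hk.le]
      funext y
      congr 1
      exact intervalIntegral.integral_congr_ae ((hJae (k + 1)).mono fun t ht _ => ht.symm)
    rw [e]
    have hcont := hJc (k + 1) hk
    exact (intervalIntegral.integral_hasDerivAt_right (hcont.intervalIntegrable _ _)
      (hcont.stronglyMeasurableAtFilter _ _) hcont.continuousAt).const_add _
  · have e : J (N + 1) = w (N + 1) := by simp [J]
    rw [hJ N le_rfl, e]
    exact (hwb (N + 1) le_rfl).ae_hasDerivAt_primitive.mono fun x hx => hx.const_add _
  · exact fun k hk => (hwb k hk).congr (hJae k)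
  · exact fun k hk => (hw k hk).congr (hJae k)

end DiracWKB

/-! ### Algebra of the WKB expansion: universal differential polynomials and cancellation of low
orders. -/

namespace DiracWKB

/-! ### Weighted homogeneous differential polynomials -/

/-- The values of the normalised derivatives of the two diagonal entries:
`z i k` stands for `W_i^{(k)} / W_i`. -/
abbrev JetVal := Fin 2 → ℕ → ℂ

/-- Weighted homogeneous polynomials of degree `q` in the variables `z i k`, `k ≥ 1`, where
`z i k` has weight `k`; they have no constant term. -/
inductive Homog : ℕ → (JetVal → ℂ) → Prop
  | var (i : Fin 2) (k : ℕ) (hk : 1 ≤ k) : Homog k fun z => z i k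
  | zero (q : ℕ) : Homog q fun _ => 0
  | add {q : ℕ} {p p' : JetVal → ℂ} : Homog q p → Homog q p' → Homog q fun z => p z + p' z
  | smul {q : ℕ} {p : JetVal → ℂ} (c : ℂ) : Homog q p → Homog q fun z => c * p z
  | mul {q q' : ℕ} {p p' : JetVal → ℂ} : Homog q p → Homog q' p' →
      Homog (q + q') fun z => p z * p' z

theorem Homog.sub {q : ℕ} {p p' : JetVal → ℂ} (h : Homog q p) (h' : Homog q p') :
    Homog q fun z => p z - p' z := by
  have := h.add (h'.smul (-1))
  simpa [sub_eq_add_neg] using this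

theorem Homog.mul' {q q' n : ℕ} {p p' : JetVal → ℂ} (h : Homog q p) (h' : Homog q' p')
    (hn : q + q' = n) : Homog n fun z => p z * p' z := hn ▸ h.mul h'

theorem Homog.sum {ι : Type*} {q : ℕ} (s : Finset ι) {p : ι → JetVal → ℂ}
    (h : ∀ i ∈ s, Homog q (p i)) : Homog q fun z => ∑ i ∈ s, p i z := by
  classical
  induction s using Finset.induction_on with
  | empty => simpa using Homog.zero q
  | insert i s hi ih =>
    simp only [Finset.sum_insert hi]
    exact (h i (Finset.mem_insert_self _ _)).add
      (ih fun j hj => h j (Finset.mem_insert_of_mem hj))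

/-- The weight counts the powers of `Φ`. Since there is no constant term, every monomial contains at
least one variable and so keeps one factor `G`; in a product the superfluous factor `G` is bounded
by `C`. -/
theorem Homog.exists_bound {q : ℕ} {p : JetVal → ℂ} (h : Homog q p) {C : ℝ} (hC : 0 ≤ C) :
    ∃ C' : ℝ, 0 ≤ C' ∧ ∀ (z : JetVal) (Φ G : ℝ), 0 ≤ Φ → 0 ≤ G → G ≤ C →
      (∀ i k, 1 ≤ k → k ≤ q → ‖z i k‖ ≤ C * Φ ^ k * G) → ‖p z‖ ≤ C' * Φ ^ q * G := by
  induction h with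
  | var i k hk => exact ⟨C, hC, fun z Φ G _ _ _ h => h i k hk le_rfl⟩
  | zero q => exact ⟨0, le_rfl, fun z Φ G _ _ _ _ => by simp⟩
  | add h h' ih ih' =>
    obtain ⟨C1, h1, ih⟩ := ih
    obtain ⟨C2, h2, ih'⟩ := ih'
    refine ⟨C1 + C2, by positivity, fun z Φ G a b c d => (norm_add_le _ _).trans ?_⟩
    rw [add_mul, add_mul]
    exact add_le_add (ih z Φ G a b c d) (ih' z Φ G a b c d)
  | smul c h ih =>
    obtain ⟨C1, h1, ih⟩ := ih
    refine ⟨‖c‖ * C1, by positivity, fun z Φ G a b c' d => ?_⟩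
    rw [norm_mul, mul_assoc, mul_assoc]
    exact mul_le_mul_of_nonneg_left (by simpa [mul_assoc] using ih z Φ G a b c' d)
      (norm_nonneg _)
  | @mul q q' p p' h h' ih ih' =>
    obtain ⟨C1, h1, ih⟩ := ih
    obtain ⟨C2, h2, ih'⟩ := ih'
    refine ⟨C1 * C2 * C, by positivity, fun z Φ G a b c d => ?_⟩
    have e1 := ih z Φ G a b c fun i k hk hk' => d i k hk (by omega)
    have e2 := ih' z Φ G a b c fun i k hk hk' => d i k hk (by omega)
    rw [norm_mul]
    calc ‖p z‖ * ‖p' z‖ ≤ (C1 * Φ ^ q * G) * (C2 * Φ ^ q' * C) :=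
          mul_le_mul e1 (e2.trans (by gcongr)) (norm_nonneg _) (by positivity)
      _ = C1 * C2 * C * Φ ^ (q + q') * G := by rw [pow_add]; ring

/-- The derivative of a differential polynomial. -/
theorem Homog.exists_deriv {q : ℕ} {p : JetVal → ℂ} (h : Homog q p) :
    ∃ p', Homog (q + 1) p' ∧ ∀ (Z : ℝ → JetVal) (x : ℝ),
      (∀ i k, 1 ≤ k → k ≤ q →
        HasDerivAt (fun y => Z y i k) (Z x i (k + 1) - Z x i k * Z x i 1) x) →
      HasDerivAt (fun y => p (Z y)) (p' (Z x)) x := by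
  induction h with
  -- This is the quotient rule `(W^(k) / W)' = W^(k+1) / W - (W^(k) / W) (W' / W)`.
  | var i k hk =>
    exact ⟨_, (Homog.var i (k + 1) (by omega)).sub ((Homog.var i k hk).mul (Homog.var i 1 le_rfl)),
      fun Z x h => h i k hk le_rfl⟩
  | zero q => exact ⟨_, Homog.zero (q + 1), fun Z x _ => hasDerivAt_const _ _⟩
  | add h h' ih ih' =>
    obtain ⟨p1, h1, ih⟩ := ih
    obtain ⟨p2, h2, ih'⟩ := ih'
    exact ⟨_, h1.add h2, fun Z x hZ => (ih Z x hZ).add (ih' Z x hZ)⟩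
  | smul c h ih =>
    obtain ⟨p1, h1, ih⟩ := ih
    exact ⟨_, h1.smul c, fun Z x hZ => (ih Z x hZ).const_mul c⟩
  | @mul q q' p p' h h' ih ih' =>
    obtain ⟨p1, h1, ih⟩ := ih
    obtain ⟨p2, h2, ih'⟩ := ih'
    exact ⟨_, (h1.mul' h' (by omega)).add (h.mul' h2 (by omega)), fun Z x hZ =>
      (ih Z x fun i k hk hk' => hZ i k hk (by omega)).mul
        (ih' Z x fun i k hk hk' => hZ i k hk (by omega))⟩

theorem Homog.lipAt {q : ℕ} {p : JetVal → ℂ} (h : Homog q p) {Z : ℝ → JetVal} {x : ℝ}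
    (hZ : ∀ i k, 1 ≤ k → k ≤ q → LipAt (fun y => Z y i k) x) :
    LipAt (fun y => p (Z y)) x := by
  induction h with
  | var i k hk => exact hZ i k hk le_rfl
  | zero q => exact lipAt_const _ _
  | add h h' ih ih' => exact (ih hZ).add (ih' hZ)
  | smul c h ih => exact (lipAt_const c x).mul (ih hZ)
  | mul h h' ih ih' =>
    exact (ih fun i k hk hk' => hZ i k hk (by omega)).mul
      (ih' fun i k hk hk' => hZ i k hk (by omega))

/-! ### The WKB polynomials -/

open Classical in
/-- The derivative of a differential polynomial of degree `q` (and `0` for other functions). -/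
def polyDeriv (q : ℕ) (p : JetVal → ℂ) : JetVal → ℂ :=
  if h : Homog q p then h.exists_deriv.choose else fun _ => 0

/-- The coefficients in the solution of the transport equations:
`ψ'_{q-1} = (ψ'_{-1})^{1-q} p_q`. -/
def wkbPoly : ℕ → JetVal → ℂ
  | 0 => fun _ => 1
  | q + 1 => fun z => 2⁻¹ * ((1 - (q : ℂ)) * ((z 0 1 + z 1 1) / 2) * wkbPoly q z
      + polyDeriv q (wkbPoly q) z - z 1 1 * wkbPoly q z
      - ∑ j : Fin q, wkbPoly (j + 1) z * wkbPoly (q - j) z)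
  termination_by q => q

/-- The derivative of `wkbPoly q`. -/
def wkbPoly' (q : ℕ) : JetVal → ℂ := polyDeriv q (wkbPoly q)

theorem wkbPoly_zero : wkbPoly 0 = fun _ => 1 := by
  rw [wkbPoly]

theorem wkbPoly_succ (q : ℕ) (z : JetVal) : wkbPoly (q + 1) z =
    2⁻¹ * ((1 - (q : ℂ)) * ((z 0 1 + z 1 1) / 2) * wkbPoly q z
      + wkbPoly' q z - z 1 1 * wkbPoly q z
      - ∑ j : Fin q, wkbPoly (j + 1) z * wkbPoly (q - j) z) := by
  rw [wkbPoly, wkbPoly']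

theorem homog_polyDeriv (q : ℕ) (p : JetVal → ℂ) : Homog (q + 1) (polyDeriv q p) := by
  unfold polyDeriv
  split_ifs with h
  · exact h.exists_deriv.choose_spec.1
  · exact Homog.zero _

/-- By strong induction. The constant `p_0 = 1` is not in the class, so `q = 0` is separated
wherever it is multiplied by a polynomial of weight one; in the convolution sum both indices are at
least `1`. -/
theorem homog_wkbPoly (q : ℕ) : Homog (q + 1) (wkbPoly (q + 1)) := by
  induction q using Nat.strong_induction_on with
  | _ q ih =>
    have h1 : ∀ c : ℂ, Homog 1 fun z : JetVal => c * ((z 0 1 + z 1 1) / 2) := fun c => by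
      have := ((Homog.var 0 1 le_rfl).add (Homog.var 1 1 le_rfl)).smul (c / 2)
      convert this using 2
      ring
    have h2 : ∀ {p : JetVal → ℂ}, Homog 1 p → Homog (q + 1) fun z => p z * wkbPoly q z := by
      intro p hp
      rcases q with _ | q
      · simpa [wkbPoly_zero] using hp
      · exact hp.mul' (ih q (by omega)) (by omega)
    have hH : Homog (q + 1) fun z => 2⁻¹ * ((1 - (q : ℂ)) * ((z 0 1 + z 1 1) / 2) * wkbPoly q z
      + wkbPoly' q z - z 1 1 * wkbPoly q z
      - ∑ j : Fin q, wkbPoly (j + 1) z * wkbPoly (q - j) z) := by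
      refine Homog.smul _ ((((h2 (h1 _)).add (homog_polyDeriv _ _)).sub
        (h2 (Homog.var 1 1 le_rfl))).sub (Homog.sum _ fun j _ => ?_))
      have e : q - (j : ℕ) = (q - j - 1) + 1 := by omega
      rw [e]
      exact (ih j (by omega)).mul' (ih _ (by omega)) (by omega)
    convert hH using 2 with z
    exact wkbPoly_succ q z

theorem homog_wkbPoly' (q : ℕ) : Homog (q + 1) (wkbPoly' q) := homog_polyDeriv _ _

/-- The constant `1` is not homogeneous in the above sense, because such polynomials vanish at the
origin. The default value of `polyDeriv` is taken, and it is the correct derivative of a constant.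
-/
theorem wkbPoly'_zero : wkbPoly' 0 = fun _ => 0 := by
  have h0 : ¬ Homog 0 (fun _ : JetVal => (1 : ℂ)) := fun h => by
    obtain ⟨C, -, hC⟩ := h.exists_bound (C := 0) le_rfl
    have := hC (fun _ _ => 0) 0 0 le_rfl le_rfl le_rfl (by simp)
    norm_num at this
  simp only [wkbPoly', polyDeriv, wkbPoly_zero, h0, dif_neg, not_false_iff]

theorem wkbPoly_one (z : JetVal) : wkbPoly 1 z = (z 0 1 - z 1 1) / 4 := by
  rw [wkbPoly_succ, wkbPoly'_zero, wkbPoly_zero]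
  simp
  ring

theorem hasDerivAt_wkbPoly (q : ℕ) {Z : ℝ → JetVal} {x : ℝ} (hZ : ∀ i k, 1 ≤ k → k ≤ q →
    HasDerivAt (fun y => Z y i k) (Z x i (k + 1) - Z x i k * Z x i 1) x) :
    HasDerivAt (fun y => wkbPoly q (Z y)) (wkbPoly' q (Z x)) x := by
  rcases q with _ | q
  · rw [wkbPoly'_zero, wkbPoly_zero]
    exact hasDerivAt_const _ _
  · rw [wkbPoly', polyDeriv, dif_pos (homog_wkbPoly q)]
    exact (homog_wkbPoly q).exists_deriv.choose_spec.2 Z x hZ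

theorem lipAt_wkbPoly (q : ℕ) {Z : ℝ → JetVal} {x : ℝ}
    (hZ : ∀ i k, 1 ≤ k → k ≤ q → LipAt (fun y => Z y i k) x) :
    LipAt (fun y => wkbPoly q (Z y)) x := by
  rcases q with _ | q
  · simpa only [wkbPoly_zero] using lipAt_const _ _
  · exact (homog_wkbPoly q).lipAt hZ

/-! ### The remainder of the WKB expansion -/

/-- The term `λ^{1-q} ψ'_{q-1}` of the expansion, in terms of `Y = λ ψ'_{-1}`. -/
def wkbTerm (q : ℕ) (Y : ℂ) (z : JetVal) : ℂ := Y ^ (1 - (q : ℤ)) * wkbPoly q z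

/-- The derivative of `wkbTerm q` along a solution of the eikonal equation. -/
def wkbTerm' (q : ℕ) (Y : ℂ) (z : JetVal) : ℂ :=
  Y ^ (1 - (q : ℤ)) * ((1 - (q : ℂ)) * ((z 0 1 + z 1 1) / 2) * wkbPoly q z + wkbPoly' q z)

/-- The transport equation after rescaling by powers of `λ`, which then disappears. All terms carry
the same power `Y^(1-q)`, so only the recursion for the polynomials is left. -/
theorem wkbTerm_succ (q : ℕ) {Y : ℂ} (hY : Y ≠ 0) (z : JetVal) :
    2 * Y * wkbTerm (q + 1) Y z = wkbTerm' q Y z - z 1 1 * wkbTerm q Y z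
      - ∑ j : Fin q, wkbTerm (j + 1) Y z * wkbTerm (q - j) Y z := by
  have h1 : ∀ j : Fin q, wkbTerm (j + 1) Y z * wkbTerm (q - j) Y z
      = Y ^ (1 - (q : ℤ)) * (wkbPoly (j + 1) z * wkbPoly (q - j) z) := by
    intro j
    unfold wkbTerm
    rw [mul_mul_mul_comm, ← zpow_add₀ hY]
    congr 2
    have : ((q - (j : ℕ) : ℕ) : ℤ) = (q : ℤ) - (j : ℕ) := by
      have := j.2; omega
    rw [this]
    push_cast
    ring
  simp only [h1, ← Finset.mul_sum]
  have h2 : Y * Y ^ (1 - ((q + 1 : ℕ) : ℤ)) = Y ^ (1 - (q : ℤ)) := by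
    rw [← zpow_one_add₀ hY]; congr 1; push_cast; ring
  rw [wkbTerm, wkbPoly_succ, wkbTerm', wkbTerm]
  linear_combination ((1 - (q : ℂ)) * ((z 0 1 + z 1 1) / 2) * wkbPoly q z
      + wkbPoly' q z - z 1 1 * wkbPoly q z
      - ∑ j : Fin q, wkbPoly (j + 1) z * wkbPoly (q - j) z) * h2

/-- The two extreme terms of the Cauchy product, `j = 0` and `j = q + 1`, supply the `2 Y` on the
left of the transport equation. In this form order `q + 1` of `P'²` cancels order `q` of `P'' +
(K'/K) P'`. -/
theorem sum_range_wkbTerm (q : ℕ) {Y : ℂ} (hY : Y ≠ 0) (z : JetVal) :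
    ∑ j ∈ Finset.range (q + 2), wkbTerm j Y z * wkbTerm (q + 1 - j) Y z
      = wkbTerm' q Y z - z 1 1 * wkbTerm q Y z := by
  have h0 : wkbTerm 0 Y z = Y := by simp [wkbTerm, wkbPoly_zero]
  have h1 := wkbTerm_succ q hY z
  rw [Fin.sum_univ_eq_sum_range (fun j => wkbTerm (j + 1) Y z * wkbTerm (q - j) Y z)] at h1
  rw [Finset.sum_range_succ, Finset.sum_range_succ']
  simp only [Nat.sub_self, Nat.sub_zero, h0, Nat.add_sub_add_right]
  linear_combination h1

theorem sum_range_sq (N : ℕ) (T : ℕ → ℂ) :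
    (∑ q ∈ Finset.range (N + 1), T q) ^ 2
      = (∑ s ∈ Finset.range (N + 1), ∑ j ∈ Finset.range (s + 1), T j * T (s - j))
        + ∑ ab ∈ (Finset.range (N + 1) ×ˢ Finset.range (N + 1)).filter
          (fun ab => ¬ ab.1 + ab.2 ≤ N), T ab.1 * T ab.2 := by
  rw [sq, Finset.sum_mul_sum, ← Finset.sum_product', ← Finset.sum_filter_add_sum_filter_not _
    (fun ab : ℕ × ℕ => ab.1 + ab.2 ≤ N)]
  congr 1
  rw [← Finset.sum_fiberwise_of_maps_to (t := Finset.range (N + 1)) (g := fun ab => ab.1 + ab.2)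
    (fun ab h => by simp only [Finset.mem_filter] at h; simpa using Nat.lt_succ_of_le h.2)]
  refine Finset.sum_congr rfl fun s hs => ?_
  rw [← Finset.Nat.sum_antidiagonal_eq_sum_range_succ_mk (fun ab : ℕ × ℕ => T ab.1 * T ab.2)]
  refine Finset.sum_congr ?_ fun _ _ => rfl
  ext ⟨a, b⟩
  simp only [Finset.mem_range, Finset.mem_filter, Finset.mem_product,
    Finset.HasAntidiagonal.mem_antidiagonal] at hs ⊢
  omega

/-- The remainder `P'² - P'' - (K'/K) P' + V_λ` of the expansion with `N + 1` terms. -/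
def wkbRemainder (N : ℕ) (Y : ℂ) (z : JetVal) : ℂ :=
  (∑ q ∈ Finset.range (N + 1), wkbTerm q Y z) ^ 2 - ∑ q ∈ Finset.range (N + 1), wkbTerm' q Y z
    + z 1 1 * ∑ q ∈ Finset.range (N + 1), wkbTerm q Y z - Y ^ 2

/-- Order `0` of the square is the eikonal term `Y²`, and orders `1` to `N` cancel by the transport
equations. What remains is the linear part of order `N`, not matched by any transport equation, and
the products of total order above `N`. -/
theorem wkbRemainder_eq (N : ℕ) {Y : ℂ} (hY : Y ≠ 0) (z : JetVal) :
    wkbRemainder N Y z = -(wkbTerm' N Y z - z 1 1 * wkbTerm N Y z)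
      + ∑ ab ∈ (Finset.range (N + 1) ×ˢ Finset.range (N + 1)).filter
          (fun ab => ¬ ab.1 + ab.2 ≤ N), wkbTerm ab.1 Y z * wkbTerm ab.2 Y z := by
  have h0 : wkbTerm 0 Y z = Y := by simp [wkbTerm, wkbPoly_zero]
  rw [wkbRemainder, sum_range_sq, Finset.sum_range_succ' (fun s => ∑ j ∈ Finset.range (s + 1), _),
    Finset.sum_congr rfl fun s _ => sum_range_wkbTerm s hY z, Finset.sum_sub_distrib,
    ← Finset.mul_sum, Finset.sum_range_succ (fun q => wkbTerm' q Y z),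
    Finset.sum_range_succ (fun q => wkbTerm q Y z)]
  simp only [zero_add, Finset.sum_range_one, Nat.sub_zero, h0]
  ring

/-! ### Pointwise bounds for the expansion -/

theorem exists_bound_wkbTerm (q : ℕ) {C c : ℝ} (hC : 0 ≤ C) (hc : 0 < c) :
    ∃ C', 0 ≤ C' ∧ ∀ (Y : ℂ) (z : JetVal) (Φ G D : ℝ), 0 ≤ Φ → 0 ≤ G → G ≤ C → 0 < D →
      c * D ≤ ‖Y‖ → (∀ i k, 1 ≤ k → k ≤ q + 1 → ‖z i k‖ ≤ C * Φ ^ k * G) →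
      ‖wkbTerm (q + 1) Y z‖ ≤ C' * (Φ ^ (q + 1) * (D ^ q)⁻¹ * G) := by
  obtain ⟨C1, h1, hb⟩ := (homog_wkbPoly q).exists_bound hC
  refine ⟨(c ^ q)⁻¹ * C1, by positivity, fun Y z Φ G D h2 h3 h4 h5 h6 h7 => ?_⟩
  have e : (1 - ((q + 1 : ℕ) : ℤ)) = -(q : ℤ) := by push_cast; ring
  rw [wkbTerm, e, zpow_neg, zpow_natCast, norm_mul, norm_inv, norm_pow]
  calc (‖Y‖ ^ q)⁻¹ * ‖wkbPoly (q + 1) z‖ ≤ ((c * D) ^ q)⁻¹ * (C1 * Φ ^ (q + 1) * G) := by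
        gcongr
        exact hb z Φ G h2 h3 h4 h7
    _ = _ := by rw [mul_pow, mul_inv]; ring

theorem exists_bound_wkbTerm' (q : ℕ) {C c : ℝ} (hC : 0 ≤ C) (hc : 0 < c) :
    ∃ C', 0 ≤ C' ∧ ∀ (Y : ℂ) (z : JetVal) (Φ G D : ℝ), 0 ≤ Φ → 0 ≤ G → G ≤ C → 0 < D →
      c * D ≤ ‖Y‖ → ‖Y‖ ≤ C * D →
      (∀ i k, 1 ≤ k → k ≤ q + 1 → ‖z i k‖ ≤ C * Φ ^ k * G) →
      ‖wkbTerm' q Y z - z 1 1 * wkbTerm q Y z‖ ≤ C' * (Φ ^ (q + 1) * D * (D ^ q)⁻¹ * G) := by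
  have hH : Homog (q + 1) fun z => (1 - (q : ℂ)) * ((z 0 1 + z 1 1) / 2) * wkbPoly q z
      + wkbPoly' q z - z 1 1 * wkbPoly q z := by
    have h1 : Homog 1 fun z : JetVal => (1 - (q : ℂ)) * ((z 0 1 + z 1 1) / 2) := by
      have := ((Homog.var 0 1 le_rfl).add (Homog.var 1 1 le_rfl)).smul ((1 - (q : ℂ)) / 2)
      convert this using 2
      ring
    have h2 : ∀ {p : JetVal → ℂ}, Homog 1 p → Homog (q + 1) fun z => p z * wkbPoly q z := by
      intro p hp
      rcases q with _ | q
      · simpa [wkbPoly_zero] using hp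
      · exact hp.mul' (homog_wkbPoly q) (by omega)
    exact ((h2 h1).add (homog_wkbPoly' q)).sub (h2 (Homog.var 1 1 le_rfl))
  obtain ⟨C1, h1, hb⟩ := hH.exists_bound hC
  refine ⟨C * (c ^ q)⁻¹ * C1, by positivity, fun Y z Φ G D h2 h3 h4 h5 h6 h6' h7 => ?_⟩
  have hY : Y ≠ 0 := norm_pos_iff.1 (lt_of_lt_of_le (by positivity) h6)
  have e : wkbTerm' q Y z - z 1 1 * wkbTerm q Y z = Y * (Y ^ q)⁻¹ *
      ((1 - (q : ℂ)) * ((z 0 1 + z 1 1) / 2) * wkbPoly q z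
      + wkbPoly' q z - z 1 1 * wkbPoly q z) := by
    rw [wkbTerm', wkbTerm, sub_eq_add_neg (1 : ℤ), zpow_one_add₀ hY, zpow_neg, zpow_natCast]
    ring
  rw [e, norm_mul, norm_mul, norm_inv, norm_pow]
  calc ‖Y‖ * (‖Y‖ ^ q)⁻¹ * _ ≤ (C * D) * ((c * D) ^ q)⁻¹ * (C1 * Φ ^ (q + 1) * G) := by
        gcongr
        exact hb z Φ G h2 h3 h4 h7
    _ = _ := by rw [mul_pow, mul_inv]; ring

/-- Each surviving product has weight at least `N + 1`. Its size is reduced to that of weight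
exactly `N + 1` by `Φ ≤ C D`, since every additional order costs one factor `Φ / D`. -/
theorem exists_bound_wkbRemainder (N : ℕ) {C c : ℝ} (hC : 0 ≤ C) (hc : 0 < c) :
    ∃ C', 0 ≤ C' ∧ ∀ (Y : ℂ) (z : JetVal) (Φ G D : ℝ), 0 ≤ Φ → 0 ≤ G → G ≤ C → 0 < D →
      c * D ≤ ‖Y‖ → ‖Y‖ ≤ C * D → Φ ≤ C * D →
      (∀ i k, 1 ≤ k → k ≤ N + 1 → ‖z i k‖ ≤ C * Φ ^ k * G) →
      ‖wkbRemainder N Y z‖ ≤ C' * (Φ ^ (N + 1) * D * (D ^ N)⁻¹ * G) := by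
  obtain ⟨C1, h1, hb1⟩ := exists_bound_wkbTerm' N hC hc
  choose B hB0 hB using fun q => exists_bound_wkbTerm q hC hc
  have hpair : ∀ a b, a ≤ N → b ≤ N → N < a + b → ∃ C', 0 ≤ C' ∧
      ∀ (Y : ℂ) (z : JetVal) (Φ G D : ℝ), 0 ≤ Φ → 0 ≤ G → G ≤ C → 0 < D →
      c * D ≤ ‖Y‖ → ‖Y‖ ≤ C * D → Φ ≤ C * D →
      (∀ i k, 1 ≤ k → k ≤ N + 1 → ‖z i k‖ ≤ C * Φ ^ k * G) →
      ‖wkbTerm a Y z * wkbTerm b Y z‖ ≤ C' * (Φ ^ (N + 1) * D * (D ^ N)⁻¹ * G) := by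
    intro a b ha hb hab
    obtain ⟨a, rfl⟩ : ∃ a', a = a' + 1 := ⟨a - 1, by omega⟩
    obtain ⟨b, rfl⟩ : ∃ b', b = b' + 1 := ⟨b - 1, by omega⟩
    -- `e` is the excess of the total order over `N + 1`. Both indices are positive, because each is
    -- at most `N` while their sum exceeds `N`.
    obtain ⟨e, he⟩ : ∃ e, a + 1 + (b + 1) = N + 1 + e := ⟨a + b + 1 - N, by omega⟩
    refine ⟨B a * B b * C ^ e * C, by have := hB0 a; have := hB0 b; positivity,
      fun Y z Φ G D h2 h3 h4 h5 h6 h6' h8 h7 => ?_⟩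
    have := hB0 a
    have := hB0 b
    rw [norm_mul]
    have h10 : D * D ^ (a + b) = D ^ N * D ^ e := by
      rw [← pow_succ', ← pow_add]; congr 1; omega
    calc ‖wkbTerm (a + 1) Y z‖ * ‖wkbTerm (b + 1) Y z‖
        ≤ (B a * (Φ ^ (a + 1) * (D ^ a)⁻¹ * G)) * (B b * (Φ ^ (b + 1) * (D ^ b)⁻¹ * G)) :=
          mul_le_mul (hB a Y z Φ G D h2 h3 h4 h5 h6 fun i k hk hk' => h7 i k hk (by omega))
            (hB b Y z Φ G D h2 h3 h4 h5 h6 fun i k hk hk' => h7 i k hk (by omega))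
            (norm_nonneg _) (by positivity)
      _ = B a * B b * (Φ ^ (N + 1) * Φ ^ e * (D ^ (a + b))⁻¹ * G * G) := by
          rw [← pow_add, ← he, pow_add Φ, pow_add D, mul_inv]; ring
      _ ≤ B a * B b * (Φ ^ (N + 1) * (C * D) ^ e * (D ^ (a + b))⁻¹ * G * C) := by gcongr
      _ = B a * B b * C ^ e * C * (Φ ^ (N + 1) * D * (D ^ N)⁻¹ * G) := by
          have : D ^ e * (D ^ (a + b))⁻¹ = D * (D ^ N)⁻¹ := by
            field_simp
            linarith
          rw [mul_pow]
          linear_combination B a * B b * C ^ e * C * Φ ^ (N + 1) * G * this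
  choose! E hE0 hE using hpair
  set S := (Finset.range (N + 1) ×ˢ Finset.range (N + 1)).filter
          (fun ab => ¬ ab.1 + ab.2 ≤ N) with hS
  have hmem : ∀ ab ∈ S, ab.1 ≤ N ∧ ab.2 ≤ N ∧ N < ab.1 + ab.2 := fun ab h => by
    simp only [hS, Finset.mem_filter, Finset.mem_product, Finset.mem_range] at h
    omega
  refine ⟨C1 + ∑ ab ∈ S, E ab.1 ab.2, add_nonneg h1 (Finset.sum_nonneg fun ab h =>
    hE0 _ _ (hmem ab h).1 (hmem ab h).2.1 (hmem ab h).2.2),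
    fun Y z Φ G D h2 h3 h4 h5 h6 h6' h8 h7 => ?_⟩
  have hY : Y ≠ 0 := norm_pos_iff.1 (lt_of_lt_of_le (by positivity) h6)
  rw [wkbRemainder_eq N hY, add_mul, Finset.sum_mul]
  refine (norm_add_le _ _).trans (add_le_add ?_ ((norm_sum_le _ _).trans
    (Finset.sum_le_sum fun ab h => ?_)))
  · rw [norm_neg]
    exact hb1 Y z Φ G D h2 h3 h4 h5 h6 h6' h7
  · exact hE _ _ (hmem ab h).1 (hmem ab h).2.1 (hmem ab h).2.2 Y z Φ G D h2 h3 h4 h5 h6 h6' h8 h7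

end DiracWKB

/-! ### The two ends of the line and the cut-off radius. -/

namespace DiracWKB

/-! ### The two ends -/

theorem Side.sgn_mul_self (s : Side) : s.sgn * s.sgn = 1 := by
  cases s <;> norm_num [Side.sgn]

theorem Side.sgn_mul_sgn_mul (s : Side) (x : ℝ) : s.sgn * (s.sgn * x) = x := by
  rw [← mul_assoc, s.sgn_mul_self, one_mul]

theorem Side.abs_sgn (s : Side) : |s.sgn| = 1 := by
  cases s <;> norm_num [Side.sgn]

theorem Side.abs_eq {s : Side} {x : ℝ} (h : 0 ≤ s.sgn * x) : |x| = s.sgn * x := by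
  rw [← abs_of_nonneg h, abs_mul, s.abs_sgn, one_mul]

theorem Side.sgn_mul_le_abs (s : Side) (x : ℝ) : s.sgn * x ≤ |x| := by
  refine (le_abs_self _).trans ?_
  rw [abs_mul, s.abs_sgn, one_mul]

theorem Side.exists_nonneg (x : ℝ) : ∃ s : Side, 0 ≤ s.sgn * x := by
  rcases le_total 0 x with h | h
  · exact ⟨.plus, by simpa [Side.sgn] using h⟩
  · exact ⟨.minus, by simpa [Side.sgn] using h⟩

theorem Side.eventually_iff {s : Side} {p : ℝ → Prop} :
    (∀ᶠ x in s.filter, p x) ↔ ∃ R > 0, ∀ x, R ≤ s.sgn * x → p x := by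
  cases s
  · simp only [Side.filter, eventually_atBot, Side.sgn]
    constructor
    · rintro ⟨a, ha⟩
      exact ⟨|a| + 1, by positivity, fun x hx => ha x (by linarith [neg_abs_le a])⟩
    · rintro ⟨R, -, hR⟩
      exact ⟨-R, fun x hx => hR x (by linarith)⟩
  · simp only [Side.filter, eventually_atTop, Side.sgn]
    constructor
    · rintro ⟨a, ha⟩
      exact ⟨|a| + 1, by positivity, fun x hx => ha x (by linarith [le_abs_self a])⟩
    · rintro ⟨R, -, hR⟩
      exact ⟨R, fun x hx => hR x (by linarith)⟩

theorem Side.ae_of_eventually_inf_ae {s : Side} {p : ℝ → Prop}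
    (h : ∀ᶠ x in s.filter ⊓ ae volume, p x) : ∃ R > 0, ∀ᵐ x, R ≤ s.sgn * x → p x := by
  obtain ⟨A, hA, B, hB, hAB⟩ := Filter.mem_inf_iff_superset.1 h
  obtain ⟨R, hR0, hR⟩ := Side.eventually_iff.1 (show ∀ᶠ x in s.filter, x ∈ A from hA)
  exact ⟨R, hR0, (show ∀ᵐ x, x ∈ B from hB).mono fun x hx hxR => hAB ⟨hR x hxR, hx⟩⟩

theorem forall_side_eventually {α : Type*} {l : Filter α} {p : Side → α → Prop} :
    (∀ᶠ x in l, ∀ s, p s x) ↔ ∀ s, ∀ᶠ x in l, p s x := by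
  constructor
  · exact fun h s => h.mono fun x hx => hx s
  · intro h
    filter_upwards [h .minus, h .plus] with x h1 h2 s
    cases s
    exacts [h1, h2]

theorem exists_bound_of_isBigO_one {E : Type*} [NormedAddCommGroup E] {s : Side} {h : ℝ → E}
    (hc : Continuous h) (hb : h =O[s.filter] fun _ => (1 : ℝ)) :
    ∃ C, 0 ≤ C ∧ ∀ x, 0 ≤ s.sgn * x → ‖h x‖ ≤ C := by
  obtain ⟨C, hC⟩ := hb.bound
  obtain ⟨R, hR0, hR⟩ := Side.eventually_iff.1 hC
  obtain ⟨B, hB⟩ := (isCompact_Icc (a := -R) (b := R)).exists_bound_of_continuousOn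
    hc.continuousOn
  refine ⟨max |C| |B|, by positivity, fun x hx => ?_⟩
  rcases le_total R (s.sgn * x) with h1 | h1
  · exact ((by simpa using hR x h1 : ‖h x‖ ≤ C).trans (le_abs_self C)).trans (le_max_left _ _)
  · rw [← Side.abs_eq hx] at h1
    exact ((hB x (abs_le.1 h1)).trans (le_abs_self B)).trans (le_max_right _ _)

theorem isBigO_one_of_bound {E : Type*} [NormedAddCommGroup E] {s : Side} {h : ℝ → E}
    {C : ℝ} (hb : ∀ x, 0 ≤ s.sgn * x → ‖h x‖ ≤ C) : h =O[s.filter] fun _ => (1 : ℝ) := by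
  refine IsBigO.of_bound C (Side.eventually_iff.2 ⟨1, one_pos, fun x hx => ?_⟩)
  simpa using hb x (by linarith)

/-! ### The cut-off radius -/

variable {m : ℝ} {N : ℕ} {V : ℝ → Matrix (Fin 2) (Fin 2) ℂ} {f : ℝ → ℝ} {μ ε ν : Side → ℝ}
  {η ε₁ : ℝ}

theorem Admissible.continuous_gFun (hV : Admissible N V f μ ε ν) (hε₁ : ε₁ < 1) (s : Side) :
    Continuous (gFun m V f ν η ε₁ s) := by
  have h0 := hV.diag_continuous 0
  have h1 := hV.diag_continuous 1
  have hM : Continuous fun x => max (max (η⁻¹ * |(V x 0 0).re + m|) (η⁻¹ * |(V x 1 1).re - m|))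
      (η⁻¹ * |(V x 0 0).im - (V x 1 1).im|) := by
    have := Complex.continuous_re.comp h0
    have := Complex.continuous_re.comp h1
    have := Complex.continuous_im.comp h0
    have := Complex.continuous_im.comp h1
    simp only [Function.comp_def] at *
    fun_prop
  have hF : 0 < ν s → Continuous fun x => |f x| ^ (2 * ν s / (1 - ε₁)) := fun h =>
    (hV.f_continuous.abs).rpow_const fun x => Or.inr (by
      have : 0 < 1 - ε₁ := by linarith
      positivity)
  unfold gFun
  by_cases hP : PartsBounded V s <;> by_cases hν : 0 < ν s <;> simp only [hP, hν, if_true, if_false]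
  · exact hF hν
  · exact continuous_const
  · exact hM.max (hF hν)
  · exact hM

/-- The radius is the first point where the continuous function `g` attains the value `λ`. If `g`
exceeded `λ` at or before that point, the intermediate value theorem would give an earlier one. -/
theorem Admissible.gFun_le (hV : Admissible N V f μ ε ν) (hε₁ : ε₁ < 1) {lam : ℝ} {s : Side}
    (hlam : gFun m V f ν η ε₁ s 0 ≤ lam) {x : ℝ} (hx : 0 ≤ s.sgn * x)
    (hxδ : ((s.sgn * x : ℝ) : EReal) ≤ cutRadius m V f ν η ε₁ s lam) :
    gFun m V f ν η ε₁ s x ≤ lam := by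
  by_contra hlt
  rw [not_le] at hlt
  have hcont : Continuous fun y => gFun m V f ν η ε₁ s (s.sgn * y) :=
    (hV.continuous_gFun hε₁ s).comp (by fun_prop)
  obtain ⟨y, hy, hy'⟩ := intermediate_value_Icc hx hcont.continuousOn
    (show lam ∈ Set.Icc _ _ from ⟨by simpa using hlam, by
      simpa only [s.sgn_mul_sgn_mul] using hlt.le⟩)
  have hne : y ≠ s.sgn * x := fun h => by
    rw [h] at hy'
    simp only [s.sgn_mul_sgn_mul] at hy'
    exact hlt.ne' hy'
  have h1 : cutRadius m V f ν η ε₁ s lam ≤ (y : EReal) := sInf_le ⟨y, ⟨hy.1, hy'⟩, rfl⟩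
  have h2 := hxδ.trans h1
  rw [EReal.coe_le_coe_iff] at h2
  exact hne (le_antisymm hy.2 h2)

theorem Admissible.eventually_gFun_le (hV : Admissible N V f μ ε ν) (hε₁ : ε₁ < 1) (m η : ℝ) :
    ∀ᶠ lam in atTop, ∀ s x, 0 ≤ s.sgn * x →
      ((s.sgn * x : ℝ) : EReal) ≤ cutRadius m V f ν η ε₁ s lam → gFun m V f ν η ε₁ s x ≤ lam := by
  rw [forall_side_eventually]
  intro s
  filter_upwards [eventually_ge_atTop (gFun m V f ν η ε₁ s 0)] with lam hlam x hx hx'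
  exact hV.gFun_le hε₁ hlam hx hx'

/-- On a fixed compact set `g` is bounded and cannot attain a large value `λ`; so the radii tend to
infinity. -/
theorem Admissible.eventually_lt_cutRadius (hV : Admissible N V f μ ε ν) (hε₁ : ε₁ < 1)
    (m η R : ℝ) (s : Side) : ∀ᶠ lam in atTop, (R : EReal) < cutRadius m V f ν η ε₁ s lam := by
  obtain ⟨B, hB⟩ := (isCompact_Icc (a := -|R| - 1) (b := |R| + 1)).exists_bound_of_continuousOn
    (hV.continuous_gFun (m := m) (η := η) hε₁ s).continuousOn
  filter_upwards [eventually_gt_atTop B] with lam hlam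
  have h1 : ((|R| + 1 : ℝ) : EReal) ≤ cutRadius m V f ν η ε₁ s lam := by
    refine le_sInf ?_
    rintro _ ⟨x, ⟨hx0, hx⟩, rfl⟩
    by_contra hlt
    simp only [not_le, EReal.coe_lt_coe_iff] at hlt
    have h2 : |s.sgn * x| ≤ |R| + 1 := by
      rw [abs_mul, s.abs_sgn, one_mul, abs_of_nonneg hx0]; exact hlt.le
    have h3 := hB (s.sgn * x) ⟨by linarith [(abs_le.1 h2).1], (abs_le.1 h2).2⟩
    rw [hx, Real.norm_eq_abs] at h3
    linarith [le_abs_self lam]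
  refine lt_of_lt_of_le ?_ h1
  rw [EReal.coe_lt_coe_iff]
  linarith [le_abs_self R]

theorem cutRadius_eq_top (h : NoCut V ν s) (m f η ε₁) {lam : ℝ} (hlam : 0 < lam) :
    cutRadius m V f ν η ε₁ s lam = ⊤ := by
  have h2 : ¬ 0 < ν s := not_lt.2 h.2
  unfold cutRadius gFun
  simp only [h.1, h2, if_true, if_false, hlam.ne, and_false, Set.ofPred_false, Set.image_empty,
    sInf_empty]

theorem le_gFun_of_not_partsBounded {s : Side} (h : ¬ PartsBounded V s) (m f η ε₁) (x : ℝ) :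
    η⁻¹ * |(V x 0 0).re + m| ≤ gFun m V f ν η ε₁ s x ∧
    η⁻¹ * |(V x 1 1).re - m| ≤ gFun m V f ν η ε₁ s x ∧
    η⁻¹ * |(V x 0 0).im - (V x 1 1).im| ≤ gFun m V f ν η ε₁ s x := by
  unfold gFun
  simp only [h, if_false]
  split_ifs <;> simp

theorem le_gFun_of_pos {s : Side} (h : 0 < ν s) (m f η ε₁) (x : ℝ) :
    |f x| ^ (2 * ν s / (1 - ε₁)) ≤ gFun m V f ν η ε₁ s x := by
  unfold gFun
  simp only [h, if_true]
  split_ifs <;> simp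

/-- If a cut-off is needed then `g` is unbounded at that end: through `f` when the parts are bounded
(then `ν > 0`), and through one of the three parts otherwise. An infinite radius would contradict `g
≤ λ`. -/
theorem Admissible.cutRadius_lt_top (hV : Admissible N V f μ ε ν) (hη : 0 < η) (hε₁ : ε₁ < 1)
    {s : Side} (h : ¬ NoCut V ν s) (m : ℝ) :
    ∀ᶠ lam in atTop, cutRadius m V f ν η ε₁ s lam < ⊤ := by
  have hub : ∀ lam : ℝ, ∃ x, 0 ≤ s.sgn * x ∧ lam < gFun m V f ν η ε₁ s x := by
    intro lam
    by_contra hcon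
    push Not at hcon
    by_cases hP : PartsBounded V s
    · have hν : 0 < ν s := by
        by_contra hν
        exact h ⟨hP, not_lt.1 hν⟩
      have hp : 0 < 2 * ν s / (1 - ε₁) := by
        have : 0 < 1 - ε₁ := by linarith
        positivity
      refine hV.f_unbounded s (isBigO_one_of_bound (C := |lam| ^ (2 * ν s / (1 - ε₁))⁻¹)
        fun x hx => ?_)
      have h1 := (le_gFun_of_pos (V := V) hν m f η ε₁ x).trans (hcon x hx)
      rw [Real.norm_eq_abs, Real.le_rpow_inv_iff_of_pos (abs_nonneg _) (abs_nonneg _) hp]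
      exact h1.trans (le_abs_self lam)
    · have key : ∀ (w : ℝ → ℝ) (c : ℝ), (∀ x, η⁻¹ * |w x + c| ≤ gFun m V f ν η ε₁ s x) →
          w =O[s.filter] fun _ => (1 : ℝ) := fun w c hw =>
        isBigO_one_of_bound (C := η * lam + |c|) fun x hx => by
          have h1 := (hw x).trans (hcon x hx)
          rw [inv_mul_le_iff₀ hη] at h1
          rw [Real.norm_eq_abs]
          have h2 := abs_sub (w x + c) c
          rw [add_sub_cancel_right] at h2
          linarith
      have hall := fun x => le_gFun_of_not_partsBounded (ν := ν) hP m f η ε₁ x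
      exact hP ⟨key _ m fun x => (hall x).1, key _ (-m) fun x => by
        simpa [sub_eq_add_neg] using (hall x).2.1, key _ 0 fun x => by
        simpa using (hall x).2.2⟩
  filter_upwards [eventually_ge_atTop (gFun m V f ν η ε₁ s 0)] with lam hlam
  obtain ⟨x, hx, hx'⟩ := hub lam
  by_contra htop
  rw [not_lt, top_le_iff] at htop
  exact absurd (hV.gFun_le hε₁ hlam hx (by rw [htop]; exact le_top)) (not_le.2 hx')

/-- The relative smallness of the real parts and of the difference of the imaginary parts on the
support of the cut-off. -/
theorem Admissible.eventually_parts_le (hV : Admissible N V f μ ε ν) (hη : 0 < η) (hε₁ : ε₁ < 1)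
    (m : ℝ) : ∀ᶠ lam : ℝ in atTop, ∀ s x, 0 ≤ s.sgn * x →
      ((s.sgn * x : ℝ) : EReal) ≤ cutRadius m V f ν η ε₁ s lam →
      |(V x 0 0).re + m| ≤ η * lam ∧ |(V x 1 1).re - m| ≤ η * lam ∧
      |(V x 0 0).im - (V x 1 1).im| ≤ η * lam := by
  rw [forall_side_eventually]
  intro s
  by_cases hP : PartsBounded V s
  · have h0 := hV.diag_continuous 0
    have h1 := hV.diag_continuous 1
    obtain ⟨C0, -, hC0⟩ := exists_bound_of_isBigO_one (Complex.continuous_re.comp h0) hP.1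
    obtain ⟨C1, -, hC1⟩ := exists_bound_of_isBigO_one (Complex.continuous_re.comp h1) hP.2.1
    obtain ⟨C2, -, hC2⟩ := exists_bound_of_isBigO_one ((Complex.continuous_im.comp h0).sub
      (Complex.continuous_im.comp h1)) hP.2.2
    have hev : ∀ C : ℝ, ∀ᶠ lam : ℝ in atTop, C ≤ η * lam := fun C => by
      filter_upwards [eventually_ge_atTop (C / η)] with lam hlam
      rwa [div_le_iff₀' hη] at hlam
    filter_upwards [hev (C0 + |m|), hev (C1 + |m|), hev C2] with lam l0 l1 l2 x hx _
    have e0 := hC0 x hx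
    have e1 := hC1 x hx
    have e2 := hC2 x hx
    simp only [Function.comp, Real.norm_eq_abs] at e0 e1 e2
    exact ⟨(abs_add_le _ _).trans (by linarith), (abs_sub _ _).trans (by linarith),
      e2.trans l2⟩
  · filter_upwards [forall_side_eventually.1 (hV.eventually_gFun_le hε₁ m η) s]
      with lam hlam x hx hx'
    have hg := hlam x hx hx'
    obtain ⟨a, b, c⟩ := le_gFun_of_not_partsBounded (ν := ν) hP m f η ε₁ x
    have key : ∀ {t : ℝ}, η⁻¹ * t ≤ gFun m V f ν η ε₁ s x → t ≤ η * lam := fun ht => by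
      have := ht.trans hg
      rwa [inv_mul_le_iff₀ hη] at this
    exact ⟨key a, key b, key c⟩

/-- The exponent `2ν / (1 - ε₁)` in `g` is chosen for this bound: raise `g ≤ λ` to the power `(1 -
ε₁) / 2`. -/
theorem Admissible.eventually_rpow_le (hV : Admissible N V f μ ε ν) (hε₁ : ε₁ < 1)
    (m η : ℝ) : ∀ᶠ lam : ℝ in atTop, ∀ s x, 0 < ν s → 0 ≤ s.sgn * x →
      ((s.sgn * x : ℝ) : EReal) ≤ cutRadius m V f ν η ε₁ s lam →
      |f x| ^ ν s ≤ lam ^ ((1 - ε₁) / 2) := by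
  filter_upwards [hV.eventually_gFun_le hε₁ m η, eventually_gt_atTop 0] with lam hlam hpos s x hν hx hx'
  have h1 := (le_gFun_of_pos (V := V) hν m f η ε₁ x).trans (hlam s x hx hx')
  have h2 : 0 < 1 - ε₁ := by linarith
  have h3 := Real.rpow_le_rpow (by positivity) h1 (show 0 ≤ (1 - ε₁) / 2 by positivity)
  rw [← Real.rpow_mul (abs_nonneg _)] at h3
  convert h3 using 2
  field_simp

end DiracWKB

/-! ### The transport equations of the Dirac operator solved by the universal polynomials. -/

namespace DiracWKB

variable {m : ℝ} {N : ℕ} {V : ℝ → Matrix (Fin 2) (Fin 2) ℂ} {f : ℝ → ℝ} {μ ε ν : Side → ℝ}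
  {η ε₁ lam : ℝ} {J : Fin 2 → ℕ → ℝ → ℂ} {x : ℝ}

/-! ### The WKB construction in terms of jets -/

/-- The two factors `λ - m - V₁₁` and `λ + m - V₂₂` of `V_λ`. -/
def factor (m : ℝ) (V : ℝ → Matrix (Fin 2) (Fin 2) ℂ) (lam : ℝ) (i : Fin 2) (x : ℝ) : ℂ :=
  lam + (![-m, m] i : ℝ) - V x i i

theorem den_eq_factor (m V lam x) : den m V lam x = factor m V lam 1 x := by
  simp [den, factor]

theorem Vlam_eq_factor (m V lam x) :
    Vlam m V lam x = factor m V lam 0 x * factor m V lam 1 x := by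
  simp [Vlam, den, factor, sub_eq_add_neg]

/-- The open set on which both factors of `V_λ` have positive real part. -/
def goodSet (m : ℝ) (V : ℝ → Matrix (Fin 2) (Fin 2) ℂ) (lam : ℝ) : Set ℝ :=
  {x | ∀ i, 0 < (factor m V lam i x).re}

/-- The normalised derivatives of the factors. -/
def jetVal (m : ℝ) (V : ℝ → Matrix (Fin 2) (Fin 2) ℂ) (J : Fin 2 → ℕ → ℝ → ℂ) (lam : ℝ)
    (x : ℝ) : JetVal :=
  fun i k => -J i k x / factor m V lam i x

/-- The function `λ ψ'_{-1} = i V_λ^{1/2}`. -/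
def eikonal (m : ℝ) (V : ℝ → Matrix (Fin 2) (Fin 2) ℂ) (lam : ℝ) (x : ℝ) : ℂ :=
  Complex.I * Vlam m V lam x ^ (1 / 2 : ℂ)

/-- The functions `J i k` with `k ≤ q` are differentiable at `x` with derivatives
`J i (k + 1)`. -/
def JetAt (J : Fin 2 → ℕ → ℝ → ℂ) (q : ℕ) (x : ℝ) : Prop :=
  ∀ i, ∀ k ≤ q, HasDerivAt (J i k) (J i (k + 1) x) x

theorem JetAt.mono {q q' : ℕ} (h : JetAt J q x) (hq : q' ≤ q) : JetAt J q' x :=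
  fun i k hk => h i k (hk.trans hq)

theorem jetAt_of_lt (hJ : ∀ i, IsJet N (fun x => V x i i) (J i)) {q : ℕ} (hq : q < N) (x : ℝ) :
    JetAt J q x := fun i k hk => (hJ i).hasDerivAt k (by omega) x

theorem ae_jetAt (hJ : ∀ i, IsJet N (fun x => V x i i) (J i)) : ∀ᵐ x, JetAt J N x := by
  have h : ∀ᵐ x, ∀ i, HasDerivAt (J i N) (J i (N + 1) x) x :=
    ae_all_iff.2 fun i => (hJ i).ae_hasDerivAt
  filter_upwards [h] with x hx i k hk
  rcases hk.lt_or_eq with hk | rfl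
  · exact (hJ i).hasDerivAt k hk x
  · exact hx i

theorem factor_ne_zero (hx : x ∈ goodSet m V lam) (i : Fin 2) : factor m V lam i x ≠ 0 :=
  fun h => by simpa [h] using hx i

theorem factor_mem_slitPlane (hx : x ∈ goodSet m V lam) (i : Fin 2) :
    factor m V lam i x ∈ Complex.slitPlane := Or.inl (hx i)

/-- The arguments of the two numbers lie in `(-π/2, π/2)`, so their sum never reaches `±π`. The
proof is the corresponding algebraic contradiction. It keeps the principal square root of `V_λ`
smooth on `goodSet`. -/
theorem mul_mem_slitPlane {a b : ℂ} (ha : 0 < a.re) (hb : 0 < b.re) :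
    a * b ∈ Complex.slitPlane := by
  rw [Complex.mem_slitPlane_iff]
  by_contra h
  push Not at h
  obtain ⟨h1, h2⟩ := h
  rw [Complex.mul_re] at h1
  rw [Complex.mul_im] at h2
  have h3 : b.re * a.im ^ 2 + a.re ^ 2 * b.re ≤ 0 := by
    have : a.im * (a.re * b.im) = -(a.im ^ 2 * b.re) := by linear_combination a.im * h2
    nlinarith
  nlinarith [mul_pos (pow_pos ha 2) hb, mul_nonneg hb.le (sq_nonneg a.im)]

theorem Vlam_mem_slitPlane (hx : x ∈ goodSet m V lam) : Vlam m V lam x ∈ Complex.slitPlane := by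
  rw [Vlam_eq_factor]
  exact mul_mem_slitPlane (hx 0) (hx 1)

theorem eikonal_sq (m V lam x) : eikonal m V lam x ^ 2 = -Vlam m V lam x := by
  rw [eikonal, mul_pow, Complex.I_sq, ← Complex.cpow_nat_mul]
  norm_num

theorem eikonal_ne_zero (hx : x ∈ goodSet m V lam) : eikonal m V lam x ≠ 0 := by
  intro h
  have := eikonal_sq m V lam x
  rw [h] at this
  exact Complex.slitPlane_ne_zero (Vlam_mem_slitPlane hx) (by simpa using this.symm)

theorem hasDerivAt_factor (hJ : ∀ i, IsJet N (fun x => V x i i) (J i)) (hx : JetAt J 0 x)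
    (i : Fin 2) : HasDerivAt (factor m V lam i) (-J i 1 x) x := by
  have h := (hx i 0 le_rfl).const_sub ((lam : ℂ) + (![-m, m] i : ℝ))
  rw [(hJ i).zero] at h
  exact h

theorem hasDerivAt_jetVal (hJ : ∀ i, IsJet N (fun x => V x i i) (J i)) {q : ℕ}
    (hx : JetAt J q x) (hg : x ∈ goodSet m V lam) (i : Fin 2) (k : ℕ) (hk : k ≤ q) :
    HasDerivAt (fun y => jetVal m V J lam y i k)
      (jetVal m V J lam x i (k + 1) - jetVal m V J lam x i k * jetVal m V J lam x i 1) x := by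
  have h0 := factor_ne_zero hg i
  have h := ((hx i k hk).neg).div (hasDerivAt_factor hJ (hx.mono (Nat.zero_le _)) i) h0
  refine h.congr_deriv ?_
  simp only [jetVal]
  field_simp
  simp
  ring

theorem hasDerivAt_eikonal (hJ : ∀ i, IsJet N (fun x => V x i i) (J i)) (hx : JetAt J 0 x)
    (hg : x ∈ goodSet m V lam) :
    HasDerivAt (eikonal m V lam) (eikonal m V lam x *
      ((jetVal m V J lam x 0 1 + jetVal m V J lam x 1 1) / 2)) x := by
  have h0 := factor_ne_zero hg 0
  have h1 := factor_ne_zero hg 1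
  have hV : HasDerivAt (Vlam m V lam) (Vlam m V lam x *
      (jetVal m V J lam x 0 1 + jetVal m V J lam x 1 1)) x := by
    have h := (hasDerivAt_factor (m := m) (lam := lam) hJ hx 0).mul
      (hasDerivAt_factor (m := m) (lam := lam) hJ hx 1)
    rw [show Vlam m V lam = factor m V lam 0 * factor m V lam 1 from
      funext fun y => Vlam_eq_factor m V lam y]
    refine h.congr_deriv ?_
    simp only [jetVal, Pi.mul_apply]
    field_simp
  have hs := Vlam_mem_slitPlane hg
  have hp := ((hasDerivAt_id (Vlam m V lam x)).cpow_const (c := (1 / 2 : ℂ)) hs).comp x hV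
  refine (hp.const_mul Complex.I).congr_deriv ?_
  have hne := Complex.slitPlane_ne_zero hs
  simp only [id, eikonal]
  rw [Complex.cpow_sub _ _ hne, Complex.cpow_one]
  field_simp

theorem hasDerivAt_wkbTerm (hJ : ∀ i, IsJet N (fun x => V x i i) (J i)) {q : ℕ}
    (hx : JetAt J q x) (hg : x ∈ goodSet m V lam) :
    HasDerivAt (fun y => wkbTerm q (eikonal m V lam y) (jetVal m V J lam y))
      (wkbTerm' q (eikonal m V lam x) (jetVal m V J lam x)) x := by
  have hY := eikonal_ne_zero hg
  have h1 := (hasDerivAt_zpow (1 - (q : ℤ)) (eikonal m V lam x) (Or.inl hY)).comp x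
    (hasDerivAt_eikonal hJ (hx.mono (Nat.zero_le _)) hg)
  have h2 := hasDerivAt_wkbPoly q fun i k _ hk => hasDerivAt_jetVal hJ hx hg i k hk
  refine (h1.mul h2).congr_deriv ?_
  rw [wkbTerm', zpow_sub_one₀ hY]
  simp only [Function.comp]
  push_cast
  field_simp

theorem isOpen_goodSet (hc : ∀ i, Continuous fun x => V x i i) : IsOpen (goodSet m V lam) := by
  have : goodSet m V lam = ⋂ i, {x | 0 < (factor m V lam i x).re} := by
    ext; simp [goodSet]
  rw [this]
  refine isOpen_iInter_of_finite fun i => isOpen_lt continuous_const ?_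
  exact Complex.continuous_re.comp (continuous_const.sub (hc i))

theorem IsJet.continuous {g : ℝ → ℂ} {J : ℕ → ℝ → ℂ} (h : IsJet N g J) : Continuous g := by
  rw [← h.zero]
  exact continuous_iff_continuousAt.2 fun x => (h.lipAt 0 (Nat.zero_le _) x).continuousAt

theorem lipAt_factor (hJ : ∀ i, IsJet N (fun x => V x i i) (J i)) (i : Fin 2) :
    LipAt (factor m V lam i) x := by
  have := (hJ i).lipAt 0 (Nat.zero_le _) x
  rw [(hJ i).zero] at this
  exact (lipAt_const _ _).sub this

theorem lipAt_wkbTerm (hJ : ∀ i, IsJet N (fun x => V x i i) (J i)) {q : ℕ} (hq : q ≤ N)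
    (hg : x ∈ goodSet m V lam) :
    LipAt (fun y => wkbTerm q (eikonal m V lam y) (jetVal m V J lam y)) x := by
  have hf := fun i => lipAt_factor (m := m) (lam := lam) (x := x) hJ i
  refine LipAt.mul ?_ (lipAt_wkbPoly q fun i k _ hk => ?_)
  · have h1 : LipAt (Vlam m V lam) x :=
      ((hf 0).mul (hf 1)).congr (Eventually.of_forall fun y => Vlam_eq_factor m V lam y)
    have h2 : LipAt (eikonal m V lam) x := (lipAt_const _ _).mul
      (h1.comp (g := fun w : ℂ => w ^ (1 / 2 : ℂ)) (by
        have hs := Vlam_mem_slitPlane hg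
        have : AnalyticAt ℂ (fun w : ℂ => w ^ (1 / 2 : ℂ)) (Vlam m V lam x) :=
          analyticAt_id.cpow analyticAt_const hs
        exact (this.contDiffAt (n := 1)).restrict_scalars ℝ))
    refine h2.comp (g := fun w : ℂ => w ^ (1 - (q : ℤ))) ?_
    have : AnalyticAt ℂ (fun w : ℂ => w ^ (1 - (q : ℤ))) (eikonal m V lam x) :=
      analyticAt_id.zpow (eikonal_ne_zero hg)
    exact (this.contDiffAt (n := 1)).restrict_scalars ℝ
  · exact (((hJ i).lipAt k (hk.trans hq) x).neg.mul ((hf i).inv (factor_ne_zero hg i))).congr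
      (Eventually.of_forall fun y => div_eq_mul_inv _ _)

theorem k₁_ne_zero (V x) : k₁ V x ≠ 0 := Complex.exp_ne_zero _

/-- The equality of the off-diagonal entries removes `k₁ / k₂` from `K_λ`, and `K'/K` becomes the
logarithmic derivative of `1 / (λ + m - V₂₂)`. -/
theorem k₁_eq_k₂ (hsymm : ∀ᵐ x, V x 0 1 = V x 1 0) : k₁ V = k₂ V := by
  funext x
  unfold k₁ k₂
  congr 2
  exact intervalIntegral.integral_congr_ae (hsymm.mono fun t ht _ => ht.symm)

theorem Klam_eq (hk : k₁ V = k₂ V) (m lam) : Klam m V lam = fun x => (factor m V lam 1 x)⁻¹ := by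
  funext x
  rw [Klam, ← hk, div_self (k₁_ne_zero V x), den_eq_factor, one_div]

theorem deriv_Klam_div (hJ : ∀ i, IsJet N (fun x => V x i i) (J i)) (hk : k₁ V = k₂ V)
    (hx : JetAt J 0 x) (hg : x ∈ goodSet m V lam) :
    deriv (Klam m V lam) x / Klam m V lam x = -jetVal m V J lam x 1 1 := by
  have h1 := factor_ne_zero hg 1
  rw [Klam_eq hk, ((hasDerivAt_factor hJ hx 1).fun_inv h1).deriv, jetVal]
  field_simp

/-- The solutions of the transport equations in terms of jets. -/
theorem psiD_eq (hJ : ∀ i, IsJet N (fun x => V x i i) (J i)) (hk : k₁ V = k₂ V)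
    (hlam : 0 < lam) {q : ℕ} (hq : q ≤ N) (hg : x ∈ goodSet m V lam) :
    psiD m V lam q x = (lam : ℂ) ^ ((q : ℤ) - 1) *
      wkbTerm q (eikonal m V lam x) (jetVal m V J lam x) := by
  have hl : (lam : ℂ) ≠ 0 := by exact_mod_cast hlam.ne'
  have hz : ∀ y, psiD m V lam 0 y = (lam : ℂ)⁻¹ * eikonal m V lam y := fun y => by
    rw [psiD, eikonal]; ring
  induction q using Nat.strong_induction_on generalizing x with
  | _ q ih =>
    rcases q with _ | q
    · rw [hz]
      simp [wkbTerm, wkbPoly_zero]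
    · have hY := eikonal_ne_zero hg
      have hjet := jetAt_of_lt hJ (show q < N by omega) x
      have hd : deriv (psiD m V lam q) x = (lam : ℂ) ^ ((q : ℤ) - 1) *
          wkbTerm' q (eikonal m V lam x) (jetVal m V J lam x) := by
        refine HasDerivAt.deriv (HasDerivAt.congr_of_eventuallyEq
          ((hasDerivAt_wkbTerm hJ hjet hg).const_mul _) ?_)
        -- Differentiating the formula of order `q` requires it in a neighbourhood of `x`. For this
        -- reason the induction is generalised over all points of the open set `goodSet`.
        filter_upwards [(isOpen_goodSet fun i => (hJ i).continuous).mem_nhds hg] with y hy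
        exact ih q (by omega) (by omega) hy
      have hs : ∀ j : Fin q, psiD m V lam (j + 1) x * psiD m V lam (q - j) x
          = (lam : ℂ) ^ ((q : ℤ) - 1) *
            (wkbTerm (j + 1) (eikonal m V lam x) (jetVal m V J lam x) *
              wkbTerm (q - j) (eikonal m V lam x) (jetVal m V J lam x)) := by
        intro j
        have := j.2
        rw [ih (j + 1) (by omega) (by omega) hg, ih (q - j) (by omega) (by omega) hg,
          mul_mul_mul_comm, ← zpow_add₀ hl]
        congr 2
        push_cast [Nat.cast_sub j.2.le]
        ring
      rw [psiD]
      beta_reduce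
      rw [hd, deriv_Klam_div hJ hk (hjet.mono (Nat.zero_le _)) hg, hz,
        ih q (by omega) (by omega) hg]
      simp only [hs, ← Finset.mul_sum]
      have key := wkbTerm_succ q hY (jetVal m V J lam x)
      have e : (lam : ℂ) ^ (((q + 1 : ℕ) : ℤ) - 1) = lam * (lam : ℂ) ^ ((q : ℤ) - 1) := by
        rw [← zpow_one_add₀ hl]; congr 1; push_cast; ring
      rw [e]
      field_simp
      linear_combination -key

end DiracWKB

/-! ### The phase on the support of the cut-off, and the size and sign of the eikonal term. -/

namespace DiracWKB

variable {m : ℝ} {N : ℕ} {V : ℝ → Matrix (Fin 2) (Fin 2) ℂ} {f : ℝ → ℝ} {μ ε ν : Side → ℝ}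
  {η ε₁ lam : ℝ} {J : Fin 2 → ℕ → ℝ → ℂ} {x : ℝ} {δ : Side → EReal}

/-! ### The support of the cut-off -/

/-- The closed interval `[-δ⁻, δ⁺]`. -/
def region (δ : Side → EReal) : Set ℝ := {x | ∀ s : Side, ((s.sgn * x : ℝ) : EReal) ≤ δ s}

/-- The open interval `(-δ⁻, δ⁺)`. -/
def openRegion (δ : Side → EReal) : Set ℝ := {x | ∀ s : Side, ((s.sgn * x : ℝ) : EReal) < δ s}

theorem openRegion_subset_region : openRegion δ ⊆ region δ := fun _ hx s => (hx s).le

theorem isClosed_region : IsClosed (region δ) := by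
  have : region δ = ⋂ s : Side, {x | ((s.sgn * x : ℝ) : EReal) ≤ δ s} := by
    ext; simp [region]
  rw [this]
  exact isClosed_iInter fun s => isClosed_le
    (continuous_coe_real_ereal.comp (continuous_const.mul continuous_id)) continuous_const

theorem isOpen_setOf_lt (δ : Side → EReal) (Δ : Side → ℝ) :
    IsOpen {x : ℝ | ∀ s : Side, ((s.sgn * x + Δ s : ℝ) : EReal) < δ s} := by
  have : {x : ℝ | ∀ s : Side, ((s.sgn * x + Δ s : ℝ) : EReal) < δ s}
      = {x : ℝ | ((Side.sgn .minus * x + Δ .minus : ℝ) : EReal) < δ .minus} ∩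
        {x : ℝ | ((Side.sgn .plus * x + Δ .plus : ℝ) : EReal) < δ .plus} := by
    ext x
    exact ⟨fun h => ⟨h _, h _⟩, fun h s => by cases s; exacts [h.1, h.2]⟩
  rw [this]
  have key : ∀ s : Side, IsOpen {x : ℝ | ((s.sgn * x + Δ s : ℝ) : EReal) < δ s} := fun s =>
    isOpen_lt (continuous_coe_real_ereal.comp
      ((continuous_const.mul continuous_id).add continuous_const)) continuous_const
  exact (key _).inter (key _)

theorem ordConnected_region : (region δ).OrdConnected := by
  refine ⟨fun x hx z hz y hy s => ?_⟩
  cases s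
  · refine le_trans ?_ (hx .minus)
    simp only [Side.sgn, EReal.coe_le_coe_iff]
    linarith [hy.1]
  · refine le_trans ?_ (hz .plus)
    simp only [Side.sgn, EReal.coe_le_coe_iff]
    linarith [hy.2]

/-- Only the at most two finite end points are lost. This matters because the supremum in the final
bound runs over strict inequalities. -/
theorem ae_mem_openRegion (δ : Side → EReal) : ∀ᵐ x, x ∈ region δ → x ∈ openRegion δ := by
  have : ({x : ℝ | ∃ s : Side, ((s.sgn * x : ℝ) : EReal) = δ s} : Set ℝ).Countable := by
    have hsub : ({x : ℝ | ∃ s : Side, ((s.sgn * x : ℝ) : EReal) = δ s} : Set ℝ) ⊆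
        {Side.sgn .minus * (δ .minus).toReal, Side.sgn .plus * (δ .plus).toReal} := by
      rintro x ⟨s, hs⟩
      have hx : x = s.sgn * (δ s).toReal := by
        rw [← hs, EReal.toReal_coe, s.sgn_mul_sgn_mul]
      cases s
      · exact Or.inl hx
      · exact Or.inr hx
    exact (Set.Finite.subset (by simp) hsub).countable
  filter_upwards [this.ae_notMem volume] with x hx hxr s
  exact lt_of_le_of_ne (hxr s) fun h => hx ⟨s, h⟩

theorem mem_region_of_nonneg {s : Side} (hδ : ∀ s, 0 ≤ δ s) (hx : 0 ≤ s.sgn * x)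
    (h : ((s.sgn * x : ℝ) : EReal) ≤ δ s) : x ∈ region δ := by
  intro t
  cases s <;> cases t
  · exact h
  · refine le_trans ?_ (hδ _)
    simp only [Side.sgn] at *
    exact_mod_cast (by linarith : 1 * x ≤ 0)
  · refine le_trans ?_ (hδ _)
    simp only [Side.sgn] at *
    exact_mod_cast (by linarith : -1 * x ≤ 0)
  · exact h

theorem zero_mem_region (hδ : ∀ s, 0 ≤ δ s) : (0 : ℝ) ∈ region δ := fun s => by
  simpa using hδ s

/-! ### The phase -/

/-- The component of `0` in `goodSet`. -/
def core (m : ℝ) (V : ℝ → Matrix (Fin 2) (Fin 2) ℂ) (lam : ℝ) : Set ℝ :=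
  connectedComponentIn (goodSet m V lam) 0

theorem core_subset : core m V lam ⊆ goodSet m V lam := connectedComponentIn_subset _ _

/-- The formulas for `ψ_k` hold on `goodSet` only, while the phase integrates them from `0`. The
open interval `core` contains the closed support region with a margin, so the phase is
differentiable also at the end points. -/
theorem region_subset_core (hδ : ∀ s, 0 ≤ δ s) (h : region δ ⊆ goodSet m V lam) :
    region δ ⊆ core m V lam :=
  ordConnected_region.isPreconnected.subset_connectedComponentIn (zero_mem_region hδ) h

theorem isOpen_core (hc : ∀ i, Continuous fun x => V x i i) : IsOpen (core m V lam) :=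
  (isOpen_goodSet hc).connectedComponentIn

theorem uIcc_subset_core (h0 : (0 : ℝ) ∈ core m V lam) (hx : x ∈ core m V lam) :
    Set.uIcc 0 x ⊆ core m V lam :=
  (isPreconnected_connectedComponentIn.ordConnected).uIcc_subset h0 hx

/-- The derivative of the phase. -/
def phaseDeriv (N : ℕ) (m : ℝ) (V : ℝ → Matrix (Fin 2) (Fin 2) ℂ) (J : Fin 2 → ℕ → ℝ → ℂ)
    (lam x : ℝ) : ℂ :=
  ∑ q ∈ Finset.range (N + 1), wkbTerm q (eikonal m V lam x) (jetVal m V J lam x)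

/-- The second derivative of the phase. -/
def phaseDeriv2 (N : ℕ) (m : ℝ) (V : ℝ → Matrix (Fin 2) (Fin 2) ℂ) (J : Fin 2 → ℕ → ℝ → ℂ)
    (lam x : ℝ) : ℂ :=
  ∑ q ∈ Finset.range (N + 1), wkbTerm' q (eikonal m V lam x) (jetVal m V J lam x)

theorem continuousOn_wkbTerm (hJ : ∀ i, IsJet N (fun x => V x i i) (J i)) {q : ℕ} (hq : q ≤ N) :
    ContinuousOn (fun y => wkbTerm q (eikonal m V lam y) (jetVal m V J lam y))
      (goodSet m V lam) := fun _ hx =>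
  (lipAt_wkbTerm hJ hq hx).continuousAt.continuousWithinAt

theorem phase_eq (hJ : ∀ i, IsJet N (fun x => V x i i) (J i)) (hk : k₁ V = k₂ V)
    (hlam : 0 < lam) (h0 : (0 : ℝ) ∈ core m V lam) (hx : x ∈ core m V lam) :
    phase m V N lam x = ∑ q ∈ Finset.range (N + 1),
      ∫ t in (0 : ℝ)..x, wkbTerm q (eikonal m V lam t) (jetVal m V J lam t) := by
  have hl : (lam : ℂ) ≠ 0 := by exact_mod_cast hlam.ne'
  refine Finset.sum_congr rfl fun q hq => ?_
  have hq' : q ≤ N := by simpa [Nat.lt_succ_iff] using hq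
  rw [intervalIntegral.integral_congr (g := fun t => (lam : ℂ) ^ ((q : ℤ) - 1) *
      wkbTerm q (eikonal m V lam t) (jetVal m V J lam t)) fun t ht =>
        psiD_eq hJ hk hlam hq' (core_subset (uIcc_subset_core h0 hx ht)),
    intervalIntegral.integral_const_mul, ← mul_assoc, ← zpow_add₀ hl]
  simp

theorem hasDerivAt_phase (hJ : ∀ i, IsJet N (fun x => V x i i) (J i)) (hk : k₁ V = k₂ V)
    (hlam : 0 < lam) (h0 : (0 : ℝ) ∈ core m V lam) (hx : x ∈ core m V lam) :
    HasDerivAt (phase m V N lam) (phaseDeriv N m V J lam x) x := by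
  have hopen : IsOpen (core m V lam) := isOpen_core fun i => (hJ i).continuous
  have h : HasDerivAt (fun x => ∑ q ∈ Finset.range (N + 1),
      ∫ t in (0 : ℝ)..x, wkbTerm q (eikonal m V lam t) (jetVal m V J lam t))
      (phaseDeriv N m V J lam x) x := by
    refine HasDerivAt.fun_sum fun q hq => ?_
    have hq' : q ≤ N := by simpa [Nat.lt_succ_iff] using hq
    have hc := (continuousOn_wkbTerm (m := m) (lam := lam) hJ hq').mono core_subset
    exact intervalIntegral.integral_hasDerivAt_right
      (hc.mono (uIcc_subset_core h0 hx)).intervalIntegrable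
      (hc.stronglyMeasurableAtFilter hopen x hx) (hc.continuousAt (hopen.mem_nhds hx))
  exact h.congr_of_eventuallyEq (by
    filter_upwards [hopen.mem_nhds hx] with y hy using phase_eq hJ hk hlam h0 hy)

theorem lipAt_phaseDeriv (hJ : ∀ i, IsJet N (fun x => V x i i) (J i))
    (hx : x ∈ goodSet m V lam) : LipAt (phaseDeriv N m V J lam) x :=
  LipAt.sum _ fun q hq => lipAt_wkbTerm hJ (by simpa [Nat.lt_succ_iff] using hq) hx

theorem lipAt_phase (hJ : ∀ i, IsJet N (fun x => V x i i) (J i)) (hk : k₁ V = k₂ V)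
    (hlam : 0 < lam) (h0 : (0 : ℝ) ∈ core m V lam) (hx : x ∈ core m V lam) :
    LipAt (phase m V N lam) x := by
  have hopen : IsOpen (core m V lam) := isOpen_core fun i => (hJ i).continuous
  exact (hasStrictDerivAt_of_hasDerivAt_of_continuousAt
    (by filter_upwards [hopen.mem_nhds hx] with y hy using hasDerivAt_phase hJ hk hlam h0 hy)
    (lipAt_phaseDeriv hJ (core_subset hx)).continuousAt).hasStrictFDerivAt.exists_lipschitzOnWith

theorem hasDerivAt_phaseDeriv (hJ : ∀ i, IsJet N (fun x => V x i i) (J i)) (hj : JetAt J N x)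
    (hx : x ∈ goodSet m V lam) :
    HasDerivAt (phaseDeriv N m V J lam) (phaseDeriv2 N m V J lam x) x :=
  HasDerivAt.fun_sum fun q hq =>
    hasDerivAt_wkbTerm hJ (hj.mono (by simpa [Nat.lt_succ_iff] using hq)) hx

theorem wkbRemainder_eq_phase (N m V J lam x) :
    wkbRemainder N (eikonal m V lam x) (jetVal m V J lam x)
      = phaseDeriv N m V J lam x ^ 2 - phaseDeriv2 N m V J lam x
        + jetVal m V J lam x 1 1 * phaseDeriv N m V J lam x + Vlam m V lam x := by
  rw [wkbRemainder, eikonal_sq, sub_neg_eq_add]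
  rfl

/-! ### The size of the factors -/

/-- Smallness of the real parts and of the difference of the imaginary parts at `x`. -/
def PartsLe (m : ℝ) (V : ℝ → Matrix (Fin 2) (Fin 2) ℂ) (η lam x : ℝ) : Prop :=
  |(V x 0 0).re + m| ≤ η * lam ∧ |(V x 1 1).re - m| ≤ η * lam ∧
    |(V x 0 0).im - (V x 1 1).im| ≤ η * lam

theorem factor_re (m V lam) (x : ℝ) : (factor m V lam 0 x).re = lam - ((V x 0 0).re + m) ∧
    (factor m V lam 1 x).re = lam - ((V x 1 1).re - m) := by
  constructor <;> simp [factor] <;> ring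

theorem factor_im (m V lam i) (x : ℝ) : (factor m V lam i x).im = -(V x i i).im := by
  simp [factor]

theorem PartsLe.re_mem (h : PartsLe m V η lam x) (i : Fin 2) :
    (1 - η) * lam ≤ (factor m V lam i x).re ∧ (factor m V lam i x).re ≤ (1 + η) * lam := by
  obtain ⟨h0, h1, -⟩ := h
  rw [abs_le] at h0 h1
  obtain ⟨e0, e1⟩ := factor_re m V lam x
  fin_cases i
  · simp only [Fin.zero_eta, e0]
    constructor <;> linarith
  · simp only [Fin.mk_one, e1]
    constructor <;> linarith

theorem PartsLe.mem_goodSet (h : PartsLe m V η lam x) (hη : η < 1) (hlam : 0 < lam) :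
    x ∈ goodSet m V lam := fun i =>
  lt_of_lt_of_le (mul_pos (by linarith) hlam) (h.re_mem i).1

theorem PartsLe.le_norm (h : PartsLe m V η lam x) (i : Fin 2) :
    (1 - η) * lam ≤ ‖factor m V lam i x‖ :=
  (h.re_mem i).1.trans (Complex.re_le_norm _)

/-- The constant which compares the sizes of the two factors and of the diagonal entries. -/
def sizeConst (m η : ℝ) : ℝ := (4 + |m|) / (1 - η) + 2

theorem one_le_sizeConst (hη : η < 1) : 1 ≤ sizeConst m η := by
  have : 0 < 1 - η := by linarith
  have : 0 ≤ (4 + |m|) / (1 - η) := by positivity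
  unfold sizeConst
  linarith

/-- The factors differ by at most `3 η λ ≤ 3 λ`, whereas each has modulus at least `(1 - η) λ`.
Hence they are comparable, however large the common imaginary part may be. -/
theorem PartsLe.norm_factor_le (h : PartsLe m V η lam x) (hη0 : 0 < η) (hη : η < 1)
    (hlam : 1 ≤ lam) (i j : Fin 2) :
    ‖factor m V lam i x‖ ≤ (3 / (1 - η) + 1) * ‖factor m V lam j x‖ := by
  have h1η : 0 < 1 - η := by linarith
  have hd : ‖factor m V lam 0 x - factor m V lam 1 x‖ ≤ 3 * lam := by
    refine (Complex.norm_le_abs_re_add_abs_im _).trans ?_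
    obtain ⟨h0, h1, h2⟩ := h
    obtain ⟨e0, e1⟩ := factor_re m V lam x
    rw [Complex.sub_re, Complex.sub_im, e0, e1, factor_im, factor_im]
    have : |lam - ((V x 0 0).re + m) - (lam - ((V x 1 1).re - m))| ≤ 2 * (η * lam) := by
      rw [abs_le] at *
      constructor <;> linarith
    have h3 : |-(V x 0 0).im - -(V x 1 1).im| ≤ η * lam := by
      rw [← abs_neg]
      convert h2 using 2
      ring
    nlinarith
  have hd' : ‖factor m V lam i x - factor m V lam j x‖ ≤ 3 * lam := by
    fin_cases i <;> fin_cases j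
    · simp; linarith
    · exact hd
    · rw [norm_sub_rev]; exact hd
    · simp; linarith
  have h3 : 3 * lam ≤ 3 / (1 - η) * ‖factor m V lam j x‖ := by
    rw [div_mul_eq_mul_div, le_div_iff₀ h1η]
    nlinarith [h.le_norm j]
  calc ‖factor m V lam i x‖
      = ‖(factor m V lam i x - factor m V lam j x) + factor m V lam j x‖ := by
        rw [sub_add_cancel]
    _ ≤ 3 * lam + ‖factor m V lam j x‖ := (norm_add_le _ _).trans (by gcongr)
    _ ≤ _ := by linarith

theorem PartsLe.norm_factor_le' (h : PartsLe m V η lam x) (hη0 : 0 < η) (hη : η < 1)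
    (hlam : 1 ≤ lam) (i j : Fin 2) :
    ‖factor m V lam i x‖ ≤ sizeConst m η * ‖factor m V lam j x‖ := by
  refine (h.norm_factor_le hη0 hη hlam i j).trans ?_
  have : 0 < 1 - η := by linarith
  gcongr
  unfold sizeConst
  have : 3 / (1 - η) ≤ (4 + |m|) / (1 - η) := by
    gcongr
    linarith [abs_nonneg m]
  linarith

theorem PartsLe.norm_diag_le (h : PartsLe m V η lam x) (hη0 : 0 < η) (hη : η < 1)
    (hlam : 1 ≤ lam) (i : Fin 2) : ‖V x i i‖ ≤ sizeConst m η * ‖factor m V lam 1 x‖ := by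
  have h1η : 0 < 1 - η := by linarith
  have e : V x i i = ((lam + (![-m, m] i : ℝ) : ℝ) : ℂ) - factor m V lam i x := by
    simp [factor]
  have h1 : ‖((lam + (![-m, m] i : ℝ) : ℝ) : ℂ)‖ ≤ (1 + |m|) * lam := by
    rw [Complex.norm_real, Real.norm_eq_abs]
    refine (abs_add_le _ _).trans ?_
    have : |(![-m, m] i : ℝ)| = |m| := by fin_cases i <;> simp
    rw [this, abs_of_pos (by linarith)]
    nlinarith [abs_nonneg m]
  have h2 : (1 + |m|) * lam ≤ (1 + |m|) / (1 - η) * ‖factor m V lam 1 x‖ := by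
    rw [div_mul_eq_mul_div, le_div_iff₀ h1η]
    nlinarith [h.le_norm 1, abs_nonneg m]
  have h3 := h.norm_factor_le hη0 hη hlam i 1
  rw [e]
  refine (norm_sub_le _ _).trans ?_
  have e2 : sizeConst m η = (1 + |m|) / (1 - η) + (3 / (1 - η) + 1) + 1 := by
    unfold sizeConst
    field_simp
    ring
  rw [e2]
  nlinarith [norm_nonneg (factor m V lam 1 x)]

theorem norm_eikonal_sq (m V lam) (x : ℝ) :
    ‖eikonal m V lam x‖ ^ 2 = ‖factor m V lam 0 x‖ * ‖factor m V lam 1 x‖ := by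
  rw [← norm_pow, eikonal_sq, norm_neg, Vlam_eq_factor, norm_mul]

theorem PartsLe.norm_eikonal (h : PartsLe m V η lam x) (hη0 : 0 < η) (hη : η < 1)
    (hlam : 1 ≤ lam) :
    (sizeConst m η)⁻¹ * ‖factor m V lam 1 x‖ ≤ ‖eikonal m V lam x‖ ∧
      ‖eikonal m V lam x‖ ≤ sizeConst m η * ‖factor m V lam 1 x‖ := by
  have hK := one_le_sizeConst (m := m) hη
  have hK0 : 0 < sizeConst m η := by linarith
  have h0 := h.norm_factor_le' hη0 hη hlam 0 1
  have h1 := h.norm_factor_le' hη0 hη hlam 1 0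
  have hsq := norm_eikonal_sq m V lam x
  have hD := norm_nonneg (factor m V lam 1 x)
  constructor
  · refine (abs_le_of_sq_le_sq' ?_ (norm_nonneg _)).2
    rw [hsq, sq]
    refine mul_le_mul ?_ ?_ (by positivity) (norm_nonneg _)
    · rwa [inv_mul_le_iff₀ hK0]
    · rw [inv_mul_le_iff₀ hK0]
      exact le_mul_of_one_le_left hD hK
  · refine (abs_le_of_sq_le_sq' ?_ (by positivity)).2
    rw [hsq]
    nlinarith [mul_le_mul_of_nonneg_right h0 hD, mul_nonneg hD hD]

/-! ### The real part of the leading term of the phase -/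

theorem sq_re_eq (w : ℂ) : 2 * w.re ^ 2 = ‖w ^ 2‖ + (w ^ 2).re := by
  rw [norm_pow, Complex.sq_norm, Complex.normSq_apply, sq w, Complex.mul_re]
  ring

/-- From `2 (Re w)² = |w²| + Re w²` and `2 |A| |D| ≤ |A|² + |D|²`. Only the difference of the
imaginary parts enters, so `Re V_λ^(1/2)` is `O(λ)` even where `Im V_ii` is much larger than `λ`. -/
theorem two_mul_re_sq_le {A D w : ℂ} (hw : w ^ 2 = A * D) :
    (2 * w.re) ^ 2 ≤ (A.re + D.re) ^ 2 + (A.im - D.im) ^ 2 := by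
  have h1 := sq_re_eq w
  rw [hw, norm_mul, Complex.mul_re] at h1
  have hA := Complex.sq_norm A
  have hD := Complex.sq_norm D
  rw [Complex.normSq_apply] at hA hD
  nlinarith [sq_nonneg (‖A‖ - ‖D‖)]

theorem re_mul_re_le {A D w : ℂ} (hw : w ^ 2 = A * D) : A.re * D.re ≤ 2 * w.re ^ 2 := by
  have h1 := sq_re_eq w
  rw [hw, norm_mul, Complex.mul_re] at h1
  have hA := Complex.abs_im_le_norm A
  have hD := Complex.abs_im_le_norm D
  have h2 : A.im * D.im ≤ ‖A‖ * ‖D‖ :=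
    (le_abs_self _).trans (by rw [abs_mul]; gcongr)
  linarith

theorem re_cpow_half_pos {z : ℂ} (hz : z ∈ Complex.slitPlane) : 0 < (z ^ (1 / 2 : ℂ)).re := by
  rw [Complex.cpow_def_of_ne_zero (Complex.slitPlane_ne_zero hz), Complex.exp_re]
  refine mul_pos (Real.exp_pos _) (Real.cos_pos_of_mem_Ioo ?_)
  have e : (Complex.log z * (1 / 2)).im = z.arg / 2 := by
    rw [show (1 / 2 : ℂ) = ((1 / 2 : ℝ) : ℂ) by norm_num, Complex.im_mul_ofReal, Complex.log_im]
    ring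
  rw [e]
  have h1 := Complex.neg_pi_lt_arg z
  have h2 := lt_of_le_of_ne (Complex.arg_le_pi z) (Complex.slitPlane_arg_ne_pi hz)
  constructor <;> linarith

theorem eikonal_re (m V lam) (x : ℝ) :
    (eikonal m V lam x).re = -(Vlam m V lam x ^ (1 / 2 : ℂ)).im := by
  rw [eikonal, Complex.mul_re]
  simp

theorem cpow_half_sq (z : ℂ) : (z ^ (1 / 2 : ℂ)) ^ 2 = z := by
  rw [← Complex.cpow_nat_mul]
  norm_num

/-- The imaginary part of `w² = V_λ` for `w = V_λ^(1/2)`. It expresses `Re Y` through the imaginary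
parts of the potential with weights close to `λ`. -/
theorem two_mul_re_mul_eikonal_re (m V lam) (x : ℝ) :
    2 * (Vlam m V lam x ^ (1 / 2 : ℂ)).re * (eikonal m V lam x).re =
      (factor m V lam 0 x).re * (V x 1 1).im + (factor m V lam 1 x).re * (V x 0 0).im := by
  have h := congrArg Complex.im (cpow_half_sq (Vlam m V lam x))
  rw [eikonal_re]
  rw [Vlam_eq_factor, sq, Complex.mul_im, Complex.mul_im, factor_im, factor_im] at h
  rw [Vlam_eq_factor]
  linarith

/-- The numerator of `2 Re w Re Y` is `λ (Im V₁₁ + Im V₂₂)` up to an error `η λ (|Im V₁₁| + |Im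
V₂₂|)`. Dividing by `2 Re w ≤ λ √(η² + (2+2η)²)` gives the constant in the condition on `ε`. -/
theorem PartsLe.le_eikonal_re (h : PartsLe m V η lam x) (hη0 : 0 < η) (hη : η < 1)
    (hlam : 1 ≤ lam) {κ : ℝ} (hκ : η < κ) (hκ1 : κ ≤ 1) {s : Side}
    (hs : 0 ≤ s.sgn * ((V x 0 0).im + (V x 1 1).im))
    (him : κ * (|(V x 0 0).im| + |(V x 1 1).im|) ≤ |(V x 0 0).im + (V x 1 1).im|) :
    (κ - η) / Real.sqrt (η ^ 2 + (2 + 2 * η) ^ 2) * (s.sgn * ((V x 0 0).im + (V x 1 1).im))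
      ≤ s.sgn * (eikonal m V lam x).re := by
  set S := Real.sqrt (η ^ 2 + (2 + 2 * η) ^ 2) with hS
  set w := Vlam m V lam x ^ (1 / 2 : ℂ) with hw
  set t := |(V x 0 0).im + (V x 1 1).im| with ht
  have hl0 : 0 < lam := by linarith
  have hS0 : 0 < S := Real.sqrt_pos.2 (by positivity)
  have hg := h.mem_goodSet hη hl0
  have hwre : 0 < w.re := re_cpow_half_pos (Vlam_mem_slitPlane hg)
  have hst : s.sgn * ((V x 0 0).im + (V x 1 1).im) = t := (Side.abs_eq hs).symm
  have hwS : 2 * w.re ≤ lam * S := by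
    have h1 := two_mul_re_sq_le (A := factor m V lam 0 x) (D := factor m V lam 1 x) (w := w)
      (by rw [hw, cpow_half_sq, Vlam_eq_factor])
    refine (abs_le_of_sq_le_sq' (h1.trans ?_) (by positivity)).2
    rw [mul_pow, hS, Real.sq_sqrt (by positivity), factor_im, factor_im]
    have a0 := h.re_mem 0
    have a1 := h.re_mem 1
    have b0 : 0 ≤ (1 - η) * lam := mul_nonneg (by linarith) hl0.le
    have h2 : ((factor m V lam 0 x).re + (factor m V lam 1 x).re) ^ 2
        ≤ ((2 + 2 * η) * lam) ^ 2 := by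
      apply pow_le_pow_left₀ <;> linarith [a0.1, a0.2, a1.1, a1.2]
    have h3 : (-(V x 0 0).im - -(V x 1 1).im) ^ 2 ≤ (η * lam) ^ 2 := by
      have e : -(V x 0 0).im - -(V x 1 1).im = -((V x 0 0).im - (V x 1 1).im) := by ring
      rw [e, neg_sq, ← sq_abs]
      exact pow_le_pow_left₀ (abs_nonneg _) h.2.2 2
    nlinarith
  have key := two_mul_re_mul_eikonal_re m V lam x
  rw [← hw] at key
  obtain ⟨e0, e1⟩ := factor_re m V lam x
  have hlow : lam * (κ - η) * t ≤ s.sgn * (2 * w.re * (eikonal m V lam x).re) := by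
    rw [key, e0, e1]
    have h5 : s.sgn * ((lam - ((V x 0 0).re + m)) * (V x 1 1).im
        + (lam - ((V x 1 1).re - m)) * (V x 0 0).im) = lam * t
        - s.sgn * (((V x 0 0).re + m) * (V x 1 1).im + ((V x 1 1).re - m) * (V x 0 0).im) := by
      rw [← hst]; ring
    have h6 : s.sgn * (((V x 0 0).re + m) * (V x 1 1).im + ((V x 1 1).re - m) * (V x 0 0).im)
        ≤ η * lam * (|(V x 0 0).im| + |(V x 1 1).im|) := by
      refine (s.sgn_mul_le_abs _).trans ((abs_add_le _ _).trans ?_)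
      rw [abs_mul, abs_mul]
      nlinarith [mul_le_mul_of_nonneg_right h.1 (abs_nonneg (V x 1 1).im),
        mul_le_mul_of_nonneg_right h.2.1 (abs_nonneg (V x 0 0).im)]
    have hκ0 : 0 < κ := by linarith
    -- Uses `κ (1 - κ + η) - η = (1 - κ)(κ - η) ≥ 0`, which turns the loss `η / κ` into the linear
    -- expression `1 - κ + η`.
    have h7 : η * (|(V x 0 0).im| + |(V x 1 1).im|) ≤ (1 - κ + η) * t := by
      have h8 : κ * (η * (|(V x 0 0).im| + |(V x 1 1).im|)) ≤ η * t := by nlinarith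
      have ht0 : 0 ≤ t := abs_nonneg _
      have h9 : η * t ≤ κ * ((1 - κ + η) * t) := by
        have : η ≤ κ * (1 - κ + η) := by nlinarith
        nlinarith
      exact le_of_mul_le_mul_left (h8.trans h9) hκ0
    rw [h5]
    nlinarith [mul_le_mul_of_nonneg_left h7 hl0.le]
  rw [hst, div_mul_eq_mul_div, div_le_iff₀ hS0]
  have hpos : 0 ≤ s.sgn * (eikonal m V lam x).re := by
    have h1 : 0 ≤ lam * (κ - η) * t :=
      mul_nonneg (mul_nonneg hl0.le (by linarith)) (abs_nonneg _)
    have h2 : 0 ≤ (2 * w.re) * (s.sgn * (eikonal m V lam x).re) := by linarith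
    exact nonneg_of_mul_nonneg_right h2 (by linarith)
  have h10 : s.sgn * (2 * w.re * (eikonal m V lam x).re)
      ≤ lam * S * (s.sgn * (eikonal m V lam x).re) := by
    nlinarith [mul_le_mul_of_nonneg_right hwS hpos]
  refine le_of_mul_le_mul_left ?_ hl0
  linarith

/-- Here `2 Re w ≥ (1 - η) λ` cancels the `λ` in the numerator. The bound does not depend on `λ` and
controls the phase on compact sets. -/
theorem PartsLe.abs_eikonal_re_le (h : PartsLe m V η lam x) (hη0 : 0 < η) (hη : η < 1)
    (hlam : 1 ≤ lam) {B : ℝ} (hB : ∀ i, |(V x i i).im| ≤ B) :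
    |(eikonal m V lam x).re| ≤ 4 / (1 - η) * B := by
  set w := Vlam m V lam x ^ (1 / 2 : ℂ) with hw
  have hl0 : 0 < lam := by linarith
  have h1η : 0 < 1 - η := by linarith
  have hB0 : 0 ≤ B := (abs_nonneg _).trans (hB 0)
  have hwre : 0 < w.re := re_cpow_half_pos (Vlam_mem_slitPlane (h.mem_goodSet hη hl0))
  have h1 := re_mul_re_le (A := factor m V lam 0 x) (D := factor m V lam 1 x) (w := w)
      (by rw [hw, cpow_half_sq, Vlam_eq_factor])
  have a0 := h.re_mem 0
  have a1 := h.re_mem 1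
  have b0 : 0 < (1 - η) * lam := mul_pos h1η hl0
  have h2 : (1 - η) * lam ≤ 2 * w.re := by
    refine (abs_le_of_sq_le_sq' ?_ (by positivity)).2
    nlinarith [mul_le_mul a0.1 a1.1 b0.le (b0.le.trans a0.1)]
  have key := congrArg abs (two_mul_re_mul_eikonal_re m V lam x)
  rw [← hw, abs_mul, abs_of_pos (by positivity : 0 < 2 * w.re)] at key
  have h3 : 2 * w.re * |(eikonal m V lam x).re| ≤ 4 * lam * B := by
    rw [key]
    refine (abs_add_le _ _).trans ?_
    rw [abs_mul, abs_mul, abs_of_pos (b0.trans_le a0.1), abs_of_pos (b0.trans_le a1.1)]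
    have c0 : (factor m V lam 0 x).re ≤ 2 * lam := a0.2.trans (by nlinarith)
    have c1 : (factor m V lam 1 x).re ≤ 2 * lam := a1.2.trans (by nlinarith)
    have d0 := mul_le_mul c0 (hB 1) (abs_nonneg _) (by positivity)
    have d1 := mul_le_mul c1 (hB 0) (abs_nonneg _) (by positivity)
    linarith
  rw [div_mul_eq_mul_div, le_div_iff₀ h1η]
  have h4 : (1 - η) * lam * |(eikonal m V lam x).re| ≤ 4 * lam * B :=
    (mul_le_mul_of_nonneg_right h2 (abs_nonneg _)).trans h3
  refine le_of_mul_le_mul_left ?_ hl0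
  linarith

end DiracWKB

/-! ### Weights for the normalised derivatives and the resulting rates. -/

namespace DiracWKB

variable {m : ℝ} {N : ℕ} {V : ℝ → Matrix (Fin 2) (Fin 2) ℂ} {f : ℝ → ℝ} {μ ε ν : Side → ℝ}
  {η ε₁ lam : ℝ} {J : Fin 2 → ℕ → ℝ → ℂ} {x : ℝ} {δ : Side → EReal}

/-! ### Weights on the support of the cut-off -/

/-- The pair of radii `δ^±_λ`. -/
def rad (m : ℝ) (V : ℝ → Matrix (Fin 2) (Fin 2) ℂ) (f : ℝ → ℝ) (ν : Side → ℝ) (η ε₁ lam : ℝ) :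
    Side → EReal := fun s => cutRadius m V f ν η ε₁ s lam

theorem Admissible.eventually_partsLe (hV : Admissible N V f μ ε ν) (hη : 0 < η) (hε₁ : ε₁ < 1)
    (m : ℝ) : ∀ᶠ lam : ℝ in atTop, 1 ≤ lam ∧ (∀ s, 0 ≤ rad m V f ν η ε₁ lam s) ∧
      ∀ x ∈ region (rad m V f ν η ε₁ lam), PartsLe m V η lam x := by
  have h1 := forall_side_eventually.2 fun s => hV.eventually_lt_cutRadius hε₁ m η 0 s
  filter_upwards [eventually_ge_atTop 1, h1, hV.eventually_parts_le hη hε₁ m] with lam h2 h3 h4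
  refine ⟨h2, fun s => (h3 s).le, fun x hx => ?_⟩
  obtain ⟨s, hs⟩ := Side.exists_nonneg x
  exact h4 s x hs (hx s)

open Classical in
/-- The bound on the remainder at the end `s`. -/
def rate (m : ℝ) (N : ℕ) (V : ℝ → Matrix (Fin 2) (Fin 2) ℂ) (f : ℝ → ℝ) (ν : Side → ℝ)
    (η ε₁ : ℝ) (s : Side) (a lam : ℝ) : ℝ :=
  if DiagBounded V s then
    if ν s ≤ 0 then lam ^ (-((N : ℝ) + 1)) else lam ^ (-((1 + ε₁) / 2) * ((N : ℝ) + 1))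
  else
    if ν s ≤ 0 then max (lam ^ (-((N : ℝ) + 1)))
      (lam ^ (-(N : ℝ)) * sSup (growthSet m V f ν η ε₁ N s a lam))
    else lam ^ (-((1 + ε₁) / 2) * ((N : ℝ) + 1) + 1)

/-- The left-hand side is the contribution of a fixed compact set to the remainder. It is dominated
in all four cases, because `(1 + ε₁) / 2 ≤ 1`. -/
theorem rpow_le_rate (hε₁ : ε₁ < 1) (hlam : 1 ≤ lam) (m V f ν η) (s : Side) (a : ℝ) :
    lam ^ (-((N : ℝ) + 1)) ≤ rate m N V f ν η ε₁ s a lam := by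
  have hN : (0 : ℝ) ≤ N := Nat.cast_nonneg N
  unfold rate
  split_ifs
  · exact le_rfl
  · exact Real.rpow_le_rpow_of_exponent_le hlam (by nlinarith)
  · exact le_max_left _ _
  · exact Real.rpow_le_rpow_of_exponent_le hlam (by nlinarith)

theorem rate_nonneg (hε₁ : ε₁ < 1) (hlam : 1 ≤ lam) (m V f ν η) (s : Side) (a : ℝ) :
    0 ≤ rate m N V f ν η ε₁ s a lam :=
  (Real.rpow_nonneg (by linarith) _).trans (rpow_le_rate (N := N) hε₁ hlam m V f ν η s a)

/-- The hypothesis on the derivatives of the diagonal entries, with uniform constants. -/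
theorem Admissible.exists_jet_bound (hV : Admissible N V f μ ε ν)
    (hJ : ∀ i, IsJet N (fun x => V x i i) (J i)) (s : Side) :
    ∃ C R : ℝ, 0 ≤ C ∧ 0 < R ∧ ∀ᵐ x, R ≤ s.sgn * x → ∀ i k, 1 ≤ k → k ≤ N + 1 →
      ‖J i k x‖ ≤ C * (|f x| ^ ν s) ^ k * ‖V x i i‖ := by
  have h : ∀ i k, ∃ C R : ℝ, 0 ≤ C ∧ 0 < R ∧ ∀ᵐ x, R ≤ s.sgn * x → 1 ≤ k → k ≤ N + 1 →
      ‖J i k x‖ ≤ C * (|f x| ^ ν s) ^ k * ‖V x i i‖ := by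
    intro i k
    by_cases hk : 1 ≤ k ∧ k ≤ N + 1
    · obtain ⟨W, hW, hO⟩ := hV.diag_deriv s i k hk.1 hk.2
      obtain ⟨C, hC0, hC⟩ := hO.exists_pos
      obtain ⟨R, hR0, hR⟩ := Side.ae_of_eventually_inf_ae hC.bound
      refine ⟨C, R, hC0.le, hR0, ?_⟩
      filter_upwards [hR, ((hJ i).isWeakDeriv k hk.2).ae_unique hW] with x h1 h2 h3 _ _
      have h4 := h1 h3
      rw [h2]
      refine h4.trans (le_of_eq ?_)
      rw [norm_mul, norm_norm, Real.norm_eq_abs, abs_of_nonneg (Real.rpow_nonneg (abs_nonneg _) _),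
        ← mul_assoc, mul_comm (k : ℝ), Real.rpow_mul (abs_nonneg _), Real.rpow_natCast]
    · exact ⟨0, 1, le_rfl, one_pos, Eventually.of_forall fun x _ h1 h2 => absurd ⟨h1, h2⟩ hk⟩
  choose C R hC hR hb using h
  refine ⟨∑ i, ∑ k ∈ Finset.range (N + 2), C i k, 1 + ∑ i, ∑ k ∈ Finset.range (N + 2), R i k,
    Finset.sum_nonneg fun i _ => Finset.sum_nonneg fun k _ => hC i k, ?_, ?_⟩
  · have : 0 ≤ ∑ i, ∑ k ∈ Finset.range (N + 2), R i k :=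
      Finset.sum_nonneg fun i _ => Finset.sum_nonneg fun k _ => (hR i k).le
    linarith
  · have hle : ∀ (T : Fin 2 → ℕ → ℝ), (∀ i k, 0 ≤ T i k) → ∀ i k, k ≤ N + 1 →
        T i k ≤ ∑ i, ∑ k ∈ Finset.range (N + 2), T i k := fun T hT i k hk =>
      (Finset.single_le_sum (f := fun k => T i k) (fun k _ => hT i k)
        (Finset.mem_range.2 (by omega))).trans
      (Finset.single_le_sum (f := fun i => ∑ k ∈ Finset.range (N + 2), T i k)
        (fun i _ => Finset.sum_nonneg fun k _ => hT i k) (Finset.mem_univ i))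
    have hb' : ∀ᵐ x, ∀ i k, R i k ≤ s.sgn * x → 1 ≤ k → k ≤ N + 1 →
        ‖J i k x‖ ≤ C i k * (|f x| ^ ν s) ^ k * ‖V x i i‖ :=
      ae_all_iff.2 fun i => ae_all_iff.2 fun k => hb i k
    filter_upwards [hb'] with x hx hxR i k h1 h2
    have e1 := hle R (fun i k => (hR i k).le) i k h2
    have e2 := hle C hC i k h2
    refine (hx i k (by linarith) h1 h2).trans ?_
    gcongr

theorem exists_jet_bound_compact (hJ : ∀ i, IsJet N (fun x => V x i i) (J i)) (a : ℝ) :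
    ∃ B : ℝ, 0 ≤ B ∧ ∀ᵐ x, |x| ≤ a → ∀ i k, k ≤ N + 1 → ‖J i k x‖ ≤ B := by
  have h : ∀ i k, ∃ B : ℝ, 0 ≤ B ∧ ∀ᵐ x, |x| ≤ a → k ≤ N + 1 → ‖J i k x‖ ≤ B := fun i k => by
    by_cases hk : k ≤ N + 1
    · obtain ⟨B, hB, hb⟩ := ((hJ i).memLinftyLoc k hk).exists_bound a
      exact ⟨B, hB, hb.mono fun x hx h _ => hx h⟩
    · exact ⟨0, le_rfl, Eventually.of_forall fun x _ h => absurd h hk⟩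
  choose B hB hb using h
  refine ⟨∑ i, ∑ k ∈ Finset.range (N + 2), B i k,
    Finset.sum_nonneg fun i _ => Finset.sum_nonneg fun k _ => hB i k, ?_⟩
  have hb' : ∀ᵐ x, ∀ i k, |x| ≤ a → k ≤ N + 1 → ‖J i k x‖ ≤ B i k :=
    ae_all_iff.2 fun i => ae_all_iff.2 fun k => hb i k
  filter_upwards [hb'] with x hx hxa i k hk
  exact (hx i k hxa hk).trans ((Finset.single_le_sum (f := fun k => B i k) (fun k _ => hB i k)
        (Finset.mem_range.2 (by omega))).trans
      (Finset.single_le_sum (f := fun i => ∑ k ∈ Finset.range (N + 2), B i k)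
        (fun i _ => Finset.sum_nonneg fun k _ => hB i k) (Finset.mem_univ i)))

/-- For `ν < 0` this is where `|f|` being bounded away from zero enters. -/
theorem Admissible.exists_rpow_bound (hV : Admissible N V f μ ε ν) {s : Side} (hν : ν s ≤ 0) :
    ∃ C R : ℝ, 0 ≤ C ∧ 0 < R ∧ ∀ x, R ≤ s.sgn * x → |f x| ^ ν s ≤ C := by
  rcases hν.lt_or_eq with h | h
  · obtain ⟨c, hc, hcx⟩ := hV.f_away_zero s h
    obtain ⟨R, hR0, hR⟩ := Side.eventually_iff.1 hcx
    exact ⟨c ^ ν s, R, by positivity, hR0, fun x hx =>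
      Real.rpow_le_rpow_of_nonpos hc (hR x hx) hν⟩
  · exact ⟨1, 1, zero_le_one, one_pos, fun x _ => by simp [h]⟩

/-- `Φ` and `G` control the normalised derivatives at `x`, with constant `C`. -/
structure IsWeight (m : ℝ) (N : ℕ) (V : ℝ → Matrix (Fin 2) (Fin 2) ℂ) (J : Fin 2 → ℕ → ℝ → ℂ)
    (ε₁ lam C r x Φ G : ℝ) : Prop where
  nonneg : 0 ≤ Φ
  nonneg' : 0 ≤ G
  le_const : G ≤ C
  le_rpow : Φ ≤ C * lam ^ ((1 - ε₁) / 2)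
  jet_le : ∀ i k, 1 ≤ k → k ≤ N + 1 → ‖jetVal m V J lam x i k‖ ≤ C * Φ ^ k * G
  le_rate : Φ ^ (N + 1) * (‖factor m V lam 1 x‖ ^ N)⁻¹ * G ≤ C * r

theorem IsWeight.mono {C C' r Φ G : ℝ} (h : IsWeight m N V J ε₁ lam C r x Φ G) (hC : C ≤ C')
    (hlam : 0 ≤ lam) (hr : 0 ≤ r) : IsWeight m N V J ε₁ lam C' r x Φ G := by
  have h1 := h.nonneg
  have h2 := h.nonneg'
  refine ⟨h1, h2, h.le_const.trans hC, h.le_rpow.trans ?_, fun i k hk hk' =>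
    (h.jet_le i k hk hk').trans ?_, h.le_rate.trans ?_⟩
  all_goals gcongr

theorem norm_jetVal_le (h : PartsLe m V η lam x) (hη0 : 0 < η) (hη : η < 1) (hlam : 1 ≤ lam)
    (i : Fin 2) (k : ℕ) : ‖jetVal m V J lam x i k‖ ≤
      sizeConst m η * ‖J i k x‖ * ‖factor m V lam 1 x‖⁻¹ := by
  have hpos : ∀ i, 0 < ‖factor m V lam i x‖ := fun i =>
    norm_pos_iff.2 (factor_ne_zero (h.mem_goodSet hη (by linarith)) i)
  rw [jetVal, norm_div, norm_neg, div_eq_mul_inv]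
  have h1 := h.norm_factor_le' hη0 hη hlam 1 i
  have h2 : ‖factor m V lam i x‖⁻¹ ≤ sizeConst m η * ‖factor m V lam 1 x‖⁻¹ := by
    rw [inv_le_iff_one_le_mul₀ (hpos i), mul_assoc, mul_comm _⁻¹, ← mul_assoc,
      ← div_eq_mul_inv, le_div_iff₀ (hpos 1)]
    linarith
  calc ‖J i k x‖ * ‖factor m V lam i x‖⁻¹
      ≤ ‖J i k x‖ * (sizeConst m η * ‖factor m V lam 1 x‖⁻¹) := by gcongr
    _ = _ := by ring

theorem inv_norm_factor_pow_le (h : PartsLe m V η lam x) (hη : η < 1) (hlam : 0 < lam) (n : ℕ) :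
    (‖factor m V lam 1 x‖ ^ n)⁻¹ ≤ ((1 - η) ^ n)⁻¹ * lam ^ (-(n : ℝ)) := by
  have h1 : 0 < 1 - η := by linarith
  rw [Real.rpow_neg hlam.le, Real.rpow_natCast, ← mul_inv, ← mul_pow]
  gcongr
  exact h.le_norm 1

/-- On a compact set the jets are bounded, and the weights `Φ = 1`, `G = 1 / D` give the rate
`D^(-(N+1))`. -/
theorem PartsLe.exists_isWeight_inner (h : PartsLe m V η lam x) (hη0 : 0 < η) (hη : η < 1)
    (hε₁ : ε₁ < 1) (hlam : 1 ≤ lam) {B : ℝ} (hB0 : 0 ≤ B)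
    (hB : ∀ i k, k ≤ N + 1 → ‖J i k x‖ ≤ B) {r : ℝ} (hr : lam ^ (-((N : ℝ) + 1)) ≤ r) :
    ∃ Φ G, IsWeight m N V J ε₁ lam
      (1 + (1 - η)⁻¹ + sizeConst m η * B + ((1 - η) ^ (N + 1))⁻¹) r x Φ G := by
  have hl0 : 0 < lam := by linarith
  have h1η : 0 < 1 - η := by linarith
  have hK := one_le_sizeConst (m := m) hη
  have hK0 : 0 < sizeConst m η := by linarith
  have hD : 0 < ‖factor m V lam 1 x‖ :=
    norm_pos_iff.2 (factor_ne_zero (h.mem_goodSet hη hl0) 1)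
  set C := 1 + (1 - η)⁻¹ + sizeConst m η * B + ((1 - η) ^ (N + 1))⁻¹ with hC
  have p1 : 0 ≤ (1 - η)⁻¹ := by positivity
  have p2 : 0 ≤ sizeConst m η * B := by positivity
  have p3 : 0 ≤ ((1 - η) ^ (N + 1))⁻¹ := by positivity
  refine ⟨1, ‖factor m V lam 1 x‖⁻¹, zero_le_one, by positivity, ?_, ?_, ?_, ?_⟩
  · have h2 : ‖factor m V lam 1 x‖⁻¹ ≤ (1 - η)⁻¹ := by
      gcongr
      nlinarith [h.le_norm 1]
    linarith
  · have h3 : 1 ≤ lam ^ ((1 - ε₁) / 2) := Real.one_le_rpow hlam (by linarith)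
    nlinarith
  · intro i k _ hk
    rw [one_pow, mul_one]
    refine (norm_jetVal_le h hη0 hη hlam i k).trans ?_
    gcongr
    refine (mul_le_mul_of_nonneg_left (hB i k hk) hK0.le).trans ?_
    linarith
  · have h4 := inv_norm_factor_pow_le h hη hl0 (N + 1)
    rw [one_pow, one_mul, ← mul_inv, ← pow_succ]
    push_cast at h4
    have hr0 : 0 ≤ r := (Real.rpow_nonneg hl0.le _).trans hr
    refine h4.trans (mul_le_mul (by linarith) hr (Real.rpow_nonneg hl0.le _) (by linarith))

theorem PartsLe.growth_le (h : PartsLe m V η lam x) (hη0 : 0 < η) (hη : η < 1) (hlam : 1 ≤ lam) :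
    max ‖V x 0 0‖ ‖V x 1 1‖ / ‖factor m V lam 1 x‖ ≤ sizeConst m η := by
  have hD : 0 < ‖factor m V lam 1 x‖ :=
    norm_pos_iff.2 (factor_ne_zero (h.mem_goodSet hη (by linarith)) 1)
  rw [div_le_iff₀ hD]
  exact max_le (h.norm_diag_le hη0 hη hlam 0) (h.norm_diag_le hη0 hη hlam 1)

theorem bddAbove_growthSet (hη0 : 0 < η) (hη : η < 1)
    {s : Side} {C R a : ℝ} (hC : 0 ≤ C) (hR : ∀ x, R ≤ s.sgn * x → |f x| ^ ν s ≤ C)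
    (ha0 : 0 < a) (ha : R ≤ a) (hlam : 1 ≤ lam) (hδ : ∀ s, 0 ≤ rad m V f ν η ε₁ lam s)
    (hP : ∀ x ∈ region (rad m V f ν η ε₁ lam), PartsLe m V η lam x) :
    BddAbove (growthSet m V f ν η ε₁ N s a lam) := by
  have hK := one_le_sizeConst (m := m) hη
  refine ⟨C ^ (N + 1) * sizeConst m η, ?_⟩
  rintro _ ⟨x, ⟨hx, hx'⟩, rfl⟩
  have hp := hP x (mem_region_of_nonneg hδ (by linarith) hx'.le)
  have h1 := hp.growth_le hη0 hη hlam
  have h2 : |f x| ^ (((N : ℝ) + 1) * ν s) = (|f x| ^ ν s) ^ (N + 1) := by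
    rw [mul_comm, Real.rpow_mul (abs_nonneg _)]
    exact_mod_cast Real.rpow_natCast _ _
  simp only [den_eq_factor]
  rw [h2, mul_div_assoc]
  have h3 := hR x (by linarith)
  have h4 : 0 ≤ |f x| ^ ν s := Real.rpow_nonneg (abs_nonneg _) _
  gcongr

/-- The data on the side `s` entering the estimate of the remainder away from the origin:
`Φ ≤ A` if `ν ≤ 0`, `Φ ≤ λ^θ` if `0 < ν`, and `G ≤ B / λ` in the bounded case. -/
theorem pow_mul_le_rate {Φ G D A B c K : ℝ} {s : Side} {a : ℝ} (hlam : 1 ≤ lam) (hΦ : 0 ≤ Φ)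
    (hG : 0 ≤ G) (hD : 0 < D) (hA : 0 ≤ A) (hB : 0 ≤ B) (hc : 0 ≤ c)
    (hDN : (D ^ N)⁻¹ ≤ c * lam ^ (-(N : ℝ))) (hGK : G ≤ K)
    (hΦA : ν s ≤ 0 → Φ ≤ A) (hΦl : 0 < ν s → Φ ≤ lam ^ ((1 - ε₁) / 2))
    (hGB : DiagBounded V s → G ≤ B * lam ^ (-1 : ℝ))
    (hsup : ¬ DiagBounded V s → ν s ≤ 0 →
      Φ ^ (N + 1) * G ≤ sSup (growthSet m V f ν η ε₁ N s a lam)) :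
    Φ ^ (N + 1) * (D ^ N)⁻¹ * G ≤ (A ^ (N + 1) * c * B + c * B + c + c * K)
      * rate m N V f ν η ε₁ s a lam := by
  have hl0 : 0 < lam := by linarith
  have hK : 0 ≤ K := hG.trans hGK
  have hlN : 0 ≤ lam ^ (-(N : ℝ)) := Real.rpow_nonneg hl0.le _
  have q1 : 0 ≤ A ^ (N + 1) * c * B := by positivity
  have q2 : 0 ≤ c * B := by positivity
  have q3 : 0 ≤ c * K := by positivity
  have hpow : 0 < ν s → Φ ^ (N + 1) ≤ lam ^ ((1 - ε₁) / 2 * ((N : ℝ) + 1)) := fun hν => by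
    have := pow_le_pow_left₀ hΦ (hΦl hν) (N + 1)
    rw [← Real.rpow_natCast (lam ^ _), ← Real.rpow_mul hl0.le] at this
    exact_mod_cast this
  have hi : 0 ≤ (D ^ N)⁻¹ := by positivity
  have hΦN : 0 ≤ Φ ^ (N + 1) := by positivity
  have fin : ∀ {r t C : ℝ}, 0 ≤ r → r ≤ t * C → t ≤ A ^ (N + 1) * c * B + c * B + c + c * K →
      0 ≤ C → r ≤ (A ^ (N + 1) * c * B + c * B + c + c * K) * C := fun h1 h2 h3 h4 =>
    h2.trans (mul_le_mul_of_nonneg_right h3 h4)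
  have h0 : 0 ≤ Φ ^ (N + 1) * (D ^ N)⁻¹ * G := by positivity
  unfold rate
  by_cases hdb : DiagBounded V s <;> by_cases hν : ν s ≤ 0 <;>
    simp only [hdb, hν, if_true, if_false]
  · refine fin (t := A ^ (N + 1) * c * B) h0 ?_ (by linarith) (Real.rpow_nonneg hl0.le _)
    have e : lam ^ (-((N : ℝ) + 1)) = lam ^ (-(N : ℝ)) * lam ^ (-1 : ℝ) := by
      rw [← Real.rpow_add hl0]; congr 1; ring
    calc Φ ^ (N + 1) * (D ^ N)⁻¹ * G
        ≤ A ^ (N + 1) * (c * lam ^ (-(N : ℝ))) * (B * lam ^ (-1 : ℝ)) :=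
          mul_le_mul (mul_le_mul (pow_le_pow_left₀ hΦ (hΦA hν) _) hDN hi (by positivity))
            (hGB hdb) hG (by positivity)
      _ = _ := by rw [e]; ring
  · refine fin (t := c * B) h0 ?_ (by linarith) (Real.rpow_nonneg hl0.le _)
    -- Exponents: `(1 - ε₁)/2 · (N+1)` from `Φ^(N+1)`, `-N` from `D^(-N)` and `-1` from `G`, the
    -- last being available only for bounded diagonal entries.
    have e : lam ^ (-((1 + ε₁) / 2) * ((N : ℝ) + 1)) =
        lam ^ ((1 - ε₁) / 2 * ((N : ℝ) + 1)) * lam ^ (-(N : ℝ)) * lam ^ (-1 : ℝ) := by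
      rw [← Real.rpow_add hl0, ← Real.rpow_add hl0]; congr 1; ring
    calc Φ ^ (N + 1) * (D ^ N)⁻¹ * G
        ≤ lam ^ ((1 - ε₁) / 2 * ((N : ℝ) + 1)) * (c * lam ^ (-(N : ℝ))) * (B * lam ^ (-1 : ℝ)) :=
          mul_le_mul (mul_le_mul (hpow (not_le.1 hν)) hDN hi (Real.rpow_nonneg hl0.le _))
            (hGB hdb) hG (by positivity)
      _ = _ := by rw [e]; ring
  · have hS := hsup hdb hν
    have hS0 := (mul_nonneg hΦN hG).trans hS
    refine fin (t := c) h0 ?_ (by linarith) ((mul_nonneg hlN hS0).trans (le_max_right _ _))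
    refine le_trans ?_ (mul_le_mul_of_nonneg_left (le_max_right _ _) hc)
    calc Φ ^ (N + 1) * (D ^ N)⁻¹ * G = (D ^ N)⁻¹ * (Φ ^ (N + 1) * G) := by ring
      _ ≤ (c * lam ^ (-(N : ℝ))) * sSup (growthSet m V f ν η ε₁ N s a lam) :=
        mul_le_mul hDN hS (mul_nonneg hΦN hG) (by positivity)
      _ = _ := by ring
  · refine fin (t := c * K) h0 ?_ (by linarith) (Real.rpow_nonneg hl0.le _)
    have e : lam ^ (-((1 + ε₁) / 2) * ((N : ℝ) + 1) + 1) =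
        lam ^ ((1 - ε₁) / 2 * ((N : ℝ) + 1)) * lam ^ (-(N : ℝ)) := by
      rw [← Real.rpow_add hl0]; congr 1; ring
    calc Φ ^ (N + 1) * (D ^ N)⁻¹ * G
        ≤ lam ^ ((1 - ε₁) / 2 * ((N : ℝ) + 1)) * (c * lam ^ (-(N : ℝ))) * K :=
          mul_le_mul (mul_le_mul (hpow (not_le.1 hν)) hDN hi (Real.rpow_nonneg hl0.le _))
            hGK hG (by positivity)
      _ = _ := by rw [e]; ring

/-- The weights are `Φ = |f|^ν` and `G = max |V_ii| / D`. The product `Φ^(N+1) G` is the quantity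
whose supremum appears in the theorem when `ν ≤ 0`. -/
theorem PartsLe.exists_isWeight_outer (hp : PartsLe m V η lam x) (hη0 : 0 < η) (hη : η < 1)
    (hε₁ : ε₁ < 1) (hlam : 1 ≤ lam) {s : Side} {a A C1 Cd : ℝ} (hA : 0 ≤ A) (hC1 : 0 ≤ C1)
    (hCd : 0 ≤ Cd)
    (hJ : ∀ i k, 1 ≤ k → k ≤ N + 1 → ‖J i k x‖ ≤ C1 * (|f x| ^ ν s) ^ k * ‖V x i i‖)
    (hΦA : ν s ≤ 0 → |f x| ^ ν s ≤ A) (hΦl : 0 < ν s → |f x| ^ ν s ≤ lam ^ ((1 - ε₁) / 2))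
    (hdb : DiagBounded V s → max ‖V x 0 0‖ ‖V x 1 1‖ ≤ Cd)
    (hbdd : ν s ≤ 0 → BddAbove (growthSet m V f ν η ε₁ N s a lam))
    (hmem : x ∈ outerSet m V f ν η ε₁ s a lam) :
    ∃ Φ G, IsWeight m N V J ε₁ lam (1 + sizeConst m η + A + sizeConst m η * C1
      + (A ^ (N + 1) * ((1 - η) ^ N)⁻¹ * (Cd * (1 - η)⁻¹) + ((1 - η) ^ N)⁻¹ * (Cd * (1 - η)⁻¹)
        + ((1 - η) ^ N)⁻¹ + ((1 - η) ^ N)⁻¹ * sizeConst m η))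
      (rate m N V f ν η ε₁ s a lam) x Φ G := by
  have hl0 : 0 < lam := by linarith
  have h1η : 0 < 1 - η := by linarith
  have hK1 : 1 ≤ sizeConst m η := one_le_sizeConst hη
  have hK0 : 0 < sizeConst m η := by linarith
  have hD : 0 < ‖factor m V lam 1 x‖ :=
    norm_pos_iff.2 (factor_ne_zero (hp.mem_goodSet hη hl0) 1)
  have hrate0 := rate_nonneg (N := N) hε₁ hlam m V f ν η s a
  set Φ := |f x| ^ ν s with hΦ
  set D := ‖factor m V lam 1 x‖ with hDdef
  set G := max ‖V x 0 0‖ ‖V x 1 1‖ / D with hG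
  have hΦ0 : 0 ≤ Φ := Real.rpow_nonneg (abs_nonneg _) _
  have hG0 : 0 ≤ G := by positivity
  have hGK : G ≤ sizeConst m η := hp.growth_le hη0 hη hlam
  have hDN := inv_norm_factor_pow_le hp hη hl0 N
  have hθ1 : 1 ≤ lam ^ ((1 - ε₁) / 2) := Real.one_le_rpow hlam (by linarith)
  have key := pow_mul_le_rate (m := m) (V := V) (f := f) (ν := ν) (η := η) (ε₁ := ε₁) (s := s)
    (a := a) (A := A) (B := Cd * (1 - η)⁻¹) hlam hΦ0 hG0 hD hA (by positivity) (by positivity)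
    hDN hGK hΦA hΦl
    (fun h => by
      have := inv_norm_factor_pow_le hp hη hl0 1
      rw [pow_one, pow_one, Nat.cast_one] at this
      rw [hG, div_eq_mul_inv, mul_assoc]
      exact mul_le_mul (hdb h) this (by positivity) hCd)
    (fun _ hν => by
      refine le_csSup (hbdd hν) ⟨x, hmem, ?_⟩
      simp only [den_eq_factor]
      rw [mul_div_assoc, mul_comm ((N : ℝ) + 1), Real.rpow_mul (abs_nonneg _)]
      congr 1
      exact_mod_cast Real.rpow_natCast _ _)
  set E := A ^ (N + 1) * ((1 - η) ^ N)⁻¹ * (Cd * (1 - η)⁻¹) + ((1 - η) ^ N)⁻¹ * (Cd * (1 - η)⁻¹)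
        + ((1 - η) ^ N)⁻¹ + ((1 - η) ^ N)⁻¹ * sizeConst m η with hE
  have hE0 : 0 ≤ E := by positivity
  have q1 : 0 ≤ sizeConst m η * C1 := by positivity
  refine ⟨Φ, G, hΦ0, hG0, by linarith, ?_, ?_, key.trans ?_⟩
  · rcases le_or_gt (ν s) 0 with hν | hν
    · exact (hΦA hν).trans ((by linarith : A ≤ _ * 1).trans
        (mul_le_mul_of_nonneg_left hθ1 (by linarith)))
    · exact (hΦl hν).trans (le_mul_of_one_le_left (by linarith) (by linarith))
  · intro i k hk hk'
    refine (norm_jetVal_le hp hη0 hη hlam i k).trans ?_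
    have h3 : ‖V x i i‖ * D⁻¹ ≤ G := by
      rw [hG, div_eq_mul_inv]
      refine mul_le_mul_of_nonneg_right ?_ (by positivity)
      fin_cases i
      · exact le_max_left _ _
      · exact le_max_right _ _
    calc sizeConst m η * ‖J i k x‖ * D⁻¹
        ≤ sizeConst m η * (C1 * Φ ^ k * ‖V x i i‖) * D⁻¹ :=
          mul_le_mul_of_nonneg_right (mul_le_mul_of_nonneg_left (hJ i k hk hk') hK0.le)
            (by positivity)
      _ = sizeConst m η * C1 * Φ ^ k * (‖V x i i‖ * D⁻¹) := by ring
      _ ≤ _ := mul_le_mul (mul_le_mul_of_nonneg_right (by linarith) (by positivity)) h3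
          (by positivity) (mul_nonneg (by linarith) (by positivity))
  · exact mul_le_mul_of_nonneg_right (by linarith) hrate0

theorem Admissible.exists_weight (hV : Admissible N V f μ ε ν)
    (hJ : ∀ i, IsJet N (fun x => V x i i) (J i)) (hη0 : 0 < η) (hη : η < 1) (hε₁ : ε₁ < 1)
    (m : ℝ) (s : Side) :
    ∃ a₀ > 0, ∀ a, a₀ ≤ a → (ν s ≤ 0 → ∀ᶠ lam in atTop,
        BddAbove (growthSet m V f ν η ε₁ N s a lam)) ∧
      ∃ C, 0 ≤ C ∧ ∀ᶠ lam in atTop, ∀ᵐ x, x ∈ openRegion (rad m V f ν η ε₁ lam) →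
        0 ≤ s.sgn * x → ∃ Φ G, IsWeight m N V J ε₁ lam C (rate m N V f ν η ε₁ s a lam) x Φ G := by
  obtain ⟨C1, R1, hC1, hR1, hb1⟩ := hV.exists_jet_bound hJ s
  obtain ⟨Cf, Rf, hCf, hRf, hbf⟩ : ∃ C R : ℝ, 0 ≤ C ∧ 0 < R ∧
      (ν s ≤ 0 → ∀ x, R ≤ s.sgn * x → |f x| ^ ν s ≤ C) := by
    by_cases h : ν s ≤ 0
    · obtain ⟨C, R, h1, h2, h3⟩ := hV.exists_rpow_bound h
      exact ⟨C, R, h1, h2, fun _ => h3⟩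
    · exact ⟨0, 1, le_rfl, one_pos, fun h' => absurd h' h⟩
  obtain ⟨Cd, hCd, hbd⟩ : ∃ C : ℝ, 0 ≤ C ∧ (DiagBounded V s → ∀ x, 0 ≤ s.sgn * x →
      max ‖V x 0 0‖ ‖V x 1 1‖ ≤ C) := by
    by_cases h : DiagBounded V s
    · obtain ⟨B0, h0, h0'⟩ := exists_bound_of_isBigO_one (hV.diag_continuous 0) (h 0)
      obtain ⟨B1, h1, h1'⟩ := exists_bound_of_isBigO_one (hV.diag_continuous 1) (h 1)
      exact ⟨max B0 B1, h0.trans (le_max_left _ _), fun _ x hx =>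
        max_le_max (h0' x hx) (h1' x hx)⟩
    · exact ⟨0, le_rfl, fun h' => absurd h' h⟩
  -- Beyond this threshold both the derivative bounds and the bound on `|f|^ν` hold; everything up
  -- to `a` is treated as compact.
  refine ⟨max R1 Rf, lt_max_of_lt_left hR1, fun a ha => ?_⟩
  have haR1 : R1 ≤ a := (le_max_left _ _).trans ha
  have haRf : Rf ≤ a := (le_max_right _ _).trans ha
  have ha0 : 0 < a := hR1.trans_le haR1
  have hbdd : ∀ᶠ lam in atTop, ν s ≤ 0 → BddAbove (growthSet m V f ν η ε₁ N s a lam) := by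
    filter_upwards [hV.eventually_partsLe hη0 hε₁ m] with lam ⟨h1, h2, h3⟩ hνs
    exact bddAbove_growthSet hη0 hη hCf (hbf hνs) ha0 haRf h1 h2 h3
  refine ⟨fun hνs => hbdd.mono fun _ h => h hνs, ?_⟩
  obtain ⟨B, hB0, hB⟩ := exists_jet_bound_compact hJ a
  have h1η : 0 < 1 - η := by linarith
  have hK : 0 ≤ sizeConst m η := zero_le_one.trans (one_le_sizeConst hη)
  refine ⟨(1 + (1 - η)⁻¹ + sizeConst m η * B + ((1 - η) ^ (N + 1))⁻¹) +
    (1 + sizeConst m η + Cf + sizeConst m η * C1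
      + (Cf ^ (N + 1) * ((1 - η) ^ N)⁻¹ * (Cd * (1 - η)⁻¹) + ((1 - η) ^ N)⁻¹ * (Cd * (1 - η)⁻¹)
        + ((1 - η) ^ N)⁻¹ + ((1 - η) ^ N)⁻¹ * sizeConst m η)), by positivity, ?_⟩
  filter_upwards [hV.eventually_partsLe hη0 hε₁ m, hV.eventually_rpow_le hε₁ m η, hbdd]
    with lam ⟨hlam, hδ, hP⟩ hpow hbd0
  have hl0 : 0 < lam := by linarith
  have hrate := rpow_le_rate (N := N) hε₁ hlam m V f ν η s a
  have hrate0 := rate_nonneg (N := N) hε₁ hlam m V f ν η s a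
  filter_upwards [hb1, hB] with x hx1 hxB hxreg hxs
  have hp := hP x (openRegion_subset_region hxreg)
  rcases le_or_gt (s.sgn * x) a with hxa | hxa
  · rw [← Side.abs_eq hxs] at hxa
    obtain ⟨Φ, G, hw⟩ := hp.exists_isWeight_inner (ε₁ := ε₁) hη0 hη hε₁ hlam hB0 (hxB hxa) hrate
    exact ⟨Φ, G, hw.mono (le_add_of_nonneg_right (by positivity)) hl0.le hrate0⟩
  · obtain ⟨Φ, G, hw⟩ := hp.exists_isWeight_outer (ε₁ := ε₁) (f := f) (ν := ν) (s := s) (a := a)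
      (J := J) (N := N) hη0 hη hε₁ hlam hCf hC1 hCd (hx1 (by linarith))
      (fun h => hbf h x (by linarith)) (fun h => hpow s x h hxs (hxreg s).le)
      (fun h => hbd h x hxs) hbd0 ⟨hxa, hxreg s⟩
    exact ⟨Φ, G, hw.mono (le_add_of_nonneg_left (by positivity)) hl0.le hrate0⟩

end DiracWKB

/-! ### Pointwise bounds for the terms and the remainder of the expansion. -/

namespace DiracWKB

variable {m : ℝ} {N : ℕ} {V : ℝ → Matrix (Fin 2) (Fin 2) ℂ} {f : ℝ → ℝ} {μ ε ν : Side → ℝ}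
  {η ε₁ lam : ℝ} {J : Fin 2 → ℕ → ℝ → ℂ} {x : ℝ} {δ : Side → EReal}

/-! ### Consequences of the weights -/

/-- The bounds on the terms of the expansion at `x`. -/
structure ExpansionBound (m : ℝ) (N : ℕ) (V : ℝ → Matrix (Fin 2) (Fin 2) ℂ)
    (J : Fin 2 → ℕ → ℝ → ℂ) (ε₁ lam C r x : ℝ) : Prop where
  remainder_le : ‖wkbRemainder N (eikonal m V lam x) (jetVal m V J lam x)‖
    ≤ C * r * ‖factor m V lam 1 x‖
  term_le : ∀ q, 2 ≤ q → q ≤ N →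
    ‖wkbTerm q (eikonal m V lam x) (jetVal m V J lam x)‖ ≤ C * lam ^ (-ε₁)
  phaseDeriv_le : ‖phaseDeriv N m V J lam x‖ ≤ C * ‖factor m V lam 1 x‖
  jetVal_le : ‖jetVal m V J lam x 1 1‖ ≤ C * ‖factor m V lam 1 x‖

/-- The exponent `(1 - ε₁)(q + 1)/2 - q` decreases in `q` and equals `-ε₁` at `q = 1`. With the
index shift this covers all terms from the second one on. -/
theorem term_rate_le {C c Φ D G : ℝ} (hC : 0 ≤ C) (hlam : 1 ≤ lam)
    (hε₁ : 0 < ε₁) (hΦ : 0 ≤ Φ) (hG : 0 ≤ G) (hD : 0 < D) (hc : 0 ≤ c) (q : ℕ) (hq : 1 ≤ q)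
    (hDq : (D ^ q)⁻¹ ≤ c * lam ^ (-(q : ℝ)))
    (hΦC : Φ ≤ C * lam ^ ((1 - ε₁) / 2)) (hGC : G ≤ C) :
    Φ ^ (q + 1) * (D ^ q)⁻¹ * G ≤ C ^ (q + 1) * c * C * lam ^ (-ε₁) := by
  have hl0 : 0 < lam := by linarith
  have h1 : Φ ^ (q + 1) ≤ C ^ (q + 1) * lam ^ ((1 - ε₁) / 2 * ((q : ℝ) + 1)) := by
    refine (pow_le_pow_left₀ hΦ hΦC _).trans (le_of_eq ?_)
    rw [mul_pow, ← Real.rpow_natCast (lam ^ _), ← Real.rpow_mul hl0.le]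
    push_cast
    rfl
  have hq' : (1 : ℝ) ≤ q := by exact_mod_cast hq
  have h2 : lam ^ ((1 - ε₁) / 2 * ((q : ℝ) + 1)) * lam ^ (-(q : ℝ)) ≤ lam ^ (-ε₁) := by
    rw [← Real.rpow_add hl0]
    exact Real.rpow_le_rpow_of_exponent_le hlam (by nlinarith)
  calc Φ ^ (q + 1) * (D ^ q)⁻¹ * G
      ≤ (C ^ (q + 1) * lam ^ ((1 - ε₁) / 2 * ((q : ℝ) + 1))) * (c * lam ^ (-(q : ℝ))) * C :=
        mul_le_mul (mul_le_mul h1 hDq (by positivity) (by positivity)) hGC hG (by positivity)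
    _ = C ^ (q + 1) * c * C * (lam ^ ((1 - ε₁) / 2 * ((q : ℝ) + 1)) * lam ^ (-(q : ℝ))) := by
        ring
    _ ≤ _ := by gcongr

theorem exists_expansionBound (m : ℝ) (N : ℕ) (V : ℝ → Matrix (Fin 2) (Fin 2) ℂ)
    (J : Fin 2 → ℕ → ℝ → ℂ) (hη0 : 0 < η) (hη : η < 1) (hε₁ : 0 < ε₁) {C : ℝ}
    (hC : 0 ≤ C) : ∃ C', 0 ≤ C' ∧ ∀ lam x r Φ G, 1 ≤ lam → 0 ≤ r → PartsLe m V η lam x →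
      IsWeight m N V J ε₁ lam C r x Φ G → ExpansionBound m N V J ε₁ lam C' r x := by
  have h1η : 0 < 1 - η := by linarith
  set K := sizeConst m η with hK
  have hK1 : 1 ≤ K := one_le_sizeConst hη
  have hK0 : 0 < K := by linarith
  set C2 := C + K + C * (1 - η)⁻¹ with hC2
  have hC20 : 0 ≤ C2 := by positivity
  have q1 : 0 ≤ C * (1 - η)⁻¹ := by positivity
  have hCC2 : C ≤ C2 := by linarith
  have hKi : 0 < K⁻¹ := by positivity
  obtain ⟨CR, hCR, hbR⟩ := exists_bound_wkbRemainder N hC20 hKi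
  choose B hB0 hB using fun q => exists_bound_wkbTerm q hC20 hKi
  set T : ℕ → ℝ := fun q => B q * (C ^ (q + 1) * ((1 - η) ^ q)⁻¹ * C) with hT
  have hT0 : ∀ q, 0 ≤ T q := fun q => by have := hB0 q; positivity
  set U : ℕ → ℝ := fun q => B q * (C2 ^ (q + 1) * C2) with hU
  have hU0 : ∀ q, 0 ≤ U q := fun q => by have := hB0 q; positivity
  have hTs : 0 ≤ ∑ q ∈ Finset.range N, T q := Finset.sum_nonneg fun q _ => hT0 q
  have hUs : 0 ≤ ∑ q ∈ Finset.range N, U q := Finset.sum_nonneg fun q _ => hU0 q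
  set C' := CR * C + ∑ q ∈ Finset.range N, T q + (∑ q ∈ Finset.range N, U q + K) + C * C2 * C
    with hC'
  have q2 : 0 ≤ CR * C := by positivity
  have q3 : 0 ≤ C * C2 * C := by positivity
  refine ⟨C', by positivity, fun lam x r Φ G hlam hr hp hw => ?_⟩
  have hl0 : 0 < lam := by linarith
  have hD : 0 < ‖factor m V lam 1 x‖ :=
    norm_pos_iff.2 (factor_ne_zero (hp.mem_goodSet hη hl0) 1)
  set D := ‖factor m V lam 1 x‖ with hDdef
  obtain ⟨hY1, hY2⟩ := hp.norm_eikonal hη0 hη hlam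
  have hΦ := hw.nonneg
  have hG := hw.nonneg'
  -- The only comparison between derivatives and `λ` needed by the algebra: `Φ ≲ λ^((1-ε₁)/2) ≤ λ ≲
  -- D`.
  have hΦD : Φ ≤ C2 * D := by
    have h1 : lam ^ ((1 - ε₁) / 2) ≤ lam := by
      conv_rhs => rw [← Real.rpow_one lam]
      exact Real.rpow_le_rpow_of_exponent_le hlam (by linarith)
    have h2 : lam ≤ (1 - η)⁻¹ * D := by
      rw [le_inv_mul_iff₀ h1η]
      exact hp.le_norm 1
    calc Φ ≤ C * lam ^ ((1 - ε₁) / 2) := hw.le_rpow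
      _ ≤ C * ((1 - η)⁻¹ * D) := by gcongr; exact h1.trans h2
      _ = C * (1 - η)⁻¹ * D := by ring
      _ ≤ C2 * D := by gcongr; linarith
  have hY2' : ‖eikonal m V lam x‖ ≤ C2 * D := hY2.trans (by gcongr; linarith)
  have hGC2 : G ≤ C2 := hw.le_const.trans hCC2
  have hjet : ∀ i k, 1 ≤ k → k ≤ N + 1 → ‖jetVal m V J lam x i k‖ ≤ C2 * Φ ^ k * G :=
    fun i k hk hk' => (hw.jet_le i k hk hk').trans (by gcongr)
  have hterm : ∀ q < N, ‖wkbTerm (q + 1) (eikonal m V lam x) (jetVal m V J lam x)‖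
      ≤ B q * (Φ ^ (q + 1) * (D ^ q)⁻¹ * G) := fun q hq =>
    hB q _ _ Φ G D hΦ hG hGC2 hD hY1 fun i k hk hk' => hjet i k hk (by omega)
  refine ⟨?_, ?_, ?_, ?_⟩
  · have h1 := hbR _ _ Φ G D hΦ hG hGC2 hD hY1 hY2' hΦD hjet
    refine h1.trans ?_
    calc CR * (Φ ^ (N + 1) * D * (D ^ N)⁻¹ * G) = CR * (Φ ^ (N + 1) * (D ^ N)⁻¹ * G) * D := by
          ring
      _ ≤ CR * (C * r) * D :=
        mul_le_mul_of_nonneg_right (mul_le_mul_of_nonneg_left hw.le_rate hCR) hD.le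
      _ = CR * C * (r * D) := by ring
      _ ≤ C' * (r * D) := by gcongr; linarith
      _ = _ := by ring
  · intro q hq hqN
    obtain ⟨q, rfl⟩ : ∃ q', q = q' + 1 := ⟨q - 1, by omega⟩
    refine (hterm q (by omega)).trans ?_
    have h1 := term_rate_le hC hlam hε₁ hΦ hG hD (by positivity) q (by omega)
      (inv_norm_factor_pow_le hp hη hl0 q) hw.le_rpow hw.le_const
    have h2 : T q ≤ C' := by
      have := Finset.single_le_sum (f := T) (fun q _ => hT0 q) (Finset.mem_range.2 (by omega :
        q < N))
      linarith
    calc B q * (Φ ^ (q + 1) * (D ^ q)⁻¹ * G)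
        ≤ B q * (C ^ (q + 1) * ((1 - η) ^ q)⁻¹ * C * lam ^ (-ε₁)) :=
          mul_le_mul_of_nonneg_left h1 (hB0 q)
      _ = T q * lam ^ (-ε₁) := by rw [hT]; ring
      _ ≤ _ := by gcongr
  · have h0 : wkbTerm 0 (eikonal m V lam x) (jetVal m V J lam x) = eikonal m V lam x := by
      simp [wkbTerm, wkbPoly_zero]
    rw [phaseDeriv, Finset.sum_range_succ', h0]
    have h1 : ∀ q ∈ Finset.range N, ‖wkbTerm (q + 1) (eikonal m V lam x) (jetVal m V J lam x)‖
        ≤ U q * D := fun q hq => by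
      refine (hterm q (Finset.mem_range.1 hq)).trans ?_
      have := hB0 q
      calc B q * (Φ ^ (q + 1) * (D ^ q)⁻¹ * G)
          ≤ B q * ((C2 * D) ^ (q + 1) * (D ^ q)⁻¹ * C2) := by gcongr
        _ = U q * D := by
            rw [hU, mul_pow, pow_succ D]
            field_simp
    calc ‖_ + eikonal m V lam x‖ ≤ ∑ q ∈ Finset.range N, U q * D + K * D :=
          (norm_add_le _ _).trans (add_le_add ((norm_sum_le _ _).trans (Finset.sum_le_sum h1)) hY2)
      _ = (∑ q ∈ Finset.range N, U q + K) * D := by rw [← Finset.sum_mul]; ring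
      _ ≤ C' * D := by gcongr; linarith
  · refine (hw.jet_le 1 1 le_rfl (by omega)).trans ?_
    calc C * Φ ^ 1 * G ≤ C * (C2 * D) ^ 1 * C := by gcongr; exact hw.le_const
      _ = C * C2 * C * D := by ring
      _ ≤ C' * D := by gcongr; linarith

/-- The pointwise bounds on the expansion, at almost every point of the support of the cut-off. -/
theorem Admissible.exists_expansionBound (hV : Admissible N V f μ ε ν)
    (hJ : ∀ i, IsJet N (fun x => V x i i) (J i)) (hη0 : 0 < η) (hη : η < 1) (hε₁ : 0 < ε₁)
    (hε₁' : ε₁ < 1) (m : ℝ) :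
    ∃ a₀ > 0, ∀ a : Side → ℝ, (∀ s, a₀ ≤ a s) →
      (∀ s, ν s ≤ 0 → ∀ᶠ lam in atTop, BddAbove (growthSet m V f ν η ε₁ N s (a s) lam)) ∧
      ∃ C, 0 ≤ C ∧ ∀ᶠ lam in atTop, ∀ᵐ x, x ∈ openRegion (rad m V f ν η ε₁ lam) → ∀ s,
        0 ≤ s.sgn * x →
        ExpansionBound m N V J ε₁ lam C (rate m N V f ν η ε₁ s (a s) lam) x := by
  choose A hA0 hA using hV.exists_weight (m := m) hJ hη0 hη hε₁'
  refine ⟨max (A .minus) (A .plus), lt_max_of_lt_left (hA0 _), fun a ha => ?_⟩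
  have ha' : ∀ s, A s ≤ a s := fun s => by
    cases s
    · exact (le_max_left _ _).trans (ha _)
    · exact (le_max_right _ _).trans (ha _)
  refine ⟨fun s => (hA s (a s) (ha' s)).1, ?_⟩
  choose C hC0 hC using fun s => (hA s (a s) (ha' s)).2
  choose C' hC'0 hC' using fun s =>
    DiracWKB.exists_expansionBound m N V J hη0 hη hε₁ (hC0 s)
  refine ⟨max (C' .minus) (C' .plus), le_max_of_le_left (hC'0 _), ?_⟩
  filter_upwards [forall_side_eventually.2 hC, hV.eventually_partsLe hη0 hε₁' m]
    with lam hlam ⟨h1, h2, h3⟩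
  have hae : ∀ᵐ x, ∀ s, x ∈ openRegion (rad m V f ν η ε₁ lam) → 0 ≤ s.sgn * x →
      ∃ Φ G, IsWeight m N V J ε₁ lam (C s) (rate m N V f ν η ε₁ s (a s) lam) x Φ G :=
    forall_side_eventually.2 hlam
  filter_upwards [hae] with x hx hxr s hs
  obtain ⟨Φ, G, hw⟩ := hx s hxr hs
  have hr := rate_nonneg (N := N) hε₁' h1 m V f ν η s (a s)
  have hb := hC' s lam x _ Φ G h1 hr (h3 x (openRegion_subset_region hxr)) hw
  have hle : C' s ≤ max (C' .minus) (C' .plus) := by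
    cases s
    exacts [le_max_left _ _, le_max_right _ _]
  have hl : 0 ≤ lam := by linarith
  exact ⟨hb.1.trans (by gcongr), fun q h4 h5 => (hb.2 q h4 h5).trans (by gcongr),
    hb.3.trans (by gcongr), hb.4.trans (by gcongr)⟩

end DiracWKB

/-! ### Growth of `F`, of `log |k₁|` and of the real part of the phase. -/

namespace DiracWKB

variable {m : ℝ} {N : ℕ} {V : ℝ → Matrix (Fin 2) (Fin 2) ℂ} {f : ℝ → ℝ} {μ ε ν : Side → ℝ}
  {η ε₁ lam : ℝ} {J : Fin 2 → ℕ → ℝ → ℂ} {x : ℝ} {δ : Side → EReal}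

/-! ### Integrals towards an end -/

theorem integral_side (s : Side) (h : ℝ → ℝ) (y : ℝ) :
    ∫ t in (0 : ℝ)..(s.sgn * y), h t = ∫ t in (0 : ℝ)..y, s.sgn * h (s.sgn * t) := by
  cases s
  · simp only [Side.sgn, neg_one_mul]
    rw [intervalIntegral.integral_neg, intervalIntegral.integral_comp_neg,
      intervalIntegral.integral_symm]
    simp
  · simp [Side.sgn]

/-- Hypotheses near an end leave a bounded interval uncontrolled. An integrand that is eventually
nonnegative loses at most `C R` there, and `C R` becomes the additive constant of the later lower
bounds. -/
theorem neg_mul_le_integral {h : ℝ → ℝ} {C R y : ℝ} (hC : 0 ≤ C) (hR : 0 ≤ R) (hy : 0 ≤ y)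
    (hi : ∀ t, 0 ≤ t → t ≤ y → IntervalIntegrable h volume 0 t)
    (h1 : ∀ t, 0 ≤ t → t ≤ y → t ≤ R → -C ≤ h t) (h2 : ∀ t, R ≤ t → t ≤ y → 0 ≤ h t) :
    -(C * R) ≤ ∫ t in (0 : ℝ)..y, h t := by
  have key : ∀ z, 0 ≤ z → z ≤ y → z ≤ R → -(C * z) ≤ ∫ t in (0 : ℝ)..z, h t := fun z hz hzy hzR => by
    have := intervalIntegral.integral_mono_on hz (by simp) (hi z hz hzy)
      (f := fun _ => -C) (g := h) fun t ht => h1 t ht.1 (ht.2.trans hzy) (ht.2.trans hzR)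
    rw [intervalIntegral.integral_const, sub_zero, smul_eq_mul] at this
    linarith
  rcases le_total y R with hyR | hyR
  · have := key y hy le_rfl hyR
    nlinarith
  · have e1 := key R hR hyR le_rfl
    have i2 : IntervalIntegrable h volume R y := (hi R hR hyR).symm.trans (hi y hy le_rfl)
    have e2 : 0 ≤ ∫ t in R..y, h t :=
      intervalIntegral.integral_nonneg hyR fun t ht => h2 t ht.1 ht.2
    rw [← intervalIntegral.integral_add_adjacent_intervals (hi R hR hyR) i2]
    linarith

/-! ### The function `F` -/

/-- The integrand of `F`. -/
def imSum (V : ℝ → Matrix (Fin 2) (Fin 2) ℂ) (x : ℝ) : ℝ := (V x 0 0).im + (V x 1 1).im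

theorem Admissible.continuous_imSum (hV : Admissible N V f μ ε ν) : Continuous (imSum V) :=
  (Complex.continuous_im.comp (hV.diag_continuous 0)).add
    (Complex.continuous_im.comp (hV.diag_continuous 1))

theorem Admissible.continuous_F (hV : Admissible N V f μ ε ν) : Continuous (F V) :=
  intervalIntegral.continuous_primitive (fun a b => hV.continuous_imSum.intervalIntegrable a b) 0

theorem F_side (V : ℝ → Matrix (Fin 2) (Fin 2) ℂ) (s : Side) (y : ℝ) :
    F V (s.sgn * y) = ∫ t in (0 : ℝ)..y, s.sgn * imSum V (s.sgn * t) :=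
  integral_side s (imSum V) y

theorem Admissible.exists_le_imSum (hV : Admissible N V f μ ε ν) (s : Side) :
    ∃ c > 0, ∃ R > 0, ∀ x, R ≤ s.sgn * x → c ≤ s.sgn * imSum V x := by
  cases s
  · obtain ⟨c, h1, h2⟩ := EReal.lt_iff_exists_real_btwn.1 hV.limsup_neg
    have h3 : c < 0 := by exact_mod_cast h2
    have h4 : ∀ᶠ x in Side.filter .minus, imSum V x < c :=
      (eventually_lt_of_limsup_lt h1).mono fun x hx => by exact_mod_cast hx
    obtain ⟨R, hR, hR'⟩ := Side.eventually_iff.1 h4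
    exact ⟨-c, by linarith, R, hR, fun x hx => by
      have := hR' x hx
      simp only [Side.sgn]
      linarith⟩
  · obtain ⟨c, h1, h2⟩ := EReal.lt_iff_exists_real_btwn.1 hV.liminf_pos
    have h3 : 0 < c := by exact_mod_cast h1
    have h4 : ∀ᶠ x in Side.filter .plus, c < imSum V x :=
      (eventually_lt_of_lt_liminf h2).mono fun x hx => by exact_mod_cast hx
    obtain ⟨R, hR, hR'⟩ := Side.eventually_iff.1 h4
    exact ⟨c, h3, R, hR, fun x hx => by
      have := hR' x hx
      simp only [Side.sgn]
      linarith⟩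

theorem exists_bound_side {h : ℝ → ℝ} (hc : Continuous h) (R : ℝ) :
    ∃ B, 0 ≤ B ∧ ∀ x, |x| ≤ R → |h x| ≤ B := by
  obtain ⟨B, hB⟩ := (isCompact_Icc (a := -R) (b := R)).exists_bound_of_continuousOn
    hc.continuousOn
  exact ⟨|B|, abs_nonneg _, fun x hx => (hB x (abs_le.1 hx)).trans (le_abs_self _)⟩

theorem Side.abs_sgn_mul (s : Side) (x : ℝ) : |s.sgn * x| = |x| := by
  rw [abs_mul, s.abs_sgn, one_mul]

/-- The integrand of `F`, oriented towards the end, is eventually at least a positive constant, so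
`F` grows at least linearly. -/
theorem Admissible.exists_le_F (hV : Admissible N V f μ ε ν) (s : Side) :
    ∃ c > 0, ∃ C, 0 ≤ C ∧ ∀ x, 0 ≤ s.sgn * x → c * (s.sgn * x) ≤ F V x + C := by
  obtain ⟨c, hc, R, hR, h⟩ := hV.exists_le_imSum s
  obtain ⟨B, hB, hb⟩ := exists_bound_side hV.continuous_imSum R
  refine ⟨c, hc, (B + c) * R, by positivity, fun x hx => ?_⟩
  have hcont : Continuous fun t => s.sgn * imSum V (s.sgn * t) - c :=
    (continuous_const.mul (hV.continuous_imSum.comp (by fun_prop))).sub continuous_const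
  have h1 := neg_mul_le_integral (h := fun t => s.sgn * imSum V (s.sgn * t) - c) (C := B + c)
    (R := R) (y := s.sgn * x) (by positivity) hR.le hx
    (fun t _ _ => hcont.intervalIntegrable _ _)
    (fun t ht _ htR => by
      have := hb (s.sgn * t) (by rwa [s.abs_sgn_mul, abs_of_nonneg ht])
      have h2 : |s.sgn * imSum V (s.sgn * t)| ≤ B := by rwa [s.abs_sgn_mul]
      linarith [(abs_le.1 h2).1])
    (fun t ht _ => by
      have := h (s.sgn * t) (by rwa [s.sgn_mul_sgn_mul])
      linarith)
  have hcont' : Continuous fun t => s.sgn * imSum V (s.sgn * t) :=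
    continuous_const.mul (hV.continuous_imSum.comp (by fun_prop))
  rw [intervalIntegral.integral_sub (hcont'.intervalIntegrable _ _) (by simp), ← F_side,
    s.sgn_mul_sgn_mul] at h1
  simp at h1
  linarith

theorem Admissible.exists_F_mono (hV : Admissible N V f μ ε ν) (s : Side) :
    ∃ R > 0, ∀ x y, R ≤ s.sgn * x → s.sgn * x ≤ s.sgn * y → F V x ≤ F V y := by
  obtain ⟨c, hc, R, hR, h⟩ := hV.exists_le_imSum s
  refine ⟨R, hR, fun x y hx hxy => ?_⟩
  have hcont : Continuous fun t => s.sgn * imSum V (s.sgn * t) :=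
    continuous_const.mul (hV.continuous_imSum.comp (by fun_prop))
  have h1 := F_side V s (s.sgn * x)
  have h2 := F_side V s (s.sgn * y)
  rw [s.sgn_mul_sgn_mul] at h1 h2
  rw [h1, h2, ← sub_nonneg, intervalIntegral.integral_interval_sub_left
    (hcont.intervalIntegrable _ _) (hcont.intervalIntegrable _ _)]
  refine intervalIntegral.integral_nonneg hxy fun t ht => hc.le.trans (h _ ?_)
  rw [s.sgn_mul_sgn_mul]
  exact hx.trans ht.1

/-! ### The modulus of `k₁` -/

/-- The logarithm of `|k₁|`. -/
def logK (V : ℝ → Matrix (Fin 2) (Fin 2) ℂ) (x : ℝ) : ℝ := (∫ t in (0 : ℝ)..x, V t 1 0).im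

theorem norm_k₁_mul_exp (V : ℝ → Matrix (Fin 2) (Fin 2) ℂ) (x : ℝ) (P : ℂ) :
    ‖k₁ V x * Complex.exp (-P)‖ = Real.exp (logK V x - P.re) := by
  rw [k₁, ← Complex.exp_add, Complex.norm_exp]
  congr 1
  simp [logK, sub_eq_add_neg]

theorem MemWLoc.ae_memLinftyLoc {k : ℕ} {g : ℝ → ℂ} (h : MemWLoc k g) : MemLinftyLoc g := by
  obtain ⟨w, hw, hb⟩ := h 0 (Nat.zero_le _)
  exact hb.congr (hw.ae_eq_of_zero.mono fun x hx => hx.symm)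

theorem Admissible.memLinftyLoc_offDiag (hV : Admissible N V f μ ε ν) {i j : Fin 2} (h : i ≠ j) :
    MemLinftyLoc fun x => V x i j := (hV.offDiag_sobolev i j h).ae_memLinftyLoc

theorem Admissible.continuous_logK (hV : Admissible N V f μ ε ν) : Continuous (logK V) :=
  Complex.continuous_im.comp (intervalIntegral.continuous_primitive
    (fun a b => (hV.memLinftyLoc_offDiag (by decide : (1 : Fin 2) ≠ 0)).intervalIntegrable a b) 0)

theorem Admissible.integral_offDiag (hV : Admissible N V f μ ε ν)
    (hsymm : ∀ᵐ x, V x 0 1 = V x 1 0) (x : ℝ) :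
    ∫ t in (0 : ℝ)..x, ((V t 0 1).im + (V t 1 0).im) = 2 * logK V x := by
  have h1 : ∫ t in (0 : ℝ)..x, ((V t 0 1).im + (V t 1 0).im) = ∫ t in (0 : ℝ)..x, 2 * (V t 1 0).im :=
    intervalIntegral.integral_congr_ae (hsymm.mono fun t ht _ => by rw [ht]; ring)
  rw [h1, intervalIntegral.integral_const_mul, logK]
  congr 1
  have hi := (hV.memLinftyLoc_offDiag (by decide : (1 : Fin 2) ≠ 0)).intervalIntegrable 0 x
  exact Complex.imCLM.intervalIntegral_comp_comm hi

theorem Admissible.exists_logK_le (hV : Admissible N V f μ ε ν)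
    (hsymm : ∀ᵐ x, V x 0 1 = V x 1 0) (s : Side) :
    ∃ C, 0 ≤ C ∧ ∀ x, 0 ≤ s.sgn * x → logK V x ≤ ε s * F V x + C := by
  obtain ⟨R, hR, h⟩ := Side.eventually_iff.1 (hV.offDiag_le s)
  obtain ⟨B, hB, hb⟩ := exists_bound_side (h := fun x => logK V x - ε s * F V x)
    (hV.continuous_logK.sub (continuous_const.mul hV.continuous_F)) R
  refine ⟨B, hB, fun x hx => ?_⟩
  rcases le_total R (s.sgn * x) with h1 | h1
  · have := h x h1
    rw [hV.integral_offDiag hsymm] at this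
    linarith
  · have := hb x (by rwa [Side.abs_eq hx])
    linarith [(abs_le.1 this).2]

/-! ### The real part of the phase -/

theorem continuousOn_eikonal (hJ : ∀ i, IsJet N (fun x => V x i i) (J i)) :
    ContinuousOn (eikonal m V lam) (goodSet m V lam) := by
  have := continuousOn_wkbTerm (m := m) (lam := lam) (q := 0) hJ (Nat.zero_le _)
  simpa [wkbTerm, wkbPoly_zero] using this

theorem uIcc_subset_region (hδ : ∀ s, 0 ≤ δ s) (hx : x ∈ region δ) : Set.uIcc 0 x ⊆ region δ :=
  ordConnected_region.uIcc_subset (zero_mem_region hδ) hx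

theorem re_intervalIntegral {h : ℝ → ℂ} {a b : ℝ} (hi : IntervalIntegrable h volume a b) :
    (∫ t in a..b, h t).re = ∫ t in a..b, (h t).re :=
  (Complex.reCLM.intervalIntegral_comp_comm hi).symm

/-- Lower bound for the leading term of the real part of the phase. -/
theorem Admissible.exists_le_re_integral_eikonal (hV : Admissible N V f μ ε ν)
    (hJ : ∀ i, IsJet N (fun x => V x i i) (J i)) (hη0 : 0 < η) (hημ : ∀ s, η < μ s) (m : ℝ)
    (s : Side) : ∃ C, 0 ≤ C ∧ ∀ (lam : ℝ) (δ : Side → EReal), 1 ≤ lam → (∀ s, 0 ≤ δ s) →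
      (∀ x ∈ region δ, PartsLe m V η lam x) → ∀ x ∈ region δ, 0 ≤ s.sgn * x →
      (μ s - η) / Real.sqrt (η ^ 2 + (2 + 2 * η) ^ 2) * F V x - C ≤
        (∫ t in (0 : ℝ)..x, eikonal m V lam t).re := by
  have hη : η < 1 := (hημ s).trans_le (hV.mu_mem s).2
  obtain ⟨c, hc, R1, hR1, h1⟩ := hV.exists_le_imSum s
  obtain ⟨R2, hR2, h2⟩ := Side.eventually_iff.1 (hV.im_ge s)
  set R := max R1 R2 with hR
  have hR0 : 0 < R := lt_max_of_lt_left hR1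
  obtain ⟨B0, hB0, hb0⟩ := exists_bound_side
    (Complex.continuous_im.comp (hV.diag_continuous 0)) R
  obtain ⟨B1, hB1, hb1⟩ := exists_bound_side
    (Complex.continuous_im.comp (hV.diag_continuous 1)) R
  set κ := (μ s - η) / Real.sqrt (η ^ 2 + (2 + 2 * η) ^ 2) with hκ
  have hκ0 : 0 ≤ κ := div_nonneg (by linarith [hημ s]) (Real.sqrt_nonneg _)
  have h1η : 0 < 1 - η := by linarith
  set C := 4 / (1 - η) * (B0 + B1) + κ * (B0 + B1) with hC
  have hC0 : 0 ≤ C := by positivity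
  refine ⟨C * R, by positivity, fun lam δ hlam hδ hP x hx hxs => ?_⟩
  have hmem : ∀ t, 0 ≤ t → t ≤ s.sgn * x → s.sgn * t ∈ region δ := fun t ht htx =>
    mem_region_of_nonneg (s := s) hδ (by rwa [s.sgn_mul_sgn_mul]) (by
      rw [s.sgn_mul_sgn_mul]
      exact (EReal.coe_le_coe_iff.2 htx).trans (hx s))
  have hgood : ∀ t, 0 ≤ t → t ≤ s.sgn * x → s.sgn * t ∈ goodSet m V lam := fun t ht htx =>
    (hP _ (hmem t ht htx)).mem_goodSet hη (by linarith)
  have hi1 : ∀ t, 0 ≤ t → t ≤ s.sgn * x →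
      IntervalIntegrable (fun t => s.sgn * (eikonal m V lam (s.sgn * t)).re) volume 0 t := by
    intro t ht htx
    refine ContinuousOn.intervalIntegrable (continuousOn_const.mul
      (Complex.continuous_re.comp_continuousOn ((continuousOn_eikonal (m := m) (lam := lam)
        hJ).comp (by fun_prop) fun r hr => ?_)))
    rw [Set.uIcc_of_le ht] at hr
    exact hgood r hr.1 (hr.2.trans htx)
  have hc2 : Continuous fun t => κ * (s.sgn * imSum V (s.sgn * t)) :=
    continuous_const.mul (continuous_const.mul (hV.continuous_imSum.comp (by fun_prop)))
  -- The integrand is the oriented difference between `Re Y` and its expected lower bound. Beyond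
  -- `R` it is nonnegative, and before `R` it is bounded uniformly in `λ`.
  have key := neg_mul_le_integral (h := fun t => s.sgn * (eikonal m V lam (s.sgn * t)).re
      - κ * (s.sgn * imSum V (s.sgn * t))) (C := C) (R := R) (y := s.sgn * x) hC0 hR0.le hxs
    (fun t h0 ht => (hi1 t h0 ht).sub (hc2.intervalIntegrable _ _))
    (fun t ht htx htR => by
      have habs : |s.sgn * t| ≤ R := by rwa [s.abs_sgn_mul, abs_of_nonneg ht]
      have e0 := hb0 _ habs
      have e1 := hb1 _ habs
      simp only [Function.comp] at e0 e1
      have e2 := (hP _ (hmem t ht htx)).abs_eikonal_re_le hη0 hη hlam (B := B0 + B1) fun i => by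
        fin_cases i
        · exact e0.trans (by linarith)
        · exact e1.trans (by linarith)
      have e3 : |s.sgn * (eikonal m V lam (s.sgn * t)).re| ≤ 4 / (1 - η) * (B0 + B1) := by
        rwa [s.abs_sgn_mul]
      have e4 : |s.sgn * imSum V (s.sgn * t)| ≤ B0 + B1 := by
        rw [s.abs_sgn_mul]
        exact (abs_add_le _ _).trans (by linarith)
      have e5 := mul_le_mul_of_nonneg_left (abs_le.1 e4).2 hκ0
      linarith [(abs_le.1 e3).1])
    (fun t ht htx => by
      have ht0 : 0 ≤ t := hR0.le.trans ht
      have e1 := h1 (s.sgn * t) (by rw [s.sgn_mul_sgn_mul]; exact (le_max_left _ _).trans ht)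
      have e2 := h2 (s.sgn * t) (by rw [s.sgn_mul_sgn_mul]; exact (le_max_right _ _).trans ht)
      have := (hP _ (hmem t ht0 htx)).le_eikonal_re hη0 hη hlam (hημ s) (hV.mu_mem s).2
        (hc.le.trans e1) e2
      linarith [show κ * (s.sgn * imSum V (s.sgn * t)) ≤ _ from this])
  rw [intervalIntegral.integral_sub (hi1 _ hxs le_rfl) (hc2.intervalIntegrable _ _),
    intervalIntegral.integral_const_mul κ, ← F_side, ← integral_side s
      (fun t => (eikonal m V lam t).re), s.sgn_mul_sgn_mul] at key
  rw [re_intervalIntegral (((continuousOn_eikonal (m := m) (lam := lam) hJ).mono fun t ht =>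
    (hP t (uIcc_subset_region hδ hx ht)).mem_goodSet hη (by linarith)).intervalIntegrable)]
  linarith

theorem Admissible.exists_abs_re_integral_eikonal_le (hV : Admissible N V f μ ε ν)
    (hJ : ∀ i, IsJet N (fun x => V x i i) (J i)) (hη0 : 0 < η) (hη : η < 1) (m R : ℝ) :
    ∃ C, 0 ≤ C ∧ ∀ (lam : ℝ) (δ : Side → EReal), 1 ≤ lam → (∀ s, 0 ≤ δ s) →
      (∀ x ∈ region δ, PartsLe m V η lam x) → ∀ x ∈ region δ, |x| ≤ R →
      |(∫ t in (0 : ℝ)..x, eikonal m V lam t).re| ≤ C := by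
  obtain ⟨B0, hB0, hb0⟩ := exists_bound_side
    (Complex.continuous_im.comp (hV.diag_continuous 0)) R
  obtain ⟨B1, hB1, hb1⟩ := exists_bound_side
    (Complex.continuous_im.comp (hV.diag_continuous 1)) R
  have h1η : 0 < 1 - η := by linarith
  refine ⟨4 / (1 - η) * (B0 + B1) * |R|, by positivity, fun lam δ hlam hδ hP x hx hxR => ?_⟩
  rw [re_intervalIntegral (((continuousOn_eikonal (m := m) (lam := lam) hJ).mono fun t ht =>
    (hP t (uIcc_subset_region hδ hx ht)).mem_goodSet hη (by linarith)).intervalIntegrable),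
    ← Real.norm_eq_abs]
  refine (intervalIntegral.norm_integral_le_of_norm_le_const (C := 4 / (1 - η) * (B0 + B1))
    fun t ht => ?_).trans ?_
  · have ht' := Set.uIoc_subset_uIcc ht
    have habs : |t| ≤ R := by
      have := Set.abs_sub_left_of_mem_uIcc ht'
      simp only [sub_zero] at this
      exact this.trans hxR
    refine (hP t (uIcc_subset_region hδ hx ht')).abs_eikonal_re_le hη0 hη hlam fun i => ?_
    fin_cases i
    · exact (hb0 t habs).trans (by linarith)
    · exact (hb1 t habs).trans (by linarith)
  · rw [sub_zero]
    exact mul_le_mul_of_nonneg_left (hxR.trans (le_abs_self R)) (by positivity)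

/-- A pointwise bound integrated over a growing interval would be useless for this term. It has the
explicit primitive `(log W 0 - log W 1) / 4`, whose real part is bounded because the two factors
have comparable moduli. -/
theorem abs_re_integral_wkbTerm_one_le (hJ : ∀ i, IsJet N (fun x => V x i i) (J i)) (hN : 1 ≤ N)
    (hη0 : 0 < η) (hη : η < 1) (hlam : 1 ≤ lam) (hδ : ∀ s, 0 ≤ δ s)
    (hP : ∀ x ∈ region δ, PartsLe m V η lam x) (hx : x ∈ region δ) :
    |(∫ t in (0 : ℝ)..x, wkbTerm 1 (eikonal m V lam t) (jetVal m V J lam t)).re|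
      ≤ Real.log (sizeConst m η) := by
  have hgood : ∀ t ∈ Set.uIcc 0 x, t ∈ goodSet m V lam := fun t ht =>
    (hP t (uIcc_subset_region hδ hx ht)).mem_goodSet hη (by linarith)
  set g : ℝ → ℂ := fun t => (Complex.log (factor m V lam 0 t) - Complex.log (factor m V lam 1 t)) / 4
    with hg
  have hderiv : ∀ t ∈ Set.uIcc 0 x,
      HasDerivAt g (wkbTerm 1 (eikonal m V lam t) (jetVal m V J lam t)) t := by
    intro t ht
    have hj : JetAt J 0 t := jetAt_of_lt hJ (by omega) t
    have hl : ∀ i, HasDerivAt (fun y => Complex.log (factor m V lam i y))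
        (jetVal m V J lam t i 1) t := fun i =>
      (hasDerivAt_factor hJ hj i).clog_real (factor_mem_slitPlane (hgood t ht) i)
    refine (((hl 0).sub (hl 1)).div_const 4).congr_deriv ?_
    simp [wkbTerm, wkbPoly_one]
  have hint : IntervalIntegrable (fun t => wkbTerm 1 (eikonal m V lam t) (jetVal m V J lam t))
      volume 0 x := ((continuousOn_wkbTerm hJ hN).mono hgood).intervalIntegrable
  rw [intervalIntegral.integral_eq_sub_of_hasDerivAt hderiv hint]
  have hre : ∀ t ∈ region δ, |(g t).re| ≤ Real.log (sizeConst m η) / 4 := by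
    intro t ht
    have hp := hP t ht
    have hpos : ∀ i, 0 < ‖factor m V lam i t‖ := fun i =>
      norm_pos_iff.2 (factor_ne_zero (hp.mem_goodSet hη (by linarith)) i)
    have hK : 0 < sizeConst m η := zero_lt_one.trans_le (one_le_sizeConst hη)
    have h1 : ∀ i j, Real.log ‖factor m V lam i t‖ - Real.log ‖factor m V lam j t‖
        ≤ Real.log (sizeConst m η) := fun i j => by
      rw [sub_le_iff_le_add, ← Real.log_mul hK.ne' (hpos j).ne']
      exact Real.log_le_log (hpos i) (hp.norm_factor_le' hη0 hη hlam i j)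
    have e : (g t).re = (Real.log ‖factor m V lam 0 t‖ - Real.log ‖factor m V lam 1 t‖) / 4 := by
      simp only [hg]
      rw [show (4 : ℂ) = ((4 : ℝ) : ℂ) by norm_num, Complex.div_ofReal_re, Complex.sub_re,
        Complex.log_re, Complex.log_re]
    rw [e, abs_le]
    constructor <;> linarith [h1 0 1, h1 1 0]
  have hlog : 0 ≤ Real.log (sizeConst m η) := Real.log_nonneg (one_le_sizeConst hη)
  rw [Complex.sub_re]
  refine (abs_sub _ _).trans ?_
  linarith [hre x hx, hre 0 (zero_mem_region hδ)]

end DiracWKB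

/-! ### Exponential decay of the amplitude with constants uniform in `λ`. -/

namespace DiracWKB

variable {m : ℝ} {N : ℕ} {V : ℝ → Matrix (Fin 2) (Fin 2) ℂ} {f : ℝ → ℝ} {μ ε ν : Side → ℝ}
  {η ε₁ lam : ℝ} {J : Fin 2 → ℕ → ℝ → ℂ} {x : ℝ} {δ : Side → EReal}

/-! ### Decay of the amplitude -/

/-- The first correction contributes a bounded amount and each later one at most `B |x|`, where `B`
will be a small multiple of `λ^(-ε₁)`-type bounds tending to zero. -/
theorem abs_re_phase_sub_le (hJ : ∀ i, IsJet N (fun x => V x i i) (J i)) (hk : k₁ V = k₂ V)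
    (hη0 : 0 < η) (hη : η < 1) (hlam : 1 ≤ lam) (hδ : ∀ s, 0 ≤ δ s)
    (hP : ∀ x ∈ region δ, PartsLe m V η lam x) {B : ℝ} (hB : 0 ≤ B)
    (hb : ∀ᵐ x, x ∈ openRegion δ → ∀ q, 2 ≤ q → q ≤ N →
      ‖wkbTerm q (eikonal m V lam x) (jetVal m V J lam x)‖ ≤ B) (hx : x ∈ region δ) :
    |(phase m V N lam x).re - (∫ t in (0 : ℝ)..x, eikonal m V lam t).re|
      ≤ Real.log (sizeConst m η) + N * (B * |x|) := by
  have hgood : region δ ⊆ goodSet m V lam := fun t ht => (hP t ht).mem_goodSet hη (by linarith)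
  have hcore := region_subset_core hδ hgood
  have hlog : 0 ≤ Real.log (sizeConst m η) := Real.log_nonneg (one_le_sizeConst hη)
  have hBx : 0 ≤ B * |x| := by positivity
  rw [phase_eq hJ hk (by linarith) (hcore (zero_mem_region hδ)) (hcore hx),
    Finset.sum_range_succ']
  simp only [wkbTerm, wkbPoly_zero, Nat.cast_zero, sub_zero, zpow_one, mul_one]
  rw [Complex.add_re, add_sub_cancel_right, Complex.re_sum]
  refine (Finset.abs_sum_le_sum_abs _ _).trans ?_
  have hle : ∀ q ∈ Finset.range N, |(∫ t in (0 : ℝ)..x,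
      wkbTerm (q + 1) (eikonal m V lam t) (jetVal m V J lam t)).re|
        ≤ (if q = 0 then Real.log (sizeConst m η) else 0) + B * |x| := by
    intro q hq
    have hqN := Finset.mem_range.1 hq
    split_ifs with h0
    · subst h0
      have := abs_re_integral_wkbTerm_one_le (m := m) hJ (by omega) hη0 hη hlam hδ hP hx
      linarith
    · rw [zero_add]
      refine (Complex.abs_re_le_norm _).trans ?_
      have := intervalIntegral.norm_integral_le_of_norm_le_const_ae (a := 0) (b := x) (C := B)
        (f := fun t => wkbTerm (q + 1) (eikonal m V lam t) (jetVal m V J lam t)) (by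
          filter_upwards [hb, ae_mem_openRegion δ] with t ht ht' hmem
          exact ht (ht' (uIcc_subset_region hδ hx (Set.uIoc_subset_uIcc hmem))) _
            (by omega) (by omega))
      simpa using this
  refine (Finset.sum_le_sum hle).trans ?_
  rw [Finset.sum_add_distrib, Finset.sum_const, Finset.card_range, nsmul_eq_mul]
  refine add_le_add ?_ le_rfl
  rw [Finset.sum_ite_eq' (Finset.range N) 0]
  split_ifs <;> linarith

/-- The amplitude `k₁ exp (-P)`. -/
def amplitude (m : ℝ) (V : ℝ → Matrix (Fin 2) (Fin 2) ℂ) (N : ℕ) (lam x : ℝ) : ℂ :=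
  k₁ V x * Complex.exp (-phase m V N lam x)

/-- The data of the construction at a fixed value of `lam`, with all bounds which do not depend on
`lam`. -/
structure WKBData (m : ℝ) (N : ℕ) (V : ℝ → Matrix (Fin 2) (Fin 2) ℂ) (J : Fin 2 → ℕ → ℝ → ℂ)
    (η ε₁ c b C : ℝ) (δ : Side → EReal) (Δ r : Side → ℝ) (lam : ℝ) (ξ : ℝ → ℝ) : Prop where
  jet : ∀ i, IsJet N (fun x => V x i i) (J i)
  k_eq : k₁ V = k₂ V
  eta_lt : η < 1
  const_nonneg : 0 ≤ C
  one_le : 1 ≤ lam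
  two_lt : ∀ s, 2 < δ s
  width_eq : ∀ s, (δ s = ⊤ ∧ Δ s = 0) ∨ ∃ d : ℝ, δ s = d ∧ Δ s = d⁻¹
  rate_nonneg : ∀ s, 0 ≤ r s
  parts_le : ∀ x ∈ region δ, PartsLe m V η lam x
  expansion : ∀ᵐ x, x ∈ openRegion δ → ∀ s, 0 ≤ s.sgn * x → ExpansionBound m N V J ε₁ lam C (r s) x
  decay : ∀ s : Side, ∀ x ∈ region δ, 0 ≤ s.sgn * x →
    ‖amplitude m V N lam x‖ ≤ C * Real.exp (-c * F V x)
  lower : ∀ x, |x| ≤ 1 → b ≤ ‖amplitude m V N lam x‖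
  cutoff : IsCutoffAt δ Δ C ξ

theorem mem_region_of_abs_le {R : ℝ} (hδ : ∀ s, (R : EReal) < δ s) (hx : |x| ≤ R) :
    x ∈ region δ := fun s =>
  (EReal.coe_le_coe_iff.2 ((s.sgn_mul_le_abs x).trans hx)).trans (hδ s).le

/-- Decay of the amplitude towards one end. -/
theorem Admissible.exists_amplitude_le (hV : Admissible N V f μ ε ν)
    (hsymm : ∀ᵐ x, V x 0 1 = V x 1 0) (hJ : ∀ i, IsJet N (fun x => V x i i) (J i))
    (hη0 : 0 < η) (hημ : ∀ s, η < μ s)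
    (hηε : ∀ s, ε s < (μ s - η) / Real.sqrt (η ^ 2 + (2 + 2 * η) ^ 2)) (m : ℝ) (s : Side) :
    ∃ c > 0, ∃ b > 0, ∃ C, 0 ≤ C ∧ ∀ (lam B : ℝ) (δ : Side → EReal), 1 ≤ lam → (∀ s, 0 ≤ δ s) →
      (∀ x ∈ region δ, PartsLe m V η lam x) → 0 ≤ B → B ≤ b →
      (∀ᵐ x, x ∈ openRegion δ → ∀ q, 2 ≤ q → q ≤ N →
        ‖wkbTerm q (eikonal m V lam x) (jetVal m V J lam x)‖ ≤ B) →
      ∀ x ∈ region δ, 0 ≤ s.sgn * x → logK V x - (phase m V N lam x).re ≤ C - c * F V x := by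
  have hη : η < 1 := (hημ s).trans_le (hV.mu_mem s).2
  obtain ⟨C1, hC1, h1⟩ := hV.exists_le_re_integral_eikonal hJ hη0 hημ m s
  obtain ⟨C2, hC2, h2⟩ := hV.exists_logK_le hsymm s
  obtain ⟨c3, hc3, C3, hC3, h3⟩ := hV.exists_le_F s
  set κ := (μ s - η) / Real.sqrt (η ^ 2 + (2 + 2 * η) ^ 2) with hκ
  set L := Real.log (sizeConst m η)
  have hg : 0 < κ - ε s := by linarith [hηε s]
  -- With this threshold the corrections, at most `N b |x|`, consume no more than half of the gap `κ
  -- - ε` times `F`; the other half remains as decay rate.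
  set b := (κ - ε s) / 2 * c3 / (N + 1) with hb
  have hN : (0 : ℝ) < N + 1 := by positivity
  refine ⟨(κ - ε s) / 2, by positivity, b, by positivity,
    C1 + C2 + |L| + (κ - ε s) / 2 * C3, by positivity,
    fun lam B δ hlam hδ hP hB hBb hbd x hx hxs => ?_⟩
  have e1 := h1 lam δ hlam hδ hP x hx hxs
  have e2 := h2 x hxs
  have e3 := h3 x hxs
  have e4 := abs_re_phase_sub_le hJ (k₁_eq_k₂ hsymm) hη0 hη hlam hδ hP hB hbd hx
  rw [Side.abs_eq hxs] at e4
  have e5 : N * (B * (s.sgn * x)) ≤ (κ - ε s) / 2 * (F V x + C3) := by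
    calc (N : ℝ) * (B * (s.sgn * x)) ≤ (N + 1) * (b * (s.sgn * x)) := by
          gcongr
          linarith
      _ = (κ - ε s) / 2 * (c3 * (s.sgn * x)) := by
          rw [hb]
          field_simp
      _ ≤ _ := by gcongr
  have e6 := (abs_le.1 e4).1
  have e7 : L ≤ |L| := le_abs_self L
  linarith

theorem Admissible.exists_le_amplitude (hV : Admissible N V f μ ε ν)
    (hsymm : ∀ᵐ x, V x 0 1 = V x 1 0) (hJ : ∀ i, IsJet N (fun x => V x i i) (J i))
    (hη0 : 0 < η) (hη : η < 1) (m R : ℝ) :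
    ∃ C, 0 ≤ C ∧ ∀ (lam B : ℝ) (δ : Side → EReal), 1 ≤ lam → (∀ s, 0 ≤ δ s) →
      (∀ x ∈ region δ, PartsLe m V η lam x) → 0 ≤ B → B ≤ 1 →
      (∀ᵐ x, x ∈ openRegion δ → ∀ q, 2 ≤ q → q ≤ N →
        ‖wkbTerm q (eikonal m V lam x) (jetVal m V J lam x)‖ ≤ B) →
      ∀ x ∈ region δ, |x| ≤ R → -C ≤ logK V x - (phase m V N lam x).re := by
  obtain ⟨C1, hC1, h1⟩ := hV.exists_abs_re_integral_eikonal_le hJ hη0 hη m R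
  obtain ⟨C2, hC2, h2⟩ := exists_bound_side hV.continuous_logK R
  set L := Real.log (sizeConst m η)
  refine ⟨C1 + C2 + |L| + N * |R|, by positivity, fun lam B δ hlam hδ hP hB hB1 hbd x hx hxR => ?_⟩
  have e1 := (abs_le.1 (h1 lam δ hlam hδ hP x hx hxR)).2
  have e2 := (abs_le.1 (h2 x hxR)).1
  have e4 := (abs_le.1 (abs_re_phase_sub_le hJ (k₁_eq_k₂ hsymm) hη0 hη hlam hδ hP hB hbd hx)).2
  have e5 : (N : ℝ) * (B * |x|) ≤ N * |R| := by
    have : B * |x| ≤ 1 * |R| := mul_le_mul hB1 (hxR.trans (le_abs_self R)) (abs_nonneg _) zero_le_one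
    rw [one_mul] at this
    gcongr
  have e7 : L ≤ |L| := le_abs_self L
  linarith

theorem cutWidth_cases {s : Side} (h : ¬ NoCut V ν s → cutRadius m V f ν η ε₁ s lam < ⊤)
    (hlam : 0 < lam) (h2 : (0 : EReal) < cutRadius m V f ν η ε₁ s lam) :
    (cutRadius m V f ν η ε₁ s lam = ⊤ ∧ cutWidth m V f ν η ε₁ s lam = 0) ∨
      ∃ d : ℝ, cutRadius m V f ν η ε₁ s lam = d ∧ cutWidth m V f ν η ε₁ s lam = d⁻¹ := by
  by_cases hn : NoCut V ν s
  · exact Or.inl ⟨cutRadius_eq_top hn m f η ε₁ hlam, by simp [cutWidth, hn]⟩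
  · refine Or.inr ⟨(cutRadius m V f ν η ε₁ s lam).toReal, ?_, by simp [cutWidth, hn]⟩
    rw [EReal.coe_toReal (h hn).ne (ne_bot_of_gt h2)]

/-- For large `lam` all bounds hold with uniform constants. -/
theorem Admissible.exists_wkbData (hV : Admissible N V f μ ε ν)
    (hsymm : ∀ᵐ x, V x 0 1 = V x 1 0) (hJ : ∀ i, IsJet N (fun x => V x i i) (J i))
    (hη0 : 0 < η) (hημ : ∀ s, η < μ s)
    (hηε : ∀ s, ε s < (μ s - η) / Real.sqrt (η ^ 2 + (2 + 2 * η) ^ 2))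
    (hε₁ : 0 < ε₁) (hε₁' : ε₁ < 1) {ξ : ℝ → ℝ → ℝ} (hξ : IsCutoffFamily m V f ν η ε₁ ξ) :
    ∃ a₀ > 0, ∀ a : Side → ℝ, (∀ s, a₀ ≤ a s) →
      (∀ s, ν s ≤ 0 → ∀ᶠ lam in atTop, BddAbove (growthSet m V f ν η ε₁ N s (a s) lam)) ∧
      ∃ c > 0, ∃ b > 0, ∃ C, ∀ᶠ lam in atTop,
        WKBData m N V J η ε₁ c b C (rad m V f ν η ε₁ lam)
          (fun s => cutWidth m V f ν η ε₁ s lam)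
          (fun s => rate m N V f ν η ε₁ s (a s) lam) lam (ξ lam) := by
  have hη : η < 1 := (hημ .plus).trans_le (hV.mu_mem .plus).2
  obtain ⟨a₀, ha₀, H⟩ := hV.exists_expansionBound hJ hη0 hη hε₁ hε₁' m
  refine ⟨a₀, ha₀, fun a ha => ⟨(H a ha).1, ?_⟩⟩
  obtain ⟨C0, hC0, hexp⟩ := (H a ha).2
  choose cs hcs bs hbs Cs hCs hdec using hV.exists_amplitude_le hsymm hJ hη0 hημ hηε m
  obtain ⟨C1, hC1, hlow⟩ := hV.exists_le_amplitude hsymm hJ hη0 hη m 1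
  obtain ⟨C2, hcut⟩ := hξ
  have hFl : ∀ s : Side, ∃ C, 0 ≤ C ∧ ∀ x, 0 ≤ s.sgn * x → 0 ≤ F V x + C := fun s => by
    obtain ⟨c, hc, C, hC, h⟩ := hV.exists_le_F s
    exact ⟨C, hC, fun x hx => (mul_nonneg hc.le hx).trans (h x hx)⟩
  choose Fs hFs hF using hFl
  set c := min (cs .minus) (cs .plus) with hc
  have hc0 : 0 < c := lt_min (hcs _) (hcs _)
  have hcle : ∀ s, c ≤ cs s := fun s => by
    cases s
    exacts [min_le_left _ _, min_le_right _ _]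
  -- One constant for both ends. The exponential summands absorb the additive constants of the decay
  -- estimate and the possible negativity of `F` near the origin.
  set Ct := C0 + C1 + |C2| + ∑ s : Bool, Real.exp (Cs (cond s .plus .minus)
    + cs (cond s .plus .minus) * Fs (cond s .plus .minus)) with hCt
  have hsum : ∀ s, Real.exp (Cs s + cs s * Fs s) ≤ Ct := fun s => by
    rw [hCt, Fintype.sum_bool]
    simp only [cond_true, cond_false]
    have h1 := (Real.exp_pos (Cs .minus + cs .minus * Fs .minus)).le
    have h2 := (Real.exp_pos (Cs .plus + cs .plus * Fs .plus)).le
    have h3 := abs_nonneg C2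
    cases s <;> linarith
  have hCt0 : 0 ≤ Ct := (Real.exp_pos _).le.trans (hsum .plus)
  have hC0t : C0 ≤ Ct := by
    rw [hCt]
    have := abs_nonneg C2
    have h : 0 ≤ ∑ s : Bool, Real.exp (Cs (cond s .plus .minus)
      + cs (cond s .plus .minus) * Fs (cond s .plus .minus)) :=
      Finset.sum_nonneg fun _ _ => (Real.exp_pos _).le
    linarith
  have hC2t : C2 ≤ Ct := by
    rw [hCt]
    have := le_abs_self C2
    have h : 0 ≤ ∑ s : Bool, Real.exp (Cs (cond s .plus .minus)
      + cs (cond s .plus .minus) * Fs (cond s .plus .minus)) :=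
      Finset.sum_nonneg fun _ _ => (Real.exp_pos _).le
    linarith
  refine ⟨c, hc0, Real.exp (-C1), Real.exp_pos _, Ct, ?_⟩
  have hsmall : ∀ t : ℝ, 0 < t → ∀ᶠ lam : ℝ in atTop, C0 * lam ^ (-ε₁) ≤ t := fun t ht => by
    have h := (tendsto_rpow_neg_atTop hε₁).const_mul C0
    rw [mul_zero] at h
    exact (h.eventually (gt_mem_nhds ht)).mono fun _ h => h.le
  have hrad : ∀ᶠ lam in atTop, ∀ s, (2 : EReal) < cutRadius m V f ν η ε₁ s lam :=
    forall_side_eventually.2 fun s => by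
      have := hV.eventually_lt_cutRadius hε₁' m η 2 s
      exact_mod_cast this
  have htop : ∀ᶠ lam in atTop, ∀ s, ¬ NoCut V ν s → cutRadius m V f ν η ε₁ s lam < ⊤ :=
    forall_side_eventually.2 fun s => by
      by_cases h : NoCut V ν s
      · exact Eventually.of_forall fun _ h' => absurd h h'
      · exact (hV.cutRadius_lt_top hη0 hε₁' h m).mono fun _ h _ => h
  filter_upwards [hexp, hcut, hV.eventually_partsLe hη0 hε₁' m, hrad, htop,
    forall_side_eventually.2 fun s => hsmall (bs s) (hbs s), hsmall 1 one_pos]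
    with lam h1 h2 ⟨h3, h4, h5⟩ h6 h7 h8 h9
  have hB0 : 0 ≤ C0 * lam ^ (-ε₁) := by positivity
  have hterm : ∀ᵐ x, x ∈ openRegion (rad m V f ν η ε₁ lam) → ∀ q, 2 ≤ q → q ≤ N →
      ‖wkbTerm q (eikonal m V lam x) (jetVal m V J lam x)‖ ≤ C0 * lam ^ (-ε₁) := by
    filter_upwards [h1] with x hx hxr
    obtain ⟨s, hs⟩ := Side.exists_nonneg x
    exact (hx hxr s hs).term_le
  refine ⟨hJ, k₁_eq_k₂ hsymm, hη, hCt0, h3, h6,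
    fun s => cutWidth_cases (h7 s) (by linarith) (lt_trans (by norm_num) (h6 s)),
    fun s => rate_nonneg hε₁' h3 m V f ν η s (a s), h5, ?_, ?_, ?_, ?_⟩
  · filter_upwards [h1] with x hx hxr s hs
    have hb := hx hxr s hs
    have hr := rate_nonneg (N := N) hε₁' h3 m V f ν η s (a s)
    have hl : 0 ≤ lam := by linarith
    exact ⟨hb.1.trans (by gcongr), fun q h4 h5 => (hb.2 q h4 h5).trans (by gcongr),
      hb.3.trans (by gcongr), hb.4.trans (by gcongr)⟩
  · intro s x hx hs
    rw [amplitude, norm_k₁_mul_exp]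
    have e1 := hdec s lam _ _ h3 h4 h5 hB0 (h8 s) hterm x hx hs
    have e2 := hF s x hs
    -- `F` may be negative near the origin, so replacing the rate `cs s` by the smaller `c` needs
    -- the shift by `Fs s`.
    have e3 : 0 ≤ (cs s - c) * (F V x + Fs s) := mul_nonneg (by linarith [hcle s]) e2
    have e4 : 0 ≤ c * Fs s := mul_nonneg hc0.le (hFs s)
    refine le_trans ?_ (mul_le_mul_of_nonneg_right (hsum s) (Real.exp_pos _).le)
    rw [← Real.exp_add]
    refine Real.exp_le_exp.2 ?_
    nlinarith
  · intro x hx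
    rw [amplitude, norm_k₁_mul_exp]
    refine Real.exp_le_exp.2 (hlow lam _ _ h3 h4 h5 hB0 h9 hterm x ?_ hx)
    exact mem_region_of_abs_le (R := 2) (fun s => by exact_mod_cast h6 s) (by linarith)
  · exact ⟨h2.1, h2.2, h2.3, h2.4, fun s j hj x hx => (h2.5 s j hj x hx).trans hC2t⟩

end DiracWKB

/-! ### The components of the pseudomode and the exact formula for the residual. -/

namespace DiracWKB

variable {m : ℝ} {N : ℕ} {V : ℝ → Matrix (Fin 2) (Fin 2) ℂ}
  {η ε₁ lam c b C : ℝ} {J : Fin 2 → ℕ → ℝ → ℂ} {x : ℝ} {δ : Side → EReal} {Δ r : Side → ℝ}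
  {ξ : ℝ → ℝ}

/-! ### The components of the pseudomode -/

/-- The first component of the pseudomode. -/
def upperComp (m : ℝ) (V : ℝ → Matrix (Fin 2) (Fin 2) ℂ) (N : ℕ) (lam : ℝ) (ξ : ℝ → ℝ) (x : ℝ) : ℂ :=
  amplitude m V N lam x * ξ x

/-- The second component of the pseudomode. -/
def lowerComp (m : ℝ) (V : ℝ → Matrix (Fin 2) (Fin 2) ℂ) (J : Fin 2 → ℕ → ℝ → ℂ) (N : ℕ) (lam : ℝ)
    (ξ : ℝ → ℝ) (x : ℝ) : ℂ :=
  amplitude m V N lam x * (-Complex.I * (deriv ξ x - ξ x * phaseDeriv N m V J lam x)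
    / factor m V lam 1 x)

/-- The difference of `H_V Ψ` and `lam Ψ`. -/
def residual (m : ℝ) (V : ℝ → Matrix (Fin 2) (Fin 2) ℂ) (J : Fin 2 → ℕ → ℝ → ℂ) (N : ℕ) (lam : ℝ)
    (ξ : ℝ → ℝ) (x : ℝ) : ℂ :=
  -Complex.I * deriv (lowerComp m V J N lam ξ) x + V x 0 1 * lowerComp m V J N lam ξ x
    - factor m V lam 0 x * upperComp m V N lam ξ x

namespace WKBData

theorem lam_pos (h : WKBData m N V J η ε₁ c b C δ Δ r lam ξ) : 0 < lam := by
  linarith [h.one_le]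

theorem rad_nonneg (h : WKBData m N V J η ε₁ c b C δ Δ r lam ξ) (s : Side) : 0 ≤ δ s :=
  le_trans (by norm_num) (h.two_lt s).le

theorem mem_goodSet (h : WKBData m N V J η ε₁ c b C δ Δ r lam ξ) (hx : x ∈ region δ) :
    x ∈ goodSet m V lam := (h.parts_le x hx).mem_goodSet h.eta_lt h.lam_pos

theorem mem_core (h : WKBData m N V J η ε₁ c b C δ Δ r lam ξ) (hx : x ∈ region δ) :
    x ∈ core m V lam := region_subset_core h.rad_nonneg (fun _ => h.mem_goodSet) hx

theorem zero_mem_core (h : WKBData m N V J η ε₁ c b C δ Δ r lam ξ) : (0 : ℝ) ∈ core m V lam :=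
  h.mem_core (zero_mem_region h.rad_nonneg)

theorem factor_ne (h : WKBData m N V J η ε₁ c b C δ Δ r lam ξ) (hx : x ∈ region δ) (i : Fin 2) :
    factor m V lam i x ≠ 0 := factor_ne_zero (h.mem_goodSet hx) i

theorem cutoff_eq_zero (h : WKBData m N V J η ε₁ c b C δ Δ r lam ξ) (hx : x ∉ region δ) :
    ξ x = 0 := by
  refine h.cutoff.eq_zero x ?_
  by_contra hc
  push Not at hc
  exact hx fun s => (hc s).le

theorem eventually_notMem (_h : WKBData m N V J η ε₁ c b C δ Δ r lam ξ)
    (hx : x ∉ region δ) : ∀ᶠ y in 𝓝 x, y ∉ region δ :=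
  isClosed_region.isOpen_compl.mem_nhds hx

theorem iteratedDeriv_eq_zero (h : WKBData m N V J η ε₁ c b C δ Δ r lam ξ) (hx : x ∉ region δ)
    (j : ℕ) : iteratedDeriv j ξ x = 0 := by
  have h0 : ξ =ᶠ[𝓝 x] fun _ => 0 :=
    (h.eventually_notMem hx).mono fun y hy => h.cutoff_eq_zero hy
  rw [h0.iteratedDeriv_eq, iteratedDeriv_fun_const_zero]

theorem deriv_eq_zero (h : WKBData m N V J η ε₁ c b C δ Δ r lam ξ) (hx : x ∉ region δ) :
    deriv ξ x = 0 := by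
  rw [← iteratedDeriv_one]
  exact h.iteratedDeriv_eq_zero hx 1

theorem contDiff_deriv (h : WKBData m N V J η ε₁ c b C δ Δ r lam ξ) : ContDiff ℝ ∞ (deriv ξ) :=
  (contDiff_infty_iff_deriv.1 h.cutoff.smooth).2

theorem hasDerivAt_cutoff (h : WKBData m N V J η ε₁ c b C δ Δ r lam ξ) (x : ℝ) :
    HasDerivAt (fun y => (ξ y : ℂ)) (deriv ξ x : ℝ) x :=
  ((h.cutoff.smooth.differentiable (by simp)) x).hasDerivAt.ofReal_comp

theorem hasDerivAt_deriv_cutoff (h : WKBData m N V J η ε₁ c b C δ Δ r lam ξ) (x : ℝ) :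
    HasDerivAt (fun y => ((deriv ξ y : ℝ) : ℂ)) (iteratedDeriv 2 ξ x : ℝ) x := by
  rw [iteratedDeriv_succ, iteratedDeriv_one]
  exact ((h.contDiff_deriv.differentiable (by simp)) x).hasDerivAt.ofReal_comp

/-- A function which vanishes off the support of the cut-off is regular if it is so in
a neighbourhood of that support. -/
theorem lipAt_of_core (h : WKBData m N V J η ε₁ c b C δ Δ r lam ξ) {g : ℝ → ℂ}
    (hg : ∀ x ∈ core m V lam, LipAt g x) (h0 : ∀ x, x ∉ region δ → g x = 0) (x : ℝ) :
    LipAt g x := by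
  by_cases hx : x ∈ region δ
  · exact hg x (h.mem_core hx)
  · exact (lipAt_const (0 : ℂ) x).congr ((h.eventually_notMem hx).mono fun y hy => h0 y hy)

theorem lipAt_k₁ (hV : MemLinftyLoc fun x => V x 1 0) (x : ℝ) : LipAt (k₁ V) x :=
  ((lipAt_const (-Complex.I) x).mul (hV.lipAt_primitive x)).cexp

theorem lipAt_amplitude (h : WKBData m N V J η ε₁ c b C δ Δ r lam ξ)
    (hV : MemLinftyLoc fun x => V x 1 0) (hx : x ∈ core m V lam) :
    LipAt (amplitude m V N lam) x :=
  (lipAt_k₁ hV x).mul (lipAt_phase h.jet h.k_eq h.lam_pos h.zero_mem_core hx).neg.cexp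

theorem lipAt_upperComp (h : WKBData m N V J η ε₁ c b C δ Δ r lam ξ)
    (hV : MemLinftyLoc fun x => V x 1 0) (x : ℝ) : LipAt (upperComp m V N lam ξ) x := by
  refine h.lipAt_of_core (fun x hx => (h.lipAt_amplitude hV hx).mul
    (lipAt_of_contDiffAt (h.cutoff.smooth.of_le (by simp)).contDiffAt).ofReal) (fun x hx => ?_) x
  simp [h.cutoff_eq_zero hx]

theorem lipAt_lowerComp (h : WKBData m N V J η ε₁ c b C δ Δ r lam ξ)
    (hV : MemLinftyLoc fun x => V x 1 0) (x : ℝ) : LipAt (lowerComp m V J N lam ξ) x := by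
  refine h.lipAt_of_core (fun x hx => (h.lipAt_amplitude hV hx).mul ?_) (fun x hx => ?_) x
  · have hc := core_subset hx
    have h1 : LipAt (fun y => ((deriv ξ y : ℝ) : ℂ) - ξ y * phaseDeriv N m V J lam y) x :=
      (lipAt_of_contDiffAt (h.contDiff_deriv.of_le (by simp)).contDiffAt).ofReal.sub
        ((lipAt_of_contDiffAt (h.cutoff.smooth.of_le (by simp)).contDiffAt).ofReal.mul
          (lipAt_phaseDeriv h.jet hc))
    exact (((lipAt_const (-Complex.I) x).mul h1).mul
      ((lipAt_factor h.jet 1).inv (factor_ne_zero hc 1))).congr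
        (Eventually.of_forall fun y => div_eq_mul_inv _ _)
  · simp [h.cutoff_eq_zero hx, h.deriv_eq_zero hx]

theorem deriv_phase (h : WKBData m N V J η ε₁ c b C δ Δ r lam ξ) (hx : x ∈ region δ) :
    deriv (phase m V N lam) x = phaseDeriv N m V J lam x :=
  (hasDerivAt_phase h.jet h.k_eq h.lam_pos h.zero_mem_core (h.mem_core hx)).deriv

theorem deriv_cutoff_mul_exp (h : WKBData m N V J η ε₁ c b C δ Δ r lam ξ) (x : ℝ) :
    deriv (fun y => (ξ y : ℂ) * Complex.exp (-phase m V N lam y)) x =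
      Complex.exp (-phase m V N lam x) * (deriv ξ x - ξ x * phaseDeriv N m V J lam x) := by
  by_cases hx : x ∈ region δ
  · have h1 := (hasDerivAt_phase h.jet h.k_eq h.lam_pos h.zero_mem_core (h.mem_core hx)).fun_neg.cexp
    rw [((h.hasDerivAt_cutoff x).fun_mul h1).deriv]
    ring
  · have h0 : (fun y => (ξ y : ℂ) * Complex.exp (-phase m V N lam y)) =ᶠ[𝓝 x] fun _ => 0 :=
      (h.eventually_notMem hx).mono fun y hy => by simp [h.cutoff_eq_zero hy]
    rw [h0.deriv_eq]
    simp [h.cutoff_eq_zero hx, h.deriv_eq_zero hx]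

theorem pseudomode_eq {ξ : ℝ → ℝ → ℝ} (h : WKBData m N V J η ε₁ c b C δ Δ r lam (ξ lam)) (x : ℝ) :
    pseudomode m V N ξ lam x = !₂[upperComp m V N lam (ξ lam) x, lowerComp m V J N lam (ξ lam) x] := by
  have h1 : k₁ V x * uFun m V N ξ lam x = upperComp m V N lam (ξ lam) x := by
    simp only [uFun, upperComp, amplitude]
    ring
  have h2 : k₂ V x * vFun m V N ξ lam x = lowerComp m V J N lam (ξ lam) x := by
    have hu : deriv (uFun m V N ξ lam) x = _ := h.deriv_cutoff_mul_exp x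
    rw [vFun, hu, ← h.k_eq, div_self (k₁_ne_zero V x), den_eq_factor, lowerComp, amplitude]
    ring
  rw [pseudomode, h1, h2]

theorem ae_hasDerivAt_k₁ (hV : MemLinftyLoc fun x => V x 1 0) :
    ∀ᵐ x, HasDerivAt (k₁ V) (k₁ V x * (-Complex.I * V x 1 0)) x := by
  filter_upwards [hV.ae_hasDerivAt_primitive] with x hx
  exact (hx.const_mul (-Complex.I)).cexp

theorem ae_hasDerivAt_amplitude (h : WKBData m N V J η ε₁ c b C δ Δ r lam ξ)
    (hV : MemLinftyLoc fun x => V x 1 0) : ∀ᵐ x, x ∈ region δ →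
      HasDerivAt (amplitude m V N lam) (amplitude m V N lam x *
        (-Complex.I * V x 1 0 - phaseDeriv N m V J lam x)) x := by
  filter_upwards [ae_hasDerivAt_k₁ hV] with x hx hxr
  have h1 := (hasDerivAt_phase h.jet h.k_eq h.lam_pos h.zero_mem_core (h.mem_core hxr)).fun_neg.cexp
  refine (hx.mul h1).congr_deriv ?_
  simp only [amplitude]
  ring

/-- This is the second row of the eigenvalue equation, solved for the derivative. It holds without
error, so the whole residual sits in the first row. -/
theorem ae_hasDerivAt_upperComp (h : WKBData m N V J η ε₁ c b C δ Δ r lam ξ)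
    (hV : MemLinftyLoc fun x => V x 1 0) : ∀ᵐ x, HasDerivAt (upperComp m V N lam ξ)
      (-Complex.I * V x 1 0 * upperComp m V N lam ξ x
        + Complex.I * factor m V lam 1 x * lowerComp m V J N lam ξ x) x := by
  filter_upwards [h.ae_hasDerivAt_amplitude hV] with x hx
  by_cases hxr : x ∈ region δ
  · refine ((hx hxr).mul (h.hasDerivAt_cutoff x)).congr_deriv ?_
    have h1 := h.factor_ne hxr 1
    simp only [upperComp, lowerComp]
    field_simp
    linear_combination ((amplitude m V N lam x *
      ((deriv ξ x : ℝ) - ξ x * phaseDeriv N m V J lam x))) * Complex.I_sq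
  · have h0 : upperComp m V N lam ξ =ᶠ[𝓝 x] fun _ => 0 :=
      (h.eventually_notMem hxr).mono fun y hy => by simp [upperComp, h.cutoff_eq_zero hy]
    refine ((hasDerivAt_const x (0 : ℂ)).congr_of_eventuallyEq h0).congr_deriv ?_
    simp [upperComp, lowerComp, h.cutoff_eq_zero hxr, h.deriv_eq_zero hxr]

theorem ae_differentiableAt_lowerComp (h : WKBData m N V J η ε₁ c b C δ Δ r lam ξ)
    (hV : MemLinftyLoc fun x => V x 1 0) :
    ∀ᵐ x, DifferentiableAt ℝ (lowerComp m V J N lam ξ) x := by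
  filter_upwards [h.ae_hasDerivAt_amplitude hV, ae_jetAt h.jet] with x hx hj
  by_cases hxr : x ∈ region δ
  · exact ((hx hxr).mul ((((h.hasDerivAt_deriv_cutoff x).sub ((h.hasDerivAt_cutoff x).mul
      (hasDerivAt_phaseDeriv h.jet hj (h.mem_goodSet hxr)))).const_mul (-Complex.I)).div
        (hasDerivAt_factor h.jet (hj.mono (Nat.zero_le _)) 1)
        (h.factor_ne hxr 1))).differentiableAt
  · have h0 : lowerComp m V J N lam ξ =ᶠ[𝓝 x] fun _ => 0 :=
      (h.eventually_notMem hxr).mono fun y hy => by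
        simp [lowerComp, h.cutoff_eq_zero hy, h.deriv_eq_zero hy]
    exact (differentiableAt_const (0 : ℂ)).congr_of_eventuallyEq h0

/-- The error terms: two with derivatives of the cut-off, and the remainder of the expansion. -/
theorem ae_residual_eq (h : WKBData m N V J η ε₁ c b C δ Δ r lam ξ)
    (hV : MemLinftyLoc fun x => V x 1 0) (hsymm : ∀ᵐ x, V x 0 1 = V x 1 0) :
    ∀ᵐ x, residual m V J N lam ξ x = -(amplitude m V N lam x / den m V lam x
        * (iteratedDeriv 2 ξ x : ℝ))
      + amplitude m V N lam x / den m V lam x * (2 * deriv (phase m V N lam) x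
        - deriv (Klam m V lam) x / Klam m V lam x) * (deriv ξ x : ℝ)
      - upperComp m V N lam ξ x / factor m V lam 1 x
        * wkbRemainder N (eikonal m V lam x) (jetVal m V J lam x) := by
  filter_upwards [h.ae_hasDerivAt_amplitude hV, ae_jetAt h.jet, hsymm] with x hx hj hs
  by_cases hxr : x ∈ region δ
  · have hg := h.mem_goodSet hxr
    have h1 := h.factor_ne hxr 1
    have hd := hasDerivAt_factor (m := m) (lam := lam) h.jet (hj.mono (Nat.zero_le _)) 1
    have hz : -J 1 1 x = jetVal m V J lam x 1 1 * factor m V lam 1 x := by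
      rw [jetVal, div_mul_cancel₀ _ h1]
    have hder := (hx hxr).mul ((((h.hasDerivAt_deriv_cutoff x).sub ((h.hasDerivAt_cutoff x).mul
      (hasDerivAt_phaseDeriv h.jet hj hg))).const_mul (-Complex.I)).div hd h1)
    have hlow : deriv (lowerComp m V J N lam ξ) x = _ := hder.deriv
    rw [residual, hlow, h.deriv_phase hxr, deriv_Klam_div h.jet h.k_eq (hj.mono (Nat.zero_le _)) hg,
      wkbRemainder_eq_phase, den_eq_factor, Vlam_eq_factor, hz, hs]
    simp only [upperComp, lowerComp, Pi.mul_apply, Pi.sub_apply, Pi.div_apply]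
    set A := amplitude m V N lam x
    set P' := phaseDeriv N m V J lam x
    set P'' := phaseDeriv2 N m V J lam x
    set z := jetVal m V J lam x 1 1
    set D := factor m V lam 1 x
    field_simp
    ring_nf
    have hI : Complex.I ^ 3 = -Complex.I := by rw [pow_succ, Complex.I_sq]; ring
    simp only [Complex.I_sq, hI]
    ring
  · have h0 : lowerComp m V J N lam ξ =ᶠ[𝓝 x] fun _ => 0 :=
      (h.eventually_notMem hxr).mono fun y hy => by
        simp [lowerComp, h.cutoff_eq_zero hy, h.deriv_eq_zero hy]
    rw [residual, h0.deriv_eq, h0.eq_of_nhds]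
    simp [upperComp, h.cutoff_eq_zero hxr, h.deriv_eq_zero hxr, h.iteratedDeriv_eq_zero hxr]

end WKBData

/-- The Dirac operator applied to a pair of locally Lipschitz functions. -/
theorem isDiracImage_of_lipAt {Ψ Φ : ℝ → EuclideanSpace ℂ (Fin 2)}
    (hV0 : MemLinftyLoc fun x => V x 0 1) (hV1 : MemLinftyLoc fun x => V x 1 0)
    (hc : ∀ i, Continuous fun x => V x i i) {h0' h1' : ℝ → ℂ}
    (hΨ : MemLp Ψ 2 volume) (hΦ : MemLp Φ 2 volume) (hL : ∀ i x, LipAt (fun y => Ψ y i) x)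
    (hd0 : ∀ᵐ x, HasDerivAt (fun y => Ψ y 0) (h0' x) x)
    (hd1 : ∀ᵐ x, HasDerivAt (fun y => Ψ y 1) (h1' x) x)
    (e0 : ∀ᵐ x, Φ x 0 = -Complex.I * h1' x + V x 0 1 * Ψ x 1 + (V x 0 0 + m) * Ψ x 0)
    (e1 : ∀ᵐ x, Φ x 1 = -Complex.I * h0' x + V x 1 0 * Ψ x 0 + (V x 1 1 - m) * Ψ x 1) :
    IsDiracImage m V Ψ Φ := by
  have hcont : ∀ i, Continuous fun y => Ψ y i := fun i =>
    continuous_iff_continuousAt.2 fun x => (hL i x).continuousAt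
  have key : ∀ (g g' w : ℝ → ℂ) (q p : ℝ → ℂ) (W : ℝ → ℂ), (∀ x, LipAt g x) →
      (∀ᵐ x, HasDerivAt g (g' x) x) → MemLinftyLoc w → Continuous g → Continuous q → Continuous p →
      (∀ᵐ x, W x = -Complex.I * g' x + w x * g x + p x * q x) →
      ∀ φ : ℝ → ℝ, ContDiff ℝ ∞ φ → HasCompactSupport φ →
      (∫ x, deriv φ x • (Complex.I * g x)) + ∫ x, φ x • (w x * g x + p x * q x)
        = ∫ x, φ x • W x := by
    intro g g' w q p W hg hgd hw hgc hq hp hW φ hφ hφc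
    obtain ⟨i1, i2⟩ := integral_deriv_smul_eq_of_lipAt
      (H := fun x => Complex.I * g x) (H' := fun x => Complex.I * g' x)
      (fun x => (lipAt_const _ _).mul (hg x)) (hgd.mono fun x hx => hx.const_mul _) hφ hφc
    have hφ0 : Continuous φ := hφ.continuous
    have hloc : LocallyIntegrable (fun x => w x * g x) volume := by
      have := (locallyIntegrableOn_univ.2 hw.locallyIntegrable).mul_continuousOn
        hgc.continuousOn isOpen_univ.isLocallyClosed
      exact locallyIntegrableOn_univ.1 this
    have i3 : Integrable (fun x => φ x • (w x * g x + p x * q x)) volume :=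
      (hloc.add (hp.mul hq).locallyIntegrable).integrable_smul_left_of_hasCompactSupport hφ0 hφc
    rw [i2, neg_add_eq_sub, ← integral_sub i3 i1]
    refine integral_congr_ae (hW.mono fun x hx => ?_)
    simp only [hx, Complex.real_smul]
    ring
  refine ⟨hΨ, hΦ, ?_, ?_⟩
  · exact key (fun y => Ψ y 1) h1' (fun x => V x 0 1) (fun y => Ψ y 0) (fun x => V x 0 0 + m)
      (fun x => Φ x 0) (hL 1) hd1 hV0 (hcont 1) (hcont 0) ((hc 0).add continuous_const) e0
  · exact key (fun y => Ψ y 0) h0' (fun x => V x 1 0) (fun y => Ψ y 1) (fun x => V x 1 1 - m)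
      (fun x => Φ x 1) (hL 0) hd0 hV1 (hcont 0) (hcont 1) ((hc 1).sub continuous_const) e1

end DiracWKB

/-! ### Norms in `L²`, and the amplitude in the transition regions. -/

namespace DiracWKB

variable {m : ℝ} {N : ℕ} {V : ℝ → Matrix (Fin 2) (Fin 2) ℂ} {f : ℝ → ℝ} {μ ε ν : Side → ℝ}
  {η ε₁ lam c b C : ℝ} {J : Fin 2 → ℕ → ℝ → ℂ} {x : ℝ} {δ : Side → EReal} {Δ r : Side → ℝ}
  {ξ : ℝ → ℝ}

/-! ### The norm of `L²` -/

section l2norm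

variable {E G : Type*} [NormedAddCommGroup E] [NormedAddCommGroup G]

theorem l2norm_nonneg (h : ℝ → E) : 0 ≤ l2norm h := ENNReal.toReal_nonneg

theorem l2norm_le_mul {h : ℝ → E} {g : ℝ → G} {K : ℝ} (hK : 0 ≤ K) (hg : MemLp g 2 volume)
    (hb : ∀ᵐ x, ‖h x‖ ≤ K * ‖g x‖) : l2norm h ≤ K * l2norm g := by
  have h1 := eLpNorm_le_mul_eLpNorm_of_ae_le_mul hb 2
  have h2 := ENNReal.toReal_mono (ENNReal.mul_ne_top ENNReal.ofReal_ne_top hg.2.ne) h1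
  rwa [ENNReal.toReal_mul, ENNReal.toReal_ofReal hK] at h2

theorem l2norm_neg (h : ℝ → E) : l2norm (fun x => -h x) = l2norm h := by
  unfold l2norm
  congr 1
  exact eLpNorm_neg h 2 volume

theorem l2norm_add_le {h g : ℝ → E} (hh : MemLp h 2 volume) (hg : MemLp g 2 volume) :
    l2norm (fun x => h x + g x) ≤ l2norm h + l2norm g := by
  unfold l2norm
  rw [← ENNReal.toReal_add hh.2.ne hg.2.ne]
  exact ENNReal.toReal_mono (ENNReal.add_ne_top.2 ⟨hh.2.ne, hg.2.ne⟩)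
    (eLpNorm_add_le hh.1 hg.1 (by norm_num))

theorem l2norm_congr_ae {h g : ℝ → E} (e : ∀ᵐ x, h x = g x) : l2norm h = l2norm g := by
  unfold l2norm
  rw [eLpNorm_congr_ae e]

theorem l2norm_sq {h : ℝ → E} (hh : MemLp h 2 volume) : l2norm h ^ 2 = ∫ x, ‖h x‖ ^ 2 := by
  unfold l2norm
  have h0 : 0 ≤ ∫ x, ‖h x‖ ^ 2 := integral_nonneg fun x => by positivity
  rw [hh.eLpNorm_eq_integral_rpow_norm (by norm_num) (by norm_num)]
  simp only [ENNReal.toReal_ofNat, Real.rpow_ofNat]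
  rw [ENNReal.toReal_ofReal (by positivity), ← Real.rpow_natCast, ← Real.rpow_mul h0]
  norm_num

theorem le_l2norm {h : ℝ → E} (hb : 0 ≤ b) (hh : MemLp h 2 volume)
    (hle : ∀ x ∈ Set.Icc (0 : ℝ) 1, b ≤ ‖h x‖) : b ≤ l2norm h := by
  have h1 : eLpNorm ((Set.Icc (0 : ℝ) 1).indicator fun _ => b) 2 volume = ENNReal.ofReal b := by
    rw [eLpNorm_indicator_const measurableSet_Icc (by norm_num) (by norm_num)]
    simp [Real.enorm_eq_ofReal hb]
  have h2 : eLpNorm ((Set.Icc (0 : ℝ) 1).indicator fun _ => b) 2 volume ≤ eLpNorm h 2 volume :=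
    eLpNorm_mono fun x => by
      by_cases hx : x ∈ Set.Icc (0 : ℝ) 1
      · rw [Set.indicator_of_mem hx, Real.norm_eq_abs, abs_of_nonneg hb]
        exact hle x hx
      · rw [Set.indicator_of_notMem hx, norm_zero]
        exact norm_nonneg _
  rw [h1] at h2
  exact (ENNReal.ofReal_le_iff_le_toReal hh.2.ne).1 h2

theorem l2norm_sq_pair {h g : ℝ → ℂ} (hh : MemLp h 2 volume) (hg : MemLp g 2 volume) :
    l2norm (fun x => (!₂[h x, g x] : EuclideanSpace ℂ (Fin 2))) ^ 2 = l2norm h ^ 2 + l2norm g ^ 2 ∧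
      MemLp (fun x => (!₂[h x, g x] : EuclideanSpace ℂ (Fin 2))) 2 volume := by
  have hm : MemLp (fun x => (!₂[h x, g x] : EuclideanSpace ℂ (Fin 2))) 2 volume := by
    refine MemLp.of_eval_piLp fun i => ?_
    fin_cases i
    · exact hh
    · exact hg
  refine ⟨?_, hm⟩
  rw [l2norm_sq hm, l2norm_sq hh, l2norm_sq hg, ← integral_add
    ((memLp_two_iff_integrable_sq_norm hh.1).1 hh) ((memLp_two_iff_integrable_sq_norm hg.1).1 hg)]
  refine integral_congr_ae (Eventually.of_forall fun x => ?_)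
  simp [EuclideanSpace.norm_sq_eq]

/-- Comparison with `1 / (1 + x²)` through `1 + c² x² ≤ exp (2 c |x|)`. -/
theorem memLp_exp_neg_abs (hc : 0 < c) :
    MemLp (fun x : ℝ => Real.exp (-c * |x|)) 2 volume := by
  have hcont : Continuous fun x : ℝ => Real.exp (-c * |x|) := by fun_prop
  rw [memLp_two_iff_integrable_sq hcont.aestronglyMeasurable]
  refine (integrable_inv_one_add_sq.const_mul (1 + (c ^ 2)⁻¹)).mono'
    (by fun_prop) (Eventually.of_forall fun x => ?_)
  have h1 := Real.quadratic_le_exp_of_nonneg (show 0 ≤ 2 * c * |x| by positivity)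
  have h2 : 1 + c ^ 2 * x ^ 2 ≤ Real.exp (2 * c * |x|) := by
    rw [← sq_abs x]
    nlinarith [show 0 ≤ c * |x| by positivity, sq_nonneg (c * |x|)]
  rw [Real.norm_eq_abs, abs_of_nonneg (by positivity), ← Real.exp_nat_mul,
    show ((2 : ℕ) : ℝ) * (-c * |x|) = -(2 * c * |x|) by push_cast; ring, Real.exp_neg,
    ← div_eq_mul_inv, le_div_iff₀ (by positivity), inv_mul_le_iff₀ (Real.exp_pos _)]
  calc 1 + x ^ 2 ≤ (1 + c ^ 2 * x ^ 2) * (1 + (c ^ 2)⁻¹) := by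
        have : c ^ 2 * x ^ 2 * (c ^ 2)⁻¹ = x ^ 2 := by field_simp
        have h3 : 0 ≤ (c ^ 2)⁻¹ := by positivity
        have h4 : 0 ≤ c ^ 2 * x ^ 2 := by positivity
        nlinarith
    _ ≤ _ := by gcongr

end l2norm

/-! ### The transition regions of the cut-off -/

theorem Admissible.exists_F_bounds (hV : Admissible N V f μ ε ν) :
    ∃ c > 0, ∃ C, 0 ≤ C ∧ ∀ s : Side, ∀ x, 0 ≤ s.sgn * x → c * |x| ≤ F V x + C ∧
      ∀ y, 0 ≤ s.sgn * y → s.sgn * y ≤ s.sgn * x → F V y ≤ F V x + C := by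
  choose cs hcs Cs hCs hF using hV.exists_le_F
  choose R hR hmono using hV.exists_F_mono
  obtain ⟨B, hB, hb⟩ := exists_bound_side hV.continuous_F (max (R .minus) (R .plus))
  have h1 := hCs .minus
  have h2 := hCs .plus
  refine ⟨min (cs .minus) (cs .plus), lt_min (hcs _) (hcs _), B + Cs .minus + Cs .plus,
    by positivity, fun s x hx => ?_⟩
  have h3 : min (cs .minus) (cs .plus) ≤ cs s ∧ Cs s ≤ Cs .minus + Cs .plus ∧
      R s ≤ max (R .minus) (R .plus) := by
    cases s
    · exact ⟨min_le_left _ _, by linarith, le_max_left _ _⟩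
    · exact ⟨min_le_right _ _, by linarith, le_max_right _ _⟩
  have h4 := hF s x hx
  have h5 : 0 ≤ cs s * (s.sgn * x) := mul_nonneg (hcs s).le hx
  constructor
  · rw [Side.abs_eq hx]
    have := mul_le_mul_of_nonneg_right h3.1 hx
    linarith
  · intro y hy hyx
    rcases le_total (R s) (s.sgn * y) with h6 | h6
    · linarith [hmono s y x h6 hyx]
    · have := (abs_le.1 (hb y (by rw [Side.abs_eq hy]; exact h6.trans h3.2.2))).2
      linarith

open Classical in
/-- The size of the amplitude in the transition region at an end. -/
def tail (V : ℝ → Matrix (Fin 2) (Fin 2) ℂ) (d₁ : ℝ) (s : Side) (ρ : EReal) : ℝ :=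
  if ρ = ⊤ then 0 else Real.exp (-d₁ * F V (s.sgn * (1 / 2 * ρ.toReal)))

theorem tail_nonneg (V d₁ s ρ) : 0 ≤ tail V d₁ s ρ := by
  unfold tail
  split_ifs
  exacts [le_rfl, (Real.exp_pos _).le]

theorem iteratedDeriv_eq_zero_of_eventuallyEq_one {h : ℝ → ℝ} (hx : ∀ᶠ y in 𝓝 x, h y = 1) {j : ℕ}
    (hj : j = 1 ∨ j = 2) : iteratedDeriv j h x = 0 := by
  have h0 : h =ᶠ[𝓝 x] fun _ => 1 := hx
  rw [h0.iteratedDeriv_eq, iteratedDeriv_const]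
  rcases hj with rfl | rfl <;> simp

namespace WKBData

/-- A nonzero derivative of `ξ` at `x` forces `|x| ≥ d - 1/d ≥ d/2` for a finite radius `d`. The
derivatives are at most `C d^j ≤ C d²`, the width being `1/d`; an end with infinite radius creates
no transition. -/
theorem transition (h : WKBData m N V J η ε₁ c b C δ Δ r lam ξ) {s : Side} (hs : 0 ≤ s.sgn * x)
    {j : ℕ} (hj : j = 1 ∨ j = 2) (h0 : iteratedDeriv j ξ x ≠ 0) :
    ∃ d : ℝ, δ s = d ∧ 2 < d ∧ 1 / 2 * d ≤ s.sgn * x ∧ |iteratedDeriv j ξ x| ≤ C * d ^ 2 := by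
  have hex : ∃ t : Side, δ t ≤ ((t.sgn * x + Δ t : ℝ) : EReal) := by
    by_contra hc
    push Not at hc
    refine h0 (iteratedDeriv_eq_zero_of_eventuallyEq_one ?_ hj)
    filter_upwards [(isOpen_setOf_lt δ Δ).mem_nhds hc] with y hy using h.cutoff.eq_one y hy
  obtain ⟨t, ht⟩ := hex
  rcases h.width_eq t with ⟨h1, -⟩ | ⟨d, h1, h2⟩
  · rw [h1, top_le_iff] at ht
    exact absurd ht (EReal.coe_ne_top _)
  · have hd : (2 : ℝ) < d := by
      have := h.two_lt t
      rw [h1] at this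
      exact EReal.coe_lt_coe_iff.1 this
    have hdi : d⁻¹ ≤ 2⁻¹ := inv_anti₀ (by norm_num) hd.le
    rw [h1, EReal.coe_le_coe_iff, h2] at ht
    -- The distance `d - 1/d` is positive, so the transition lies on the same side as `x`.
    have hts : t = s := by
      cases s <;> cases t <;> first | rfl | (simp only [Side.sgn] at hs ht; linarith)
    subst hts
    refine ⟨d, h1, hd, by linarith, ?_⟩
    have h3 := h.cutoff.deriv_le t j hj x hs
    rw [h2, inv_pow, ← div_eq_mul_inv, div_le_iff₀ (by positivity)] at h3
    refine h3.trans (mul_le_mul_of_nonneg_left ?_ h.const_nonneg)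
    exact pow_le_pow_right₀ (by linarith) (by omega)

end WKBData

/-- Exponential bounds on the amplitude and on its products with the derivatives of the cut-off. -/
structure AmplitudeBound (m : ℝ) (V : ℝ → Matrix (Fin 2) (Fin 2) ℂ) (N : ℕ) (lam : ℝ) (ξ : ℝ → ℝ)
    (c T C x : ℝ) : Prop where
  amplitude_le : ‖amplitude m V N lam x‖ ≤ C * Real.exp (-c * |x|)
  deriv_le : ∀ j, j = 1 ∨ j = 2 →
    ‖amplitude m V N lam x‖ * |iteratedDeriv j ξ x| ≤ C * T * Real.exp (-c * |x|)

/-- The decay `exp (-c F(x))` is spent in three ways. One half yields integrability in `|x|`; the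
other half is moved to the point at distance `d/2`, where one part gives the tail `exp (-(c/4) F)`
and the other a factor `exp (-k d)` against the growth `d²` of the derivatives of the cut-off. -/
theorem Admissible.exists_amplitudeBound (hV : Admissible N V f μ ε ν) (hc : 0 < c) (hC : 0 ≤ C) :
    ∃ c' > 0, ∃ d₁ > 0, ∃ C', 0 ≤ C' ∧ ∀ (m η ε₁ b lam : ℝ) (J : Fin 2 → ℕ → ℝ → ℂ)
      (δ : Side → EReal) (Δ r : Side → ℝ) (ξ : ℝ → ℝ), WKBData m N V J η ε₁ c b C δ Δ r lam ξ →
      ∀ x ∈ region δ, AmplitudeBound m V N lam ξ c'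
        (tail V d₁ .minus (δ .minus) + tail V d₁ .plus (δ .plus)) C' x := by
  obtain ⟨c0, hc0, C0, hC0, hF⟩ := hV.exists_F_bounds
  set k := c * c0 / 8 with hk
  have hk0 : 0 < k := by positivity
  set A := C * Real.exp (c * C0) with hA
  set B := C * (C * (2 / k ^ 2)) * Real.exp (5 * c * C0 / 4) with hB
  refine ⟨c * c0 / 2, by positivity, c / 4, by positivity, A + B, by positivity,
    fun m η ε₁ b lam J δ Δ r ξ h x hx => ?_⟩
  set T := tail V (c / 4) .minus (δ .minus) + tail V (c / 4) .plus (δ .plus) with hT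
  have hTs : ∀ s, tail V (c / 4) s (δ s) ≤ T := fun s => by
    have h1 := tail_nonneg V (c / 4) .minus (δ .minus)
    have h2 := tail_nonneg V (c / 4) .plus (δ .plus)
    cases s <;> linarith
  have hA0 : 0 ≤ A := by positivity
  have hB0 : 0 ≤ B := by positivity
  have hT0 : 0 ≤ T := (tail_nonneg _ _ _ _).trans (hTs .plus)
  obtain ⟨s, hs⟩ := Side.exists_nonneg x
  have hdec := h.decay s x hx hs
  obtain ⟨hF1, hF2⟩ := hF s x hs
  have hcF := mul_le_mul_of_nonneg_left hF1 hc.le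
  constructor
  · refine hdec.trans ?_
    have : Real.exp (-c * F V x) ≤ Real.exp (c * C0) * Real.exp (-(c * c0 / 2) * |x|) := by
      rw [← Real.exp_add]
      refine Real.exp_le_exp.2 ?_
      have : 0 ≤ c * (c0 * |x|) := by positivity
      nlinarith
    calc C * Real.exp (-c * F V x) ≤ A * Real.exp (-(c * c0 / 2) * |x|) := by
          rw [hA, mul_assoc]
          gcongr
      _ ≤ _ := by
          gcongr
          linarith
  · intro j hj
    by_cases h0 : iteratedDeriv j ξ x = 0
    · rw [h0, abs_zero, mul_zero]
      positivity
    obtain ⟨d, hd, hd2, hdx, hle⟩ := h.transition hs hj h0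
    set y := s.sgn * (1 / 2 * d) with hy
    have hsy : s.sgn * y = 1 / 2 * d := s.sgn_mul_sgn_mul _
    have hsy0 : 0 ≤ s.sgn * y := by rw [hsy]; linarith
    have hyx := hF2 y hsy0 (by rw [hsy]; exact hdx)
    obtain ⟨hFy, -⟩ := hF s y hsy0
    rw [Side.abs_eq hsy0, hsy] at hFy
    have htail : tail V (c / 4) s (δ s) = Real.exp (-(c / 4) * F V y) := by
      rw [tail, hd, if_neg (EReal.coe_ne_top d), EReal.toReal_coe]
    have hexp : Real.exp (-c * F V x) * Real.exp (k * d) ≤ Real.exp (5 * c * C0 / 4) *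
        (Real.exp (-(c / 4) * F V y) * Real.exp (-(c * c0 / 2) * |x|)) := by
      rw [← Real.exp_add, ← Real.exp_add, ← Real.exp_add]
      refine Real.exp_le_exp.2 ?_
      have e1 := mul_le_mul_of_nonneg_left hyx hc.le
      have e2 := mul_le_mul_of_nonneg_left hFy hc.le
      rw [hk]
      nlinarith
    have hd_sq : d ^ 2 ≤ 2 / k ^ 2 * Real.exp (k * d) := by
      have := Real.quadratic_le_exp_of_nonneg (show 0 ≤ k * d by positivity)
      have h1 : d ^ 2 = 2 / k ^ 2 * ((k * d) ^ 2 / 2) := by field_simp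
      rw [h1]
      gcongr
      linarith [show 0 ≤ k * d by positivity]
    calc ‖amplitude m V N lam x‖ * |iteratedDeriv j ξ x|
        ≤ C * Real.exp (-c * F V x) * (C * (2 / k ^ 2 * Real.exp (k * d))) :=
          mul_le_mul hdec (hle.trans (by gcongr)) (abs_nonneg _) (by positivity)
      _ = C * (C * (2 / k ^ 2)) * (Real.exp (-c * F V x) * Real.exp (k * d)) := by ring
      _ ≤ C * (C * (2 / k ^ 2)) * (Real.exp (5 * c * C0 / 4) *
          (Real.exp (-(c / 4) * F V y) * Real.exp (-(c * c0 / 2) * |x|))) := by gcongr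
      _ = B * tail V (c / 4) s (δ s) * Real.exp (-(c * c0 / 2) * |x|) := by
          rw [htail, hB]
          ring
      _ ≤ _ := by
          have := tail_nonneg V (c / 4) s (δ s)
          gcongr
          · linarith
          · exact hTs s

end DiracWKB

/-! ### Estimates in `L²` at a fixed `λ`. -/

namespace DiracWKB

variable {m : ℝ} {N : ℕ} {V : ℝ → Matrix (Fin 2) (Fin 2) ℂ}
  {η ε₁ lam c b C c' T C' : ℝ} {J : Fin 2 → ℕ → ℝ → ℂ} {x : ℝ} {δ : Side → EReal} {Δ r : Side → ℝ}
  {ξ : ℝ → ℝ}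

/-! ### Estimates in `L²` -/

/-- The error term with the second derivative of the cut-off. -/
def cutError₂ (m : ℝ) (V : ℝ → Matrix (Fin 2) (Fin 2) ℂ) (N : ℕ) (lam : ℝ) (ξ : ℝ → ℝ) (x : ℝ) :
    ℂ :=
  amplitude m V N lam x / den m V lam x * (iteratedDeriv 2 ξ x : ℝ)

/-- The error term with the first derivative of the cut-off. -/
def cutError₁ (m : ℝ) (V : ℝ → Matrix (Fin 2) (Fin 2) ℂ) (N : ℕ) (lam : ℝ) (ξ : ℝ → ℝ) (x : ℝ) :
    ℂ :=
  amplitude m V N lam x / den m V lam x * (2 * deriv (phase m V N lam) x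
    - deriv (Klam m V lam) x / Klam m V lam x) * (deriv ξ x : ℝ)

/-- The error term with the remainder of the expansion. -/
def expansionError (m : ℝ) (V : ℝ → Matrix (Fin 2) (Fin 2) ℂ) (J : Fin 2 → ℕ → ℝ → ℂ) (N : ℕ)
    (lam : ℝ) (ξ : ℝ → ℝ) (x : ℝ) : ℂ :=
  upperComp m V N lam ξ x / factor m V lam 1 x
    * wkbRemainder N (eikonal m V lam x) (jetVal m V J lam x)

namespace WKBData

theorem norm_inv_factor_le (h : WKBData m N V J η ε₁ c b C δ Δ r lam ξ) (hx : x ∈ region δ) :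
    ‖(factor m V lam 1 x)⁻¹‖ ≤ (1 - η)⁻¹ := by
  have hη := h.eta_lt
  have h1 : 0 < 1 - η := by linarith
  rw [norm_inv]
  refine inv_anti₀ h1 (le_trans ?_ ((h.parts_le x hx).le_norm 1))
  nlinarith [h.one_le]

theorem norm_cutoff_le (h : WKBData m N V J η ε₁ c b C δ Δ r lam ξ) (x : ℝ) :
    ‖((ξ x : ℝ) : ℂ)‖ ≤ 1 := by
  rw [Complex.norm_real, Real.norm_eq_abs, abs_of_nonneg (h.cutoff.mem_Icc x).1]
  exact (h.cutoff.mem_Icc x).2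

theorem norm_cutError₂_le (h : WKBData m N V J η ε₁ c b C δ Δ r lam ξ)
    (ha : ∀ x ∈ region δ, AmplitudeBound m V N lam ξ c' T C' x) (hCT : 0 ≤ C' * T) (x : ℝ) :
    ‖cutError₂ m V N lam ξ x‖ ≤ (1 - η)⁻¹ * (C' * T) * ‖Real.exp (-c' * |x|)‖ := by
  have h1 : 0 < 1 - η := by linarith [h.eta_lt]
  by_cases hx : x ∈ region δ
  · have h2 := (ha x hx).deriv_le 2 (Or.inr rfl)
    have h3 := h.norm_inv_factor_le hx
    rw [cutError₂, den_eq_factor, div_eq_mul_inv, norm_mul, norm_mul, Complex.norm_real,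
      Real.norm_eq_abs, Real.norm_eq_abs, Real.abs_exp]
    calc _ = ‖(factor m V lam 1 x)⁻¹‖ * (‖amplitude m V N lam x‖ * |iteratedDeriv 2 ξ x|) := by ring
      _ ≤ (1 - η)⁻¹ * (C' * T * Real.exp (-c' * |x|)) := by gcongr
      _ = _ := by ring
  · rw [cutError₂, h.iteratedDeriv_eq_zero hx]
    simp only [Complex.ofReal_zero, mul_zero, norm_zero]
    positivity

theorem norm_cutError₁_le (h : WKBData m N V J η ε₁ c b C δ Δ r lam ξ)
    (ha : ∀ x ∈ region δ, AmplitudeBound m V N lam ξ c' T C' x) (hCT : 0 ≤ C' * T) :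
    ∀ᵐ x, ‖cutError₁ m V N lam ξ x‖ ≤ 3 * C * (C' * T) * ‖Real.exp (-c' * |x|)‖ := by
  have hC := h.const_nonneg
  filter_upwards [h.expansion, ae_mem_openRegion δ, ae_jetAt h.jet] with x h1 h2 hj
  by_cases hx : x ∈ region δ
  · obtain ⟨s, hs⟩ := Side.exists_nonneg x
    have hb := h1 (h2 hx) s hs
    have h3 := (ha x hx).deriv_le 1 (Or.inl rfl)
    rw [iteratedDeriv_one] at h3
    have hD : 0 < ‖factor m V lam 1 x‖ := norm_pos_iff.2 (h.factor_ne hx 1)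
    have h4 : ‖(2 * phaseDeriv N m V J lam x - -jetVal m V J lam x 1 1)‖
        ≤ 3 * C * ‖factor m V lam 1 x‖ := by
      rw [sub_neg_eq_add]
      refine (norm_add_le _ _).trans ?_
      rw [norm_mul, Complex.norm_ofNat]
      linarith [hb.phaseDeriv_le, hb.jetVal_le]
    rw [cutError₁, h.deriv_phase hx, deriv_Klam_div h.jet h.k_eq (hj.mono (Nat.zero_le _))
      (h.mem_goodSet hx), den_eq_factor, norm_mul, norm_mul, norm_div, Complex.norm_real,
      Real.norm_eq_abs, Real.norm_eq_abs, Real.abs_exp]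
    calc _ = ‖2 * phaseDeriv N m V J lam x - -jetVal m V J lam x 1 1‖ / ‖factor m V lam 1 x‖
          * (‖amplitude m V N lam x‖ * |deriv ξ x|) := by ring
      _ ≤ 3 * C * (C' * T * Real.exp (-c' * |x|)) :=
        mul_le_mul ((div_le_iff₀ hD).2 h4) h3 (by positivity) (by positivity)
      _ = _ := by ring
  · rw [cutError₁, h.deriv_eq_zero hx]
    simp only [Complex.ofReal_zero, mul_zero, norm_zero]
    positivity

theorem norm_upperComp_le (h : WKBData m N V J η ε₁ c b C δ Δ r lam ξ)
    (ha : ∀ x ∈ region δ, AmplitudeBound m V N lam ξ c' T C' x) (hC' : 0 ≤ C') (x : ℝ) :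
    ‖upperComp m V N lam ξ x‖ ≤ C' * ‖Real.exp (-c' * |x|)‖ := by
  by_cases hx : x ∈ region δ
  · rw [upperComp, norm_mul, Real.norm_eq_abs, Real.abs_exp]
    calc _ ≤ ‖amplitude m V N lam x‖ * 1 := by gcongr; exact h.norm_cutoff_le x
      _ ≤ _ := by rw [mul_one]; exact (ha x hx).amplitude_le
  · rw [upperComp, h.cutoff_eq_zero hx]
    simp only [Complex.ofReal_zero, mul_zero, norm_zero]
    positivity

theorem norm_lowerComp_le (h : WKBData m N V J η ε₁ c b C δ Δ r lam ξ)
    (ha : ∀ x ∈ region δ, AmplitudeBound m V N lam ξ c' T C' x) (hC' : 0 ≤ C')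
    (hCT : 0 ≤ C' * T) : ∀ᵐ x, ‖lowerComp m V J N lam ξ x‖
      ≤ ((1 - η)⁻¹ * (C' * T) + C * C') * ‖Real.exp (-c' * |x|)‖ := by
  have hC := h.const_nonneg
  have h1η : 0 < 1 - η := by linarith [h.eta_lt]
  filter_upwards [h.expansion, ae_mem_openRegion δ] with x h1 h2
  by_cases hx : x ∈ region δ
  · obtain ⟨s, hs⟩ := Side.exists_nonneg x
    have hb := (h1 (h2 hx) s hs).phaseDeriv_le
    have h3 := (ha x hx).deriv_le 1 (Or.inl rfl)
    have h4 := (ha x hx).amplitude_le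
    rw [iteratedDeriv_one] at h3
    have hD : 0 < ‖factor m V lam 1 x‖ := norm_pos_iff.2 (h.factor_ne hx 1)
    have h5 : lowerComp m V J N lam ξ x = -Complex.I * (amplitude m V N lam x * (deriv ξ x : ℝ)
        * (factor m V lam 1 x)⁻¹ - ξ x * (amplitude m V N lam x
          * (phaseDeriv N m V J lam x / factor m V lam 1 x))) := by
      rw [lowerComp]
      ring
    rw [h5, norm_mul, norm_neg, Complex.norm_I, one_mul, Real.norm_eq_abs, Real.abs_exp]
    refine (norm_sub_le _ _).trans ?_
    rw [norm_mul, norm_mul, norm_mul, norm_mul, norm_div, Complex.norm_real (deriv ξ x),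
      Real.norm_eq_abs]
    calc _ ≤ C' * T * Real.exp (-c' * |x|) * (1 - η)⁻¹
          + 1 * (C' * Real.exp (-c' * |x|) * C) := by
          gcongr
          · exact h.norm_inv_factor_le hx
          · exact h.norm_cutoff_le x
          · exact (div_le_iff₀ hD).2 hb
      _ = _ := by ring
  · rw [lowerComp, h.cutoff_eq_zero hx, h.deriv_eq_zero hx]
    simp only [Complex.ofReal_zero, mul_zero, zero_mul, sub_zero, zero_div, norm_zero]
    positivity

theorem norm_expansionError_le (h : WKBData m N V J η ε₁ c b C δ Δ r lam ξ) :
    ∀ᵐ x, ‖expansionError m V J N lam ξ x‖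
      ≤ C * (r .minus + r .plus) * ‖upperComp m V N lam ξ x‖ := by
  have hC := h.const_nonneg
  have hr0 := h.rate_nonneg .minus
  have hr1 := h.rate_nonneg .plus
  filter_upwards [h.expansion, ae_mem_openRegion δ] with x h1 h2
  by_cases hx : x ∈ region δ
  · obtain ⟨s, hs⟩ := Side.exists_nonneg x
    have hb := (h1 (h2 hx) s hs).remainder_le
    have hD : 0 < ‖factor m V lam 1 x‖ := norm_pos_iff.2 (h.factor_ne hx 1)
    have hrs : r s ≤ r .minus + r .plus := by cases s <;> linarith
    rw [expansionError, norm_mul, norm_div]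
    calc _ ≤ ‖upperComp m V N lam ξ x‖ / ‖factor m V lam 1 x‖
          * (C * (r .minus + r .plus) * ‖factor m V lam 1 x‖) := by
          gcongr
          exact hb.trans (by gcongr)
      _ = _ := by field_simp
  · rw [expansionError, upperComp, h.cutoff_eq_zero hx]
    simp

theorem continuous_upperComp (h : WKBData m N V J η ε₁ c b C δ Δ r lam ξ)
    (hV : MemLinftyLoc fun x => V x 1 0) : Continuous (upperComp m V N lam ξ) :=
  continuous_iff_continuousAt.2 fun x => (h.lipAt_upperComp hV x).continuousAt

theorem continuous_lowerComp (h : WKBData m N V J η ε₁ c b C δ Δ r lam ξ)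
    (hV : MemLinftyLoc fun x => V x 1 0) : Continuous (lowerComp m V J N lam ξ) :=
  continuous_iff_continuousAt.2 fun x => (h.lipAt_lowerComp hV x).continuousAt

theorem continuous_amplitude_mul_iteratedDeriv (h : WKBData m N V J η ε₁ c b C δ Δ r lam ξ)
    (hV : MemLinftyLoc fun x => V x 1 0) (j : ℕ) : Continuous fun x =>
      amplitude m V N lam x / den m V lam x * ((iteratedDeriv j ξ x : ℝ) : ℂ) := by
  refine continuous_iff_continuousAt.2 fun x => (h.lipAt_of_core (g := fun x =>
    amplitude m V N lam x / den m V lam x * ((iteratedDeriv j ξ x : ℝ) : ℂ)) (fun x hx => ?_)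
    (fun x hx => ?_) x).continuousAt
  · refine LipAt.mul ?_ (LipAt.ofReal (lipAt_of_contDiffAt ?_))
    · exact ((h.lipAt_amplitude hV hx).mul ((lipAt_factor h.jet 1).inv
        (factor_ne_zero (core_subset hx) 1))).congr (Eventually.of_forall fun y => by
          beta_reduce
          rw [den_eq_factor, div_eq_mul_inv])
    · refine ((h.cutoff.smooth.iterate_deriv j).of_le (n := ∞) (by simp)).contDiffAt.congr_of_eventuallyEq
        (Eventually.of_forall fun y => ?_)
      rw [iteratedDeriv_eq_iterate]
  · rw [h.iteratedDeriv_eq_zero hx]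
    simp

theorem aestronglyMeasurable_cutError₁ (h : WKBData m N V J η ε₁ c b C δ Δ r lam ξ)
    (hV : MemLinftyLoc fun x => V x 1 0) :
    AEStronglyMeasurable (cutError₁ m V N lam ξ) volume := by
  have hK : Measurable (Klam m V lam) := by
    rw [Klam_eq h.k_eq]
    have : Continuous (factor m V lam 1) := continuous_iff_continuousAt.2 fun x =>
      (lipAt_factor h.jet 1).continuousAt
    exact this.measurable.inv
  have h1 : Measurable fun x => 2 * deriv (phase m V N lam) x
      - deriv (Klam m V lam) x / Klam m V lam x :=
    ((measurable_deriv _).const_mul 2).sub ((measurable_deriv _).div hK)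
  have h2 := (h.continuous_amplitude_mul_iteratedDeriv hV 1).measurable.mul h1
  refine h2.aestronglyMeasurable.congr (Eventually.of_forall fun x => ?_)
  simp only [Pi.mul_apply, cutError₁, iteratedDeriv_one]
  ring

theorem aestronglyMeasurable_residual (h : WKBData m N V J η ε₁ c b C δ Δ r lam ξ)
    (hV0 : MemLinftyLoc fun x => V x 0 1) (hV : MemLinftyLoc fun x => V x 1 0) :
    AEStronglyMeasurable (residual m V J N lam ξ) volume := by
  have hf : Continuous (factor m V lam 0) := continuous_iff_continuousAt.2 fun x =>
    (lipAt_factor h.jet 0).continuousAt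
  exact ((((measurable_deriv _).const_mul _).aestronglyMeasurable).add
    (hV0.locallyIntegrable.aestronglyMeasurable.mul
      (h.continuous_lowerComp hV).aestronglyMeasurable)).sub
    (hf.mul (h.continuous_upperComp hV)).aestronglyMeasurable

end WKBData

/-- All the functions in the construction are square integrable. -/
structure SquareIntegrable (m : ℝ) (V : ℝ → Matrix (Fin 2) (Fin 2) ℂ) (J : Fin 2 → ℕ → ℝ → ℂ)
    (N : ℕ) (lam : ℝ) (ξ : ℝ → ℝ) : Prop where
  upper : MemLp (upperComp m V N lam ξ) 2 volume
  lower : MemLp (lowerComp m V J N lam ξ) 2 volume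
  cut₁ : MemLp (cutError₁ m V N lam ξ) 2 volume
  cut₂ : MemLp (cutError₂ m V N lam ξ) 2 volume
  expansion : MemLp (expansionError m V J N lam ξ) 2 volume
  residual_eq : ∀ᵐ x, residual m V J N lam ξ x = -cutError₂ m V N lam ξ x
    + cutError₁ m V N lam ξ x - expansionError m V J N lam ξ x

namespace WKBData

theorem squareIntegrable (h : WKBData m N V J η ε₁ c b C δ Δ r lam ξ)
    (hV0 : MemLinftyLoc fun x => V x 0 1) (hV : MemLinftyLoc fun x => V x 1 0)
    (hsymm : ∀ᵐ x, V x 0 1 = V x 1 0) (hc' : 0 < c')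
    (ha : ∀ x ∈ region δ, AmplitudeBound m V N lam ξ c' T C' x) (hC' : 0 ≤ C')
    (hCT : 0 ≤ C' * T) : SquareIntegrable m V J N lam ξ := by
  have hG := memLp_exp_neg_abs hc'
  have hres := h.ae_residual_eq hV hsymm
  have h0 : MemLp (upperComp m V N lam ξ) 2 volume :=
    hG.of_le_mul (h.continuous_upperComp hV).aestronglyMeasurable
      (Eventually.of_forall (h.norm_upperComp_le ha hC'))
  have h1 : MemLp (cutError₁ m V N lam ξ) 2 volume :=
    hG.of_le_mul (h.aestronglyMeasurable_cutError₁ hV) (h.norm_cutError₁_le ha hCT)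
  have h2 : MemLp (cutError₂ m V N lam ξ) 2 volume :=
    hG.of_le_mul (h.continuous_amplitude_mul_iteratedDeriv hV 2).aestronglyMeasurable
      (Eventually.of_forall (h.norm_cutError₂_le ha hCT))
  refine ⟨h0, hG.of_le_mul (h.continuous_lowerComp hV).aestronglyMeasurable
    (h.norm_lowerComp_le ha hC' hCT), h1, h2, h0.of_le_mul ?_ h.norm_expansionError_le, hres⟩
  -- Measurability of the expansion error is read off from the residual identity, so no
  -- measurability of the jets of highest order has to be discussed.
  refine ((h2.1.neg.add h1.1).sub (h.aestronglyMeasurable_residual hV0 hV)).congr ?_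
  filter_upwards [hres] with x hx
  simp only [Pi.sub_apply, Pi.add_apply, Pi.neg_apply, hx, cutError₁, cutError₂, expansionError]
  ring

end WKBData

namespace SquareIntegrable

theorem residual_memLp (h : SquareIntegrable m V J N lam ξ) :
    MemLp (residual m V J N lam ξ) 2 volume :=
  ((h.cut₂.neg.add h.cut₁).sub h.expansion).ae_eq
    (h.residual_eq.mono fun _ hx => hx.symm)

theorem l2norm_residual_le (h : SquareIntegrable m V J N lam ξ) :
    l2norm (residual m V J N lam ξ) ≤ l2norm (cutError₂ m V N lam ξ)
      + l2norm (cutError₁ m V N lam ξ) + l2norm (expansionError m V J N lam ξ) := by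
  have e : l2norm (residual m V J N lam ξ) = l2norm fun x => (-cutError₂ m V N lam ξ x
      + cutError₁ m V N lam ξ x) + -expansionError m V J N lam ξ x :=
    l2norm_congr_ae (h.residual_eq.mono fun x hx => by rw [hx, sub_eq_add_neg])
  rw [e]
  refine (l2norm_add_le (h.cut₂.neg.add h.cut₁) h.expansion.neg).trans ?_
  refine (add_le_add_left (l2norm_add_le h.cut₂.neg h.cut₁) _).trans (le_of_eq ?_)
  rw [← l2norm_neg (cutError₂ m V N lam ξ), ← l2norm_neg (expansionError m V J N lam ξ)]
  rfl

end SquareIntegrable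

namespace WKBData

/-- All radii exceed `2` and the finite ones have width below `1/2`, so `ξ = 1` on `[0, 1]`, where
the amplitude is bounded below. -/
theorem le_l2norm_upperComp (h : WKBData m N V J η ε₁ c b C δ Δ r lam ξ) (hb : 0 ≤ b)
    (hs : SquareIntegrable m V J N lam ξ) : b ≤ l2norm (upperComp m V N lam ξ) := by
  refine le_l2norm hb hs.upper fun x hx => ?_
  have hx1 : |x| ≤ 1 := by rw [abs_of_nonneg hx.1]; exact hx.2
  have h1 : ξ x = 1 := by
    refine h.cutoff.eq_one x fun s => ?_
    have h2 := s.sgn_mul_le_abs x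
    rcases h.width_eq s with ⟨e1, -⟩ | ⟨d, e1, e2⟩
    · rw [e1]
      exact EReal.coe_lt_top _
    · have hd : (2 : ℝ) < d := by
        have := h.two_lt s
        rw [e1] at this
        exact EReal.coe_lt_coe_iff.1 this
      have hdi : d⁻¹ ≤ 2⁻¹ := inv_anti₀ (by norm_num) hd.le
      rw [e1, e2, EReal.coe_lt_coe_iff]
      linarith
  rw [upperComp, h1, Complex.ofReal_one, mul_one]
  exact h.lower x hx1

variable {ξ : ℝ → ℝ → ℝ}

theorem kappa_eq (h : WKBData m N V J η ε₁ c b C δ Δ r lam (ξ lam)) :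
    kappa m V N ξ lam = (l2norm (cutError₂ m V N lam (ξ lam)) + l2norm (cutError₁ m V N lam (ξ lam)))
      / Real.sqrt (l2norm (upperComp m V N lam (ξ lam)) ^ 2
        + l2norm (lowerComp m V J N lam (ξ lam)) ^ 2) := by
  have e : (fun x => k₁ V x * (-Complex.I * deriv (fun y => Complex.exp (-phase m V N lam y)
      * (ξ lam y : ℂ)) x) / den m V lam x) = lowerComp m V J N lam (ξ lam) := by
    funext x
    have : (fun y => Complex.exp (-phase m V N lam y) * (ξ lam y : ℂ))
        = fun y => (ξ lam y : ℂ) * Complex.exp (-phase m V N lam y) := by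
      funext y
      ring
    rw [this, h.deriv_cutoff_mul_exp, den_eq_factor, lowerComp, amplitude]
    ring
  rw [kappa, e]
  rfl

theorem kappa_nonneg (m V N ξ) (lam : ℝ) : 0 ≤ kappa m V N ξ lam :=
  div_nonneg (add_nonneg (l2norm_nonneg _) (l2norm_nonneg _)) (Real.sqrt_nonneg _)

theorem kappa_le (h : WKBData m N V J η ε₁ c b C δ Δ r lam (ξ lam)) (hb : 0 < b)
    (hs : SquareIntegrable m V J N lam (ξ lam)) (hc' : 0 < c')
    (ha : ∀ x ∈ region δ, AmplitudeBound m V N lam (ξ lam) c' T C' x) (hCT : 0 ≤ C' * T) :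
    kappa m V N ξ lam ≤ ((1 - η)⁻¹ + 3 * C) * C' * l2norm (fun x : ℝ => Real.exp (-c' * |x|)) / b
      * T := by
  have hG := memLp_exp_neg_abs hc'
  have hC := h.const_nonneg
  have h1η : 0 < 1 - η := by linarith [h.eta_lt]
  have h1 := l2norm_le_mul (by positivity) hG
    (Eventually.of_forall (h.norm_cutError₂_le ha hCT))
  have h2 := l2norm_le_mul (by positivity) hG (h.norm_cutError₁_le ha hCT)
  have h3 := h.le_l2norm_upperComp hb.le hs
  have h4 : b ≤ Real.sqrt (l2norm (upperComp m V N lam (ξ lam)) ^ 2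
      + l2norm (lowerComp m V J N lam (ξ lam)) ^ 2) := by
    refine Real.le_sqrt_of_sq_le ?_
    nlinarith [sq_nonneg (l2norm (lowerComp m V J N lam (ξ lam)))]
  rw [h.kappa_eq, div_le_iff₀ (hb.trans_le h4)]
  set G := l2norm (fun x : ℝ => Real.exp (-c' * |x|))
  have hG0 : 0 ≤ G := l2norm_nonneg _
  have hA : 0 ≤ ((1 - η)⁻¹ + 3 * C) * (C' * T) * G := by positivity
  calc _ ≤ ((1 - η)⁻¹ + 3 * C) * (C' * T) * G := by
        refine (add_le_add h1 h2).trans (le_of_eq ?_)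
        ring
    _ = ((1 - η)⁻¹ + 3 * C) * (C' * T) * G / b * b := by field_simp
    _ ≤ ((1 - η)⁻¹ + 3 * C) * (C' * T) * G / b * Real.sqrt _ :=
        mul_le_mul_of_nonneg_left h4 (by positivity)
    _ = _ := by ring

/-- The pseudomode estimate at a fixed value of `lam`. -/
theorem exists_isDiracImage (h : WKBData m N V J η ε₁ c b C δ Δ r lam (ξ lam)) (hb : 0 < b)
    (hs : SquareIntegrable m V J N lam (ξ lam))
    (hV0 : MemLinftyLoc fun x => V x 0 1) (hV : MemLinftyLoc fun x => V x 1 0)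
    (hc : ∀ i, Continuous fun x => V x i i) :
    ∃ Φ : ℝ → EuclideanSpace ℂ (Fin 2), IsDiracImage m V (pseudomode m V N ξ lam) Φ ∧
      0 < l2norm (pseudomode m V N ξ lam) ∧
      l2norm (fun x => Φ x - (lam : ℂ) • pseudomode m V N ξ lam x) / l2norm (pseudomode m V N ξ lam)
        ≤ kappa m V N ξ lam + (C * r .minus + C * r .plus) := by
  have hC := h.const_nonneg
  have hr0 := h.rate_nonneg .minus
  have hr1 := h.rate_nonneg .plus
  have hΨ : pseudomode m V N ξ lam = fun x =>
      !₂[upperComp m V N lam (ξ lam) x, lowerComp m V J N lam (ξ lam) x] := funext h.pseudomode_eq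
  obtain ⟨n1, n2⟩ := l2norm_sq_pair hs.upper hs.lower
  obtain ⟨n3, n4⟩ := l2norm_sq_pair hs.residual_memLp (MemLp.zero' (ε := ℂ))
  have h3 := h.le_l2norm_upperComp hb.le hs
  set Ψ := fun x => (!₂[upperComp m V N lam (ξ lam) x, lowerComp m V J N lam (ξ lam) x] :
    EuclideanSpace ℂ (Fin 2)) with hΨdef
  have hle : l2norm (upperComp m V N lam (ξ lam)) ≤ l2norm Ψ :=
    le_of_sq_le_sq (by rw [n1]; nlinarith [sq_nonneg (l2norm (lowerComp m V J N lam (ξ lam)))])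
      (l2norm_nonneg _)
  have hpos : 0 < l2norm Ψ := (hb.trans_le h3).trans_le hle
  have hκ : kappa m V N ξ lam * l2norm Ψ = l2norm (cutError₂ m V N lam (ξ lam))
      + l2norm (cutError₁ m V N lam (ξ lam)) := by
    rw [h.kappa_eq, ← n1, Real.sqrt_sq hpos.le, div_mul_cancel₀ _ hpos.ne']
  have hdiff : (fun x => ((lam : ℂ) • Ψ x + !₂[residual m V J N lam (ξ lam) x, 0])
      - (lam : ℂ) • Ψ x) = fun x => (!₂[residual m V J N lam (ξ lam) x, 0] :
        EuclideanSpace ℂ (Fin 2)) := by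
    funext x
    rw [add_sub_cancel_left]
  have hzero : l2norm (fun _ : ℝ => (0 : ℂ)) = 0 := by simp [l2norm]
  have hres : l2norm (fun x => (!₂[residual m V J N lam (ξ lam) x, 0] :
      EuclideanSpace ℂ (Fin 2))) = l2norm (residual m V J N lam (ξ lam)) := by
    rw [hzero] at n3
    refine (sq_eq_sq₀ (l2norm_nonneg _) (l2norm_nonneg _)).1 ?_
    rw [n3]
    ring
  rw [hΨ]
  -- The image under `H_V` is `λ Ψ` plus an error in the first component alone.
  refine ⟨fun x => (lam : ℂ) • Ψ x + !₂[residual m V J N lam (ξ lam) x, 0], ?_, hpos, ?_⟩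
  · refine isDiracImage_of_lipAt hV0 hV hc (h1' := deriv (lowerComp m V J N lam (ξ lam))) n2
      ((n2.const_smul (lam : ℂ)).add n4) ?_ (h.ae_hasDerivAt_upperComp hV)
      ((h.ae_differentiableAt_lowerComp hV).mono fun x hx => hx.hasDerivAt) ?_ ?_
    · intro i x
      fin_cases i
      · exact h.lipAt_upperComp hV x
      · exact h.lipAt_lowerComp hV x
    · refine Eventually.of_forall fun x => ?_
      simp only [hΨdef, PiLp.add_apply, PiLp.smul_apply, residual, smul_eq_mul]
      simp [factor]
      ring
    · refine Eventually.of_forall fun x => ?_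
      simp only [hΨdef, PiLp.add_apply, PiLp.smul_apply, smul_eq_mul]
      simp [factor]
      ring_nf
      simp only [Complex.I_sq]
      ring
  · rw [hdiff, hres, div_le_iff₀ hpos, add_mul, hκ]
    refine hs.l2norm_residual_le.trans (add_le_add le_rfl ?_)
    have h5 := l2norm_le_mul (by positivity) hs.upper h.norm_expansionError_le
    calc _ ≤ C * (r .minus + r .plus) * l2norm (upperComp m V N lam (ξ lam)) := h5
      _ ≤ C * (r .minus + r .plus) * l2norm Ψ := by gcongr
      _ = _ := by ring

end WKBData

end DiracWKB

/-! ### The limit of large `λ`. -/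

namespace DiracWKB

variable {m : ℝ} {N : ℕ} {V : ℝ → Matrix (Fin 2) (Fin 2) ℂ} {f : ℝ → ℝ} {μ ε ν : Side → ℝ}
  {η ε₁ lam : ℝ} {J : Fin 2 → ℕ → ℝ → ℂ}

/-! ### The limit of large `lam` -/

theorem tail_eq_zero {s : Side} (h : NoCut V ν s) (m f η ε₁ d₁) :
    ∀ᶠ lam in atTop, tail V d₁ s (cutRadius m V f ν η ε₁ s lam) = 0 := by
  filter_upwards [eventually_gt_atTop 0] with lam hlam
  rw [cutRadius_eq_top h m f η ε₁ hlam, tail, if_pos rfl]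

theorem Admissible.tail_eq_exp (hV : Admissible N V f μ ε ν) (hη : 0 < η) (hε₁ : ε₁ < 1)
    {s : Side} (h : ¬ NoCut V ν s) (m d₁ : ℝ) :
    ∀ᶠ lam in atTop, tail V d₁ s (cutRadius m V f ν η ε₁ s lam) = Real.exp (-d₁ *
      F V (s.sgn * (1 / 2 * (cutRadius m V f ν η ε₁ s lam).toReal))) := by
  filter_upwards [hV.cutRadius_lt_top hη hε₁ h m] with lam hlam
  rw [tail, if_neg hlam.ne]

/-- Either the tail vanishes for large `λ`, or the radius is finite and tends to infinity, and `F`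
tends to infinity with it. -/
theorem Admissible.tendsto_tail (hV : Admissible N V f μ ε ν) (hη : 0 < η) (hε₁ : ε₁ < 1)
    {d₁ : ℝ} (hd : 0 < d₁) (s : Side) (m : ℝ) :
    Tendsto (fun lam => tail V d₁ s (cutRadius m V f ν η ε₁ s lam)) atTop (𝓝 0) := by
  by_cases h : NoCut V ν s
  · exact tendsto_const_nhds.congr' ((tail_eq_zero h m f η ε₁ d₁).mono fun _ e => e.symm)
  refine Tendsto.congr' ((hV.tail_eq_exp hη hε₁ h m d₁).mono fun _ e => e.symm) ?_
  obtain ⟨c, hc, C, hC, hF⟩ := hV.exists_le_F s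
  refine Real.tendsto_exp_atBot.comp ?_
  have key : Tendsto (fun lam => F V (s.sgn * (1 / 2 * (cutRadius m V f ν η ε₁ s lam).toReal)))
      atTop atTop := by
    refine tendsto_atTop.2 fun R => ?_
    filter_upwards [hV.eventually_lt_cutRadius hε₁ m η (max 0 (2 * ((R + C) / c))) s,
      hV.cutRadius_lt_top hη hε₁ h m] with lam h1 h2
    rw [← EReal.coe_toReal h2.ne (ne_bot_of_gt h1), EReal.coe_lt_coe_iff] at h1
    set d := (cutRadius m V f ν η ε₁ s lam).toReal
    have h3 := (le_max_left _ _).trans h1.le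
    have h4 := (le_max_right _ _).trans h1.le
    have h5 := hF (s.sgn * (1 / 2 * d)) (by rw [s.sgn_mul_sgn_mul]; linarith)
    rw [s.sgn_mul_sgn_mul] at h5
    have h6 : (R + C) / c ≤ 1 / 2 * d := by linarith
    rw [div_le_iff₀ hc] at h6
    linarith
  have := key.const_mul_atTop hd
  exact (tendsto_neg_atTop_atBot.comp this).congr fun lam => by simp

/-- A quantity bounded by a sum over the two ends splits accordingly. -/
theorem exists_split {k : ℝ → ℝ} {t : Side → ℝ → ℝ} {K : ℝ} (hK : 0 ≤ K) (hk : ∀ lam, 0 ≤ k lam)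
    (ht : ∀ s lam, 0 ≤ t s lam) (h : ∀ᶠ lam in atTop, k lam ≤ K * (t .minus lam + t .plus lam)) :
    ∃ κ : Side → ℝ → ℝ, (∀ᶠ lam in atTop, k lam = κ .minus lam + κ .plus lam) ∧
      ∀ s, ∀ᶠ lam in atTop, |κ s lam| ≤ K * t s lam := by
  -- The end `+∞` takes as much of the quantity as its own bound allows; the rest, at most the bound
  -- at `-∞`, is left to the other end.
  refine ⟨fun s lam => Side.casesOn s (k lam - min (k lam) (K * t .plus lam))
    (min (k lam) (K * t .plus lam)), Eventually.of_forall fun lam => (sub_add_cancel _ _).symm,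
    fun s => h.mono fun lam hl => ?_⟩
  have h1 := hk lam
  have h2 : 0 ≤ K * t .minus lam := mul_nonneg hK (ht _ _)
  have h3 : 0 ≤ K * t .plus lam := mul_nonneg hK (ht _ _)
  cases s
  · rw [abs_of_nonneg (sub_nonneg.2 (min_le_left _ _)), sub_le_iff_le_add, ← min_add_add_left]
    exact le_min (by linarith) (by linarith)
  · rw [abs_of_nonneg (le_min h1 h3)]
    exact min_le_right _ _

/-- The asymptotic statement in terms of uniform bounds. -/
theorem Admissible.exists_uniform (hV : Admissible N V f μ ε ν) (hsymm : ∀ᵐ x, V x 0 1 = V x 1 0)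
    (hη0 : 0 < η) (hημ : ∀ s, η < μ s)
    (hηε : ∀ s, ε s < (μ s - η) / Real.sqrt (η ^ 2 + (2 + 2 * η) ^ 2))
    (hε₁ : 0 < ε₁) (hε₁' : ε₁ < 1) {ξ : ℝ → ℝ → ℝ} (hξ : IsCutoffFamily m V f ν η ε₁ ξ) :
    ∃ a₀ > 0, ∀ a : Side → ℝ, (∀ s, a₀ ≤ a s) →
      (∀ s, ν s ≤ 0 → ∀ᶠ lam in atTop, BddAbove (growthSet m V f ν η ε₁ N s (a s) lam)) ∧
      ∃ d₁ > 0, ∃ C, 0 ≤ C ∧ ∀ᶠ lam in atTop,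
        kappa m V N ξ lam ≤ C * (tail V d₁ .minus (cutRadius m V f ν η ε₁ .minus lam)
          + tail V d₁ .plus (cutRadius m V f ν η ε₁ .plus lam)) ∧
        ∃ Φ : ℝ → EuclideanSpace ℂ (Fin 2), IsDiracImage m V (pseudomode m V N ξ lam) Φ ∧
          0 < l2norm (pseudomode m V N ξ lam) ∧
          l2norm (fun x => Φ x - (lam : ℂ) • pseudomode m V N ξ lam x)
              / l2norm (pseudomode m V N ξ lam)
            ≤ kappa m V N ξ lam + (C * rate m N V f ν η ε₁ .minus (a .minus) lam
              + C * rate m N V f ν η ε₁ .plus (a .plus) lam) := by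
  choose J hJ using fun i => exists_isJet (hV.diag_continuous i) (hV.diag_sobolev i)
  obtain ⟨a₀, ha₀, H⟩ := hV.exists_wkbData hsymm hJ hη0 hημ hηε hε₁ hε₁' hξ
  refine ⟨a₀, ha₀, fun a ha => ⟨(H a ha).1, ?_⟩⟩
  obtain ⟨c, hc, b, hb, C, hev⟩ := (H a ha).2
  -- A single admissible `λ` already yields the signs of the constants, which do not depend on `λ`.
  obtain ⟨lam₀, h₀⟩ := hev.exists
  have hC := h₀.const_nonneg
  have h1η : 0 < 1 - η := by linarith [h₀.eta_lt]
  obtain ⟨c', hc', d₁, hd₁, C', hC', hamp⟩ := hV.exists_amplitudeBound hc hC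
  have hV0 := hV.memLinftyLoc_offDiag (by decide : (0 : Fin 2) ≠ 1)
  have hV1 := hV.memLinftyLoc_offDiag (by decide : (1 : Fin 2) ≠ 0)
  set K := ((1 - η)⁻¹ + 3 * C) * C' * l2norm (fun x : ℝ => Real.exp (-c' * |x|)) / b with hK
  have hK0 : 0 ≤ K := by
    have := l2norm_nonneg (fun x : ℝ => Real.exp (-c' * |x|))
    positivity
  refine ⟨d₁, hd₁, K + C, by positivity, hev.mono fun lam h => ?_⟩
  have hT := add_nonneg (tail_nonneg V d₁ .minus (rad m V f ν η ε₁ lam .minus))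
    (tail_nonneg V d₁ .plus (rad m V f ν η ε₁ lam .plus))
  have hab := hamp m η ε₁ b lam J _ _ _ _ h
  have hs := h.squareIntegrable hV0 hV1 hsymm hc' hab hC' (mul_nonneg hC' hT)
  constructor
  · refine (h.kappa_le hb hs hc' hab (mul_nonneg hC' hT)).trans ?_
    exact mul_le_mul_of_nonneg_right (by linarith) hT
  · obtain ⟨Φ, h1, h2, h3⟩ := h.exists_isDiracImage hb hs hV0 hV1 hV.diag_continuous
    refine ⟨Φ, h1, h2, h3.trans ?_⟩
    have hr := h.rate_nonneg
    have e1 := mul_nonneg hK0 (hr .minus)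
    have e2 := mul_nonneg hK0 (hr .plus)
    linarith

end DiracWKB

end

theorem mainTheorem3 (m : ℝ) (hm : 0 ≤ m) (N : ℕ)
    (V : ℝ → Matrix (Fin 2) (Fin 2) ℂ) (f : ℝ → ℝ) (μ ε ν : DiracWKB.Side → ℝ)
    (hV : DiracWKB.Admissible N V f μ ε ν)
    (hsymm : ∀ᵐ x, V x 0 1 = V x 1 0)
    (η ε₁ : ℝ) (hη : 0 < η) (hημ : ∀ s, η < μ s)
    (hηε : ∀ s, ε s < (μ s - η) / Real.sqrt (η ^ 2 + (2 + 2 * η) ^ 2))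
    (hε₁ : 0 < ε₁) (hε₁' : ε₁ < 1)
    (ξ : ℝ → ℝ → ℝ) (hξ : DiracWKB.IsCutoffFamily m V f ν η ε₁ ξ) :
    -- the decay of `κ`
    (Tendsto (DiracWKB.kappa m V N ξ) atTop (𝓝 0) ∧
      ∃ κ : DiracWKB.Side → ℝ → ℝ,
        (∀ᶠ lam in atTop, DiracWKB.kappa m V N ξ lam = κ .minus lam + κ .plus lam) ∧
        ∀ s : DiracWKB.Side,
          (DiracWKB.NoCut V ν s → ∀ᶠ lam in atTop, κ s lam = 0) ∧
          (¬ DiracWKB.NoCut V ν s → ∃ d₁ > 0, ∃ d₂ > 0,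
            κ s =O[atTop] fun lam => Real.exp (-d₁ *
              DiracWKB.F V (s.sgn * (d₂ * (DiracWKB.cutRadius m V f ν η ε₁ s lam).toReal))))) ∧
    -- the pseudomode estimate, for all large enough thresholds `a_±`
    ∃ a₀ > 0, ∀ a : DiracWKB.Side → ℝ, (∀ s, a₀ ≤ a s) →
      ∃ σ : DiracWKB.Side → ℝ → ℝ,
        (∀ᶠ lam in atTop, ∃ Φ : ℝ → EuclideanSpace ℂ (Fin 2),
          DiracWKB.IsDiracImage m V (DiracWKB.pseudomode m V N ξ lam) Φ ∧
          0 < DiracWKB.l2norm (DiracWKB.pseudomode m V N ξ lam) ∧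
          DiracWKB.l2norm (fun x => Φ x - (lam : ℂ) • DiracWKB.pseudomode m V N ξ lam x)
              / DiracWKB.l2norm (DiracWKB.pseudomode m V N ξ lam)
            ≤ DiracWKB.kappa m V N ξ lam + (σ .minus lam + σ .plus lam)) ∧
        ∀ s : DiracWKB.Side,
          (¬ DiracWKB.DiagBounded V s → ν s ≤ 0 →
            (∀ᶠ lam in atTop, BddAbove (DiracWKB.growthSet m V f ν η ε₁ N s (a s) lam)) ∧
            σ s =O[atTop] fun lam : ℝ => max (lam ^ (-((N : ℝ) + 1)))
              (lam ^ (-(N : ℝ)) * sSup (DiracWKB.growthSet m V f ν η ε₁ N s (a s) lam))) ∧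
          (¬ DiracWKB.DiagBounded V s → 0 < ν s →
            σ s =O[atTop] fun lam : ℝ => lam ^ (-((1 + ε₁) / 2) * ((N : ℝ) + 1) + 1)) ∧
          (DiracWKB.DiagBounded V s → ν s ≤ 0 →
            σ s =O[atTop] fun lam : ℝ => lam ^ (-((N : ℝ) + 1))) ∧
          (DiracWKB.DiagBounded V s → 0 < ν s →
            σ s =O[atTop] fun lam : ℝ => lam ^ (-((1 + ε₁) / 2) * ((N : ℝ) + 1))) := by
  obtain ⟨a₀, ha₀, H⟩ := hV.exists_uniform hsymm hη hημ hηε hε₁ hε₁' hξ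
  refine ⟨?_, a₀, ha₀, fun a ha => ?_⟩
  -- The statement on `κ` does not involve the thresholds, so any admissible choice of `a` serves
  -- here.
  · obtain ⟨d₁, hd₁, C, hC, hev⟩ := (H (fun _ => a₀) fun _ => le_rfl).2
    have hk := hev.mono fun _ h => h.1
    have ht := fun s => hV.tendsto_tail (ε₁ := ε₁) hη hε₁' hd₁ s m
    constructor
    · refine squeeze_zero' (Eventually.of_forall (DiracWKB.WKBData.kappa_nonneg m V N ξ)) hk ?_
      simpa using ((ht .minus).add (ht .plus)).const_mul C
    · obtain ⟨κ, h1, h2⟩ := DiracWKB.exists_split (t := fun s lam =>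
        DiracWKB.tail V d₁ s (DiracWKB.cutRadius m V f ν η ε₁ s lam)) hC
        (DiracWKB.WKBData.kappa_nonneg m V N ξ) (fun s lam => DiracWKB.tail_nonneg _ _ _ _) hk
      refine ⟨κ, h1, fun s => ⟨fun hn => ?_, fun hn => ⟨d₁, hd₁, 1 / 2, by norm_num, ?_⟩⟩⟩
      · filter_upwards [h2 s, DiracWKB.tail_eq_zero hn m f η ε₁ d₁] with lam e1 e2
        rw [e2, mul_zero] at e1
        exact abs_nonpos_iff.1 e1
      · refine IsBigO.of_bound C ?_
        filter_upwards [h2 s, hV.tail_eq_exp hη hε₁' hn m d₁] with lam e1 e2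
        rw [e2] at e1
        rwa [Real.norm_eq_abs, Real.norm_eq_abs, Real.abs_exp]
  · obtain ⟨hbdd, d₁, -, C, -, hev⟩ := H a ha
    -- With `σ` a constant multiple of `rate`, the four asymptotic bounds are the four branches of
    -- its definition.
    refine ⟨fun s lam => C * DiracWKB.rate m N V f ν η ε₁ s (a s) lam, hev.mono fun _ h => h.2,
      fun s => ⟨fun h1 h2 => ⟨hbdd s h2, ?_⟩, fun h1 h2 => ?_, fun h1 h2 => ?_, fun h1 h2 => ?_⟩⟩
    all_goals
      refine (isBigO_const_mul_self C _ atTop).trans (isBigO_of_le _ fun lam => le_of_eq ?_)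
      simp only [DiracWKB.rate, h1, h2, not_le.2, if_true, if_false]
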